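/- Let $\Sigma$ be a smooth surface with a smooth torsion-free affine connection $D$, let $\hat f\in C^\infty(\Sigma)$, $\mu\in\mathbb R$, let $\pi:T^*\Sigma\to\Sigma$ be the cotangent bundle and $f=\pi^*\hat f$. Let $\operatorname{Hes}^D_{\hat f}(X,Y)=XY\hat f-(D_XY)\hat f$, let $\rho^D(X,Y)=\operatorname{Tr}\{Z\mapsto D_ZD_XY-D_XD_ZY-D_{[Z,X]}Y\}$, and let $\rho^D_s(X,Y)=\frac12(\rho^D(X,Y)+\rho^D(Y,X))$; put $$Q_{\hat f}=\operatorname{Hes}^D_{\hat f}+2\rho^D_s-\mu\,d\hat f\otimes d\hat f .$$ In local coordinates $(x^1,x^2)$ of $\Sigma$, with dual fibre coordinates $(x_{1'},x_{2'})$ (a covector is $\omega=x_{i'}dx^i$), and with $\alpha\circ\beta=\frac12(\alpha\otimes\beta+\beta\otimes\alpha)$, set $$g_{D,\Phi}=2\,dx^i\circ dx_{i'}+\{-2x_{k'}\Gamma_{ij}{}^k+\Phi_{ij}\}\,dx^i\circ dx^j,\qquad g_{D,\Phi,T,S}=\iota T\circ\iota S+g_{D,\Phi},$$ where $\Gamma_{ij}{}^k$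 are the Christoffel symbols of $D$, $\Phi$ is a symmetric $(0,2)$-tensor field on $\Sigma$, $T,S$ are endomorphism fields of $T\Sigma$, and $\iota T=x_{r'}T^r_i\,dx^i$. (1) Suppose $Q_{\hat f}=0$. Then for every smooth symmetric $(0,2)$-tensor field $\Phi$ on $\Sigma$ the conclusions (a)–(d) below hold on $T^*\Sigma$ for $g=g_{D,\Phi}$ and $\lambda=0$. (2) Let $0\neq C\in\mathbb R$, $\Phi=\frac2C e^{\hat f}Q_{\hat f}$ and $T=Ce^{-\hat f}\operatorname{Id}$. Then the conclusions (a)–(d) hold on $T^*\Sigma$ for $g=g_{D,\Phi,T,\operatorname{Id}}$ and $\lambda=\frac32Ce^{-f}$. (a) (Walker) $g$ is a smooth pseudo-Riemannian metric of signature $(2,2)$, and the vertical distribution $\mathfrak D=\ker d\pi$ is null and parallel for the Levi-Civita connection $\nabla$ of $g$. (b) (Self-dual) With respect to the orientation for which $\mathfrak D$ is self-dual, the anti-self-dual part $W^-$ of the Weyl tensor of $g$ vanishes. (c) (Isotropic) At every point of $T^*\Sigma$ lying over a point where $d\hat f\neq0$, one has $\nabla f\neq0$ and $g(\nabla f,\nabla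 f)=0$. (d) (Generalized quasi-Einstein) $\operatorname{Hes}_f+\rho-\mu\,df\otimes df=\lambda g$, where $\rho$ is the Ricci tensor of $g$ and $\operatorname{Hes}_f$ is the Hessian of $f$ for $\nabla$; in case (1), where $\lambda=0$ is constant, this is the quasi-Einstein equation. -/

import Mathlib

open Bundle Filter Topology
open scoped Manifold ContDiff

noncomputable section

namespace QuasiEinstein

/-! ### Coordinate formulas on a finite-dimensional real vector space

A connection on an open subset of `V` is given by its Christoffel symbols
`Γ : V → V → V → V`, where `Γ u X Y` is the value at `u` of the covariant derivative
`∇_X Y` of the constant vector fields `X`, `Y`. -/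

section Coordinates

variable {V : Type*} [NormedAddCommGroup V] [NormedSpace ℝ V]

/-- The curvature operator
`R(X,Y)Z = ∇_{[X,Y]} Z - ∇_X ∇_Y Z + ∇_Y ∇_X Z` of constant vector fields at `u`. -/
def curvature (Γ : V → V → V → V) (u X Y Z : V) : V :=
  (fderiv ℝ (fun t => Γ t X Z) u Y + Γ u Y (Γ u X Z))
    - (fderiv ℝ (fun t => Γ t Y Z) u X + Γ u X (Γ u Y Z))

/-- The Hessian `Hes_f(X,Y) = X(Y f) - (∇_X Y) f` of constant vector fields at `u`. -/
def hessian (Γ : V → V → V → V) (f : V → ℝ) (u X Y : V) : ℝ :=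
  fderiv ℝ (fun t => fderiv ℝ f t Y) u X - fderiv ℝ f u (Γ u X Y)

/-- The Ricci tensor `ρ(X,Y) = Tr (Z ↦ R(X,Z)Y)` at `u`; the trace is computed in a basis. -/
def ricci [FiniteDimensional ℝ V] (Γ : V → V → V → V) (u X Y : V) : ℝ :=
  ∑ i, (Module.finBasis ℝ V).coord i (curvature Γ u X (Module.finBasis ℝ V i) Y)

/-- The Levi-Civita Christoffel symbols of a metric `G` on an open subset of `V` (Koszul formula
for constant vector fields): `2 G(Γ(X,Y),Z) = X G(Y,Z) + Y G(X,Z) - Z G(X,Y)`. -/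
def leviCivita (G : V → V →L[ℝ] V →L[ℝ] ℝ) (u X Y : V) : V :=
  (G u).inverse ((1 / 2 : ℝ) •
    (fderiv ℝ G u X Y + fderiv ℝ G u Y X - ((fderiv ℝ G u).flip X).flip Y))

end Coordinates

/-! ### Four-dimensional linear algebra: self-duality -/

section Linear

variable {V : Type*} [AddCommGroup V] [Module ℝ V] [TopologicalSpace V]

/-- Orthonormal basis for an indefinite scalar product: `g(E_i,E_j) = ± δ_ij`. -/
def IsOrthonormal (g : V →L[ℝ] V →L[ℝ] ℝ) (b : Module.Basis (Fin 4) ℝ V) : Prop :=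
  (∀ i j, i ≠ j → g (b i) (b j) = 0) ∧ ∀ i, g (b i) (b i) = 1 ∨ g (b i) (b i) = -1

/-- A 2-form `β` is self-dual, `⋆β = β`, with respect to a scalar product of signature `(2,2)` and
an orientation: in every positively oriented orthonormal basis `E_1, …, E_4`, with
`ε_i = g(E_i,E_i)`, one has `β(E_1,E_2) = ε_3 ε_4 β(E_3,E_4)`. The remaining two equations
for the components of `⋆β = β` are this one for the bases `E_1,E_3,E_4,E_2` and
`E_1,E_4,E_2,E_3`. -/
def IsSelfDualForm (g : V →L[ℝ] V →L[ℝ] ℝ) (o : Orientation ℝ V (Fin 4))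
    (β : V → V → ℝ) : Prop :=
  ∀ b : Module.Basis (Fin 4) ℝ V, IsOrthonormal g b → b.orientation = o →
    β (b 0) (b 1) = g (b 2) (b 2) * g (b 3) (b 3) * β (b 2) (b 3)

/-- A plane `P` is self-dual, `⋆P = P`: for `u, v ∈ P`, the 2-form metrically
dual to `u ∧ v` is self-dual. -/
def IsSelfDualPlane (g : V →L[ℝ] V →L[ℝ] ℝ) (o : Orientation ℝ V (Fin 4))
    (P : Submodule ℝ V) : Prop :=
  ∀ u ∈ P, ∀ v ∈ P, IsSelfDualForm g o (fun X Y => g u X * g v Y - g u Y * g v X)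

/-- Neutral signature `(2,2)`; this includes symmetry and nondegeneracy. -/
def HasNeutralSignature (g : V →L[ℝ] V →L[ℝ] ℝ) : Prop :=
  ∃ b : Module.Basis (Fin 4) ℝ V, (∀ i j, i ≠ j → g (b i) (b j) = 0) ∧
    g (b 0) (b 0) = 1 ∧ g (b 1) (b 1) = 1 ∧ g (b 2) (b 2) = -1 ∧ g (b 3) (b 3) = -1

end Linear

/-! ### Tensors on manifolds (without boundary)

Recall that `TangentSpace I p` is the model space `E`, a tangent vector at `p` being
identified with its components in the preferred chart `extChartAt I p`. A tensor at `p` can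
therefore be given by its components at `p` in that chart. -/

section Manifold

variable {E : Type*} [NormedAddCommGroup E] [NormedSpace ℝ E] {H : Type*} [TopologicalSpace H]
  {I : ModelWithCorners ℝ E H} {M : Type*} [TopologicalSpace M] [ChartedSpace H M]

/-- The components, in the preferred chart around `p`, of a field of bilinear forms:
its pull-back under the inverse of the chart. -/
def inChart (g : Π p : M, TangentSpace I p →L[ℝ] TangentSpace I p →L[ℝ] ℝ) (p : M) (u : E) :
    E →L[ℝ] E →L[ℝ] ℝ :=
  let A : E →L[ℝ] E := mfderiv 𝓘(ℝ, E) I (extChartAt I p).symm u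
  let B : E →L[ℝ] E →L[ℝ] ℝ := g ((extChartAt I p).symm u)
  B.bilinearComp A A

/-- Smooth `(0,2)`-tensor fields: the components are smooth in charts. -/
def IsSmoothTensor (g : Π p : M, TangentSpace I p →L[ℝ] TangentSpace I p →L[ℝ] ℝ) : Prop :=
  ∀ p : M, ContDiffOn ℝ ∞ (inChart g p) (extChartAt I p).target

/-- The coordinate vector field, with constant components `w`, of the preferred chart
around `p` (relevant only on the domain of that chart). -/
def coordField (I : ModelWithCorners ℝ E H) (p : M) (w : E) : Π x : M, TangentSpace I x :=
  VectorField.mpullback I 𝓘(ℝ, E) (extChartAt I p) (fun _ => w)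

/-- The Christoffel symbols of an affine connection in the preferred chart around `p`:
`Γ u v w` is the component vector of `D_v w` at the point with coordinates `u`,
where `v`, `w` are extended as coordinate vector fields. -/
def affineChristoffel [IsManifold I 1 M]
    (D : CovariantDerivative I E (TangentSpace I : M → Type _)) (p : M)
    (u v w : E) : E :=
  let x : M := (extChartAt I p).symm u
  mfderiv I 𝓘(ℝ, E) (extChartAt I p) x (D (coordField I p w) x (coordField I p v x))

/-- The Hessian `Hes^D_f` of a function on an affine manifold. -/
def affineHessian [IsManifold I 1 M]
    (D : CovariantDerivative I E (TangentSpace I : M → Type _)) (f : M → ℝ)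
    (p : M) (X Y : TangentSpace I p) : ℝ :=
  hessian (affineChristoffel D p) (f ∘ (extChartAt I p).symm) (extChartAt I p p) X Y

/-- The Ricci tensor `ρ^D` of an affine manifold. -/
def affineRicci [IsManifold I 1 M] [FiniteDimensional ℝ E]
    (D : CovariantDerivative I E (TangentSpace I : M → Type _))
    (p : M) (X Y : TangentSpace I p) : ℝ :=
  ricci (affineChristoffel D p) (extChartAt I p p) X Y

/-- The symmetric Ricci tensor `ρ^D_s` of an affine manifold. -/
def affineRicciSymm [IsManifold I 1 M] [FiniteDimensional ℝ E]
    (D : CovariantDerivative I E (TangentSpace I : M → Type _))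
    (p : M) (X Y : TangentSpace I p) : ℝ :=
  (1 / 2 : ℝ) * (affineRicci D p X Y + affineRicci D p Y X)

/-- The tensor `Hes^D_f + 2 ρ^D_s - μ df ⊗ df` of an affine manifold. -/
def affineQETensor [IsManifold I 1 M] [FiniteDimensional ℝ E]
    (D : CovariantDerivative I E (TangentSpace I : M → Type _)) (f : M → ℝ) (μ : ℝ)
    (p : M) (X Y : TangentSpace I p) : ℝ :=
  affineHessian D f p X Y + 2 * affineRicciSymm D p X Y
    - μ * (mvfderiv I f p X * mvfderiv I f p Y)

/-! #### Pseudo-Riemannian geometry -/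

/-- The Hessian of a function with respect to the Levi-Civita connection. -/
def metricHessian (g : Π p : M, TangentSpace I p →L[ℝ] TangentSpace I p →L[ℝ] ℝ) (f : M → ℝ)
    (p : M) (X Y : TangentSpace I p) : ℝ :=
  hessian (leviCivita (inChart g p)) (f ∘ (extChartAt I p).symm) (extChartAt I p p) X Y

/-- The curvature operator of the Levi-Civita connection. -/
def metricCurvature (g : Π p : M, TangentSpace I p →L[ℝ] TangentSpace I p →L[ℝ] ℝ)
    (p : M) (X Y Z : TangentSpace I p) : TangentSpace I p :=
  let result : E := curvature (leviCivita (inChart g p)) (extChartAt I p p) X Y Z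
  result

/-- The covariant derivative `∇_v Y` at `p`, for the Levi-Civita connection, of a
vector field `Y`. -/
def metricDeriv (g : Π p : M, TangentSpace I p →L[ℝ] TangentSpace I p →L[ℝ] ℝ)
    (Y : Π q : M, TangentSpace I q) (p : M) (v : TangentSpace I p) : TangentSpace I p :=
  let components : E → E := fun u =>
    mfderiv I 𝓘(ℝ, E) (extChartAt I p) ((extChartAt I p).symm u) (Y ((extChartAt I p).symm u))
  let w : E := v
  let y : E := Y p
  let result : E := fderiv ℝ components (extChartAt I p p) w
    + leviCivita (inChart g p) (extChartAt I p p) w y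
  result

/-- The gradient `∇f`: `g(∇f, X) = df(X)`. -/
def gradient (g : Π p : M, TangentSpace I p →L[ℝ] TangentSpace I p →L[ℝ] ℝ) (f : M → ℝ)
    (p : M) : TangentSpace I p :=
  (g p).inverse (mvfderiv I f p)

/-- On `U`, the gradient of `f` is null and nowhere zero. -/
def IsIsotropicOn (g : Π p : M, TangentSpace I p →L[ℝ] TangentSpace I p →L[ℝ] ℝ) (f : M → ℝ)
    (U : Set M) : Prop :=
  ∀ p ∈ U, g p (gradient g f p) (gradient g f p) = 0 ∧ gradient g f p ≠ 0

/-- A pseudo-Riemannian metric of neutral signature on a four-dimensional manifold. -/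
def IsNeutralMetric (g : Π p : M, TangentSpace I p →L[ℝ] TangentSpace I p →L[ℝ] ℝ) : Prop :=
  IsSmoothTensor g ∧ ∀ p, HasNeutralSignature (g p)

/-- `𝔇` is a smooth null parallel distribution of planes. -/
structure IsWalker [IsManifold I 1 M]
    (g : Π p : M, TangentSpace I p →L[ℝ] TangentSpace I p →L[ℝ] ℝ)
    (𝔇 : Π p : M, Submodule ℝ (TangentSpace I p)) : Prop where
  rank_two : ∀ p, Module.finrank ℝ (𝔇 p) = 2
  smooth : ∀ p, ∃ Y : Fin 2 → Π q : M, TangentSpace I q,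
    (∀ i, ContMDiffAt I I.tangent ∞ (fun q => (⟨q, Y i q⟩ : TangentBundle I M)) p) ∧
    ∀ᶠ q in 𝓝 p, 𝔇 q = Submodule.span ℝ (Set.range fun i => Y i q)
  null : ∀ p, ∀ X ∈ 𝔇 p, ∀ Y ∈ 𝔇 p, g p X Y = 0
  parallel : ∀ (p : M) (Y : Π q : M, TangentSpace I q),
    ContMDiffAt I I.tangent ∞ (fun q => (⟨q, Y q⟩ : TangentBundle I M)) p →
    (∀ᶠ q in 𝓝 p, Y q ∈ 𝔇 q) → ∀ v : TangentSpace I p, metricDeriv g Y p v ∈ 𝔇 p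

variable [FiniteDimensional ℝ E]

/-- The Ricci tensor of the Levi-Civita connection. -/
def metricRicci (g : Π p : M, TangentSpace I p →L[ℝ] TangentSpace I p →L[ℝ] ℝ)
    (p : M) (X Y : TangentSpace I p) : ℝ :=
  ricci (leviCivita (inChart g p)) (extChartAt I p p) X Y

/-- The scalar curvature `τ = g^{ij} ρ_{ij}`. -/
def scalarCurvature (g : Π p : M, TangentSpace I p →L[ℝ] TangentSpace I p →L[ℝ] ℝ)
    (p : M) : ℝ :=
  let b : Module.Basis (Fin (Module.finrank ℝ E)) ℝ E := Module.finBasis ℝ E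
  let G : E →L[ℝ] E →L[ℝ] ℝ := g p
  ∑ i, metricRicci g p (b i) (G.inverse (LinearMap.toContinuousLinearMap (b.coord i)))

/-- The Weyl tensor of a four-dimensional pseudo-Riemannian manifold. -/
def weyl (g : Π p : M, TangentSpace I p →L[ℝ] TangentSpace I p →L[ℝ] ℝ)
    (p : M) (X Y Z T : TangentSpace I p) : ℝ :=
  g p (metricCurvature g p X Y Z) T
    + scalarCurvature g p / 6 * (g p X Z * g p Y T - g p X T * g p Y Z)
    + 1 / 2 * (metricRicci g p X T * g p Y Z - metricRicci g p X Z * g p Y T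
        + metricRicci g p Y Z * g p X T - metricRicci g p Y T * g p X Z)

/-- The Walker manifold `(M, g, 𝔇)` is self-dual, `W⁻ = 0`, for its canonical orientation: the
one for which `𝔇` is self-dual. This orientation of `T_pM` is uniquely determined by `g_p`
and the null plane `𝔇_p`, hence depends continuously on `p`. The condition `W⁻ = 0` says that
the Weyl tensor takes values in the self-dual 2-forms. -/
def IsSelfDualWalker (g : Π p : M, TangentSpace I p →L[ℝ] TangentSpace I p →L[ℝ] ℝ)
    (𝔇 : Π p : M, Submodule ℝ (TangentSpace I p)) : Prop :=
  ∀ p, ∃ o : Orientation ℝ (TangentSpace I p) (Fin 4), IsSelfDualPlane (g p) o (𝔇 p) ∧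
    ∀ Z T : TangentSpace I p, IsSelfDualForm (g p) o (fun X Y => weyl g p X Y Z T)

/-- The generalized quasi-Einstein equation `Hes_f + ρ - μ df ⊗ df = lam g` with
smooth `lam`. It is the quasi-Einstein equation when `lam` is constant. -/
def IsGeneralizedQuasiEinstein
    (g : Π p : M, TangentSpace I p →L[ℝ] TangentSpace I p →L[ℝ] ℝ)
    (f : M → ℝ) (μ : ℝ) (lam : M → ℝ) : Prop :=
  ContMDiff I 𝓘(ℝ) ∞ f ∧ ContMDiff I 𝓘(ℝ) ∞ lam ∧
    ∀ (p : M) (X Y : TangentSpace I p),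
      metricHessian g f p X Y + metricRicci g p X Y - μ * (mvfderiv I f p X * mvfderiv I f p Y)
        = lam p * g p X Y

end Manifold

/-! ### Riemannian extensions on the cotangent bundle of a surface -/

/-- The model space of a surface. -/
abbrev Plane : Type := EuclideanSpace ℝ (Fin 2)

section Cotangent

variable (S : Type*) [TopologicalSpace S] [ChartedSpace Plane S] [IsManifold (𝓡 2) ∞ S]

/-- The cotangent bundle `T*S`; its preferred chart around `(x, ω)` is the natural chart
`(x¹, x², x_{1'}, x_{2'})` induced by the preferred chart of `S` around `x`. -/
abbrev Cotangent : Type _ :=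
  TotalSpace (Plane →L[ℝ] ℝ) (fun x : S => TangentSpace (𝓡 2) x →L[ℝ] ℝ)

/-- The model with corners of the cotangent bundle. -/
abbrev cotangentModel : ModelWithCorners ℝ (Plane × (Plane →L[ℝ] ℝ))
    (ModelProd Plane (Plane →L[ℝ] ℝ)) :=
  (𝓡 2).prod 𝓘(ℝ, Plane →L[ℝ] ℝ)

variable {S}

/-- The `i`-th coordinate vector of the plane. -/
def coordVec (i : Fin 2) : Plane := EuclideanSpace.single i 1

/-- The differential of the projection `π : T*S → S`. -/
def dproj (q : Cotangent S) :
    TangentSpace cotangentModel q →L[ℝ] TangentSpace (𝓡 2) q.proj :=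
  mfderiv cotangentModel (𝓡 2) (fun r : Cotangent S => r.proj) q

/-- The vertical distribution `ker dπ`, spanned by `∂_{x_{1'}}`, `∂_{x_{2'}}`. -/
def vertical (q : Cotangent S) : Submodule ℝ (TangentSpace cotangentModel q) :=
  LinearMap.ker (dproj q).toLinearMap

/-- The 1-form `dxⁱ` of the natural chart around `q`, at `q`. -/
def dx (q : Cotangent S) (i : Fin 2) : TangentSpace cotangentModel q →L[ℝ] ℝ :=
  (EuclideanSpace.proj i : Plane →L[ℝ] ℝ).comp
    (ContinuousLinearMap.fst ℝ Plane (Plane →L[ℝ] ℝ))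

/-- The 1-form `dx_{i'}` of the natural chart around `q`, at `q`. -/
def dxFibre (q : Cotangent S) (i : Fin 2) : TangentSpace cotangentModel q →L[ℝ] ℝ :=
  (ContinuousLinearMap.apply ℝ ℝ (coordVec i)).comp
    (ContinuousLinearMap.snd ℝ Plane (Plane →L[ℝ] ℝ))

/-- The symmetric product `α ∘ β = ½ (α ⊗ β + β ⊗ α)` of covectors. -/
def symProd {V : Type*} [AddCommGroup V] [Module ℝ V] [TopologicalSpace V]
    (α β : V →L[ℝ] ℝ) : V →L[ℝ] V →L[ℝ] ℝ :=
  (1 / 2 : ℝ) • (α.smulRight β + β.smulRight α)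

/-- The deformed Riemannian extension
`g_{D,Φ} = 2 dxⁱ ∘ dx_{i'} + {-2 x_{k'} Γ_ij^k + Φ_ij} dxⁱ ∘ dxʲ`. -/
def deformedExtension
    (D : CovariantDerivative (𝓡 2) Plane (TangentSpace (𝓡 2) : S → Type _))
    (Φ : Π x : S, TangentSpace (𝓡 2) x → TangentSpace (𝓡 2) x → ℝ) (q : Cotangent S) :
    TangentSpace cotangentModel q →L[ℝ] TangentSpace cotangentModel q →L[ℝ] ℝ :=
  let x : S := q.proj
  let fibreCoord : Fin 2 → ℝ := fun k => q.2 (coordVec k)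
  let Γ : Fin 2 → Fin 2 → Fin 2 → ℝ := fun i j k =>
    affineChristoffel D x (extChartAt (𝓡 2) x x) (coordVec i) (coordVec j) k
  (2 : ℝ) • ∑ i, symProd (dx q i) (dxFibre q i)
    + ∑ i, ∑ j, (-2 * (∑ k, fibreCoord k * Γ i j k) + Φ x (coordVec i) (coordVec j)) •
        symProd (dx q i) (dx q j)

/-- The evaluation `ιT` of an endomorphism field `T`, the 1-form `x_{r'} T^r_i dxⁱ`. -/
def evalForm (T : Π x : S, TangentSpace (𝓡 2) x →L[ℝ] TangentSpace (𝓡 2) x)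
    (q : Cotangent S) : TangentSpace cotangentModel q →L[ℝ] ℝ :=
  (q.2.comp (T q.proj)).comp (dproj q)

/-- The modified Riemannian extension `g_{D,Φ,T,T'} = ιT ∘ ιT' + g_{D,Φ}`. -/
def modifiedExtension
    (D : CovariantDerivative (𝓡 2) Plane (TangentSpace (𝓡 2) : S → Type _))
    (Φ : Π x : S, TangentSpace (𝓡 2) x → TangentSpace (𝓡 2) x → ℝ)
    (T T' : Π x : S, TangentSpace (𝓡 2) x →L[ℝ] TangentSpace (𝓡 2) x) (q : Cotangent S) :
    TangentSpace cotangentModel q →L[ℝ] TangentSpace cotangentModel q →L[ℝ] ℝ :=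
  symProd (evalForm T q) (evalForm T' q) + deformedExtension D Φ q

/-- `(T*S, g, f, μ)` with `f = π* fh` is a self-dual isotropic generalized quasi-Einstein Walker
manifold of signature `(2,2)` with factor `lam`; the Walker distribution is the vertical one.
Isotropy is asserted on the open set of points lying over points where `dfh ≠ 0`
(at the remaining points `∇f = 0`). -/
structure IsSelfDualIsotropicQE
    (g : Π q : Cotangent S,
      TangentSpace cotangentModel q →L[ℝ] TangentSpace cotangentModel q →L[ℝ] ℝ)
    (fh : S → ℝ) (μ : ℝ) (lam : Cotangent S → ℝ) : Prop where
  metric : IsNeutralMetric g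
  walker : IsWalker g vertical
  selfDual : IsSelfDualWalker g vertical
  isotropic : IsIsotropicOn g (fun q : Cotangent S => fh q.proj)
    {q : Cotangent S | mvfderiv (𝓡 2) fh q.proj ≠ 0}
  quasiEinstein : IsGeneralizedQuasiEinstein g (fun q : Cotangent S => fh q.proj) μ lam

end Cotangent

end QuasiEinstein

end

noncomputable section

set_option maxSynthPendingDepth 3

namespace QuasiEinstein

/-! ### Local shortcuts for recurring instance problems -/

-- Both cases belong to one family: for a function c on the surface take g = c ι(Id) ∘ ι(Id) +
-- g_{D,Φ} (`scalarExtension`). Case (1) is c = 0 and case (2) is c = C e^{-f}. Write ω for the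
-- tautological 1-form, whose value at a covector is that covector. In natural coordinates g is the
-- duality pairing of V × V* plus the base form b = -2ω(Γ) + Φ + c ω⊗ω, which is polynomial in the
-- fibre variable.
--
-- All metric components with a vertical argument are constant. Koszul's formula therefore gives the
-- base component of the Levi-Civita connection at once: Γ(X,Y) - (c/2)(ω(Y)X + ω(X)Y)
-- (`leviCivita_fst`). So the fibres are parallel, and they are null because g vanishes on them. For
-- a function f of the base point, the gradient is the vertical vector df, hence null, and the
-- Hessian is Hes^D_f + (c/2)(ω⊗df + df⊗ω).
--
-- Curvature components with two vertical arguments in the same pair vanish. Those with one vertical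
-- argument, or one in each pair, are short expressions in the curvature of D, c and dc. The purely
-- horizontal components are never computed, since neither the Ricci tensor nor the half of the Weyl
-- tensor that has to vanish involves them. Contraction gives (`ricci_walkerMetric`) ρ = (3/2) c g +
-- 2ρ^D_s - (c/2)Φ + ½(ω⊗dc + dc⊗ω), with scalar curvature 6c. If dc = -c df, the mixed terms of
-- Hes_f and ρ cancel, so Hes_f + ρ - μ df⊗df = (3/2) c g + (Q - (c/2)Φ). The equation thus reduces
-- to Q = (c/2)Φ, which holds in both cases (`isGeneralizedQuasiEinstein_scalarExtension`).
--
-- For self-duality, complete the vertical vectors v_j to a null basis by null lifts a_i of the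
-- coordinate vectors. In its orientation a 2-form β with β(a_i,v_j) = s δ_ij for some s is
-- self-dual (`IsNullBasis.isSelfDualForm`), and a direct computation puts W(a_i,v_j,·,·) in this
-- form (`walkerWeyl_mixed`).
--
-- It remains to pass from coordinates to the manifold. The tensors are defined at each point
-- through the chart centred there, so one fixed chart describes them only after invariance under
-- chart changes is proved. For g the inhomogeneous term in the law of the Christoffel symbols
-- cancels the one in the differential of the fibre coordinates (`inChart_scalarExtension`). For Q
-- the same law makes curvature, Ricci tensor and Hessian tensorial (`IsConnectionChange`).

local instance completeSpace_prod_dual : CompleteSpace (Plane × (Plane →L[ℝ] ℝ)) :=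
  inferInstance

local instance t2Space_prod_dual : T2Space (Plane × (Plane →L[ℝ] ℝ)) :=
  inferInstance

local instance continuousSMul_plane : ContinuousSMul ℝ Plane :=
  inferInstance

local instance continuousSMul_prod_dual : ContinuousSMul ℝ (Plane × (Plane →L[ℝ] ℝ)) :=
  inferInstance

local instance isManifold_plane_one {S : Type*} [TopologicalSpace S]
    [ChartedSpace Plane S] [IsManifold (𝓡 2) ∞ S] :
    IsManifold (𝓡 2) 1 S :=
  inferInstance

local instance isManifold_plane_two {S : Type*} [TopologicalSpace S]
    [ChartedSpace Plane S] [IsManifold (𝓡 2) ∞ S] :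
    IsManifold (𝓡 2) 2 S :=
  inferInstance

local instance topologicalSpace_cotangent {S : Type*} [TopologicalSpace S]
    [ChartedSpace Plane S] [IsManifold (𝓡 2) ∞ S] :
    TopologicalSpace (Cotangent S) :=
  inferInstance

local instance topologicalSpace_tangent {S : Type*} [TopologicalSpace S]
    [ChartedSpace Plane S] [IsManifold (𝓡 2) ∞ S] :
    TopologicalSpace (TotalSpace Plane (TangentSpace (𝓡 2) : S → Type _)) :=
  inferInstance

/-! ### Levi-Civita connection and lowered curvature of a metric in coordinates. -/

section LeviCivita

variable {E : Type*} [NormedAddCommGroup E] [NormedSpace ℝ E]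
  {G : E → E →L[ℝ] E →L[ℝ] ℝ} {u : E}

/-- Twice differentiable, symmetric and nondegenerate metrics near a point. -/
structure IsMetricAt (G : E → E →L[ℝ] E →L[ℝ] ℝ) (u : E) : Prop where
  contDiffAt : ContDiffAt ℝ 2 G u
  symm : ∀ᶠ t in 𝓝 u, ∀ X Y, G t X Y = G t Y X
  invertible : ∀ᶠ t in 𝓝 u, (G t).IsInvertible

theorem leviCivita_lower (h : (G u).IsInvertible) (X Y Z : E) :
    G u (leviCivita G u X Y) Z
      = 1 / 2 * (fderiv ℝ G u X Y Z + fderiv ℝ G u Y X Z - fderiv ℝ G u Z X Y) := by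
  unfold leviCivita
  rw [h.self_apply_inverse]
  simp

theorem _root_.ContDiffAt.differentiableAt_fderiv_apply {F : Type*} [NormedAddCommGroup F]
    [NormedSpace ℝ F] {f : E → F} (h : ContDiffAt ℝ 2 f u) (A : E) :
    DifferentiableAt ℝ (fun t => fderiv ℝ f t A) u :=
  ((h.fderiv_right (m := 1) (by norm_num)).differentiableAt (by norm_num)).clm_apply
    (differentiableAt_const A)

theorem fderiv_metric_apply (h : DifferentiableAt ℝ G u) (X Y Z : E) :
    fderiv ℝ G u X Y Z = fderiv ℝ (fun t => G t Y Z) u X := by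
  have := (h.hasFDerivAt.clm_apply (hasFDerivAt_const Y u)).clm_apply (hasFDerivAt_const Z u)
  rw [this.fderiv]; simp

theorem _root_.DifferentiableAt.clm_inverse [CompleteSpace E] {F : Type*} [NormedAddCommGroup F]
    [NormedSpace ℝ F] {f : E → E →L[ℝ] F} (h : DifferentiableAt ℝ f u) (hi : (f u).IsInvertible) :
    DifferentiableAt ℝ (fun t => (f t).inverse) u :=
  DifferentiableAt.comp u (f := f)
    ((hi.contDiffAt_map_inverse (n := 1)).differentiableAt (by norm_num)) h

/-- The second derivative `∂_X ∂_Y G(Z,T)` of the components of a metric. -/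
def secondDeriv (G : E → E →L[ℝ] E →L[ℝ] ℝ) (u X Y Z T : E) : ℝ :=
  fderiv ℝ (fun t => fderiv ℝ (fun s => G s Z T) t Y) u X

/-- The curvature of a metric, all indices lowered. -/
def loweredCurvature (G : E → E →L[ℝ] E →L[ℝ] ℝ) (u X Y Z T : E) : ℝ :=
  1 / 2 * (secondDeriv G u Y Z X T - secondDeriv G u Y T X Z
      - secondDeriv G u X Z Y T + secondDeriv G u X T Y Z)
    + G u (leviCivita G u Y Z) (leviCivita G u X T)
    - G u (leviCivita G u X Z) (leviCivita G u Y T)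

theorem IsMetricAt.contDiffAt_apply (h : IsMetricAt G u) (Y Z : E) :
    ContDiffAt ℝ 2 (fun t => G t Y Z) u :=
  (h.contDiffAt.clm_apply contDiffAt_const).clm_apply contDiffAt_const

theorem IsMetricAt.differentiableAt (h : IsMetricAt G u) : DifferentiableAt ℝ G u :=
  h.contDiffAt.differentiableAt (by norm_num)

theorem IsMetricAt.eventually_differentiableAt (h : IsMetricAt G u) :
    ∀ᶠ t in 𝓝 u, DifferentiableAt ℝ G t := by
  filter_upwards [h.contDiffAt.eventually (by simp)] with t ht
    using ht.differentiableAt (by norm_num)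

theorem IsMetricAt.differentiableAt_leviCivita [CompleteSpace E] (h : IsMetricAt G u) (X Y : E) :
    DifferentiableAt ℝ (fun t => leviCivita G t X Y) u := by
  have hi := h.differentiableAt.clm_inverse h.invertible.self_of_nhds
  have k := fun A => h.contDiffAt.differentiableAt_fderiv_apply A
  -- The covector Z ↦ ∂_Z G(X,Y) is the differential of the scalar function G(X,Y), so it is
  -- differentiable because that function is C².
  have hf : DifferentiableAt ℝ (fun t => ((fderiv ℝ G t).flip X).flip Y) u := by
    refine (((h.contDiffAt_apply X Y).fderiv_right (m := 1) (by norm_num)).differentiableAt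
      (by norm_num)).congr_of_eventuallyEq ?_
    filter_upwards [h.eventually_differentiableAt] with t ht
    ext Z
    simp [fderiv_metric_apply ht]
  unfold leviCivita
  exact hi.clm_apply (((((k X).clm_apply (differentiableAt_const Y)).add
    ((k Y).clm_apply (differentiableAt_const X))).sub hf).const_smul (1 / 2 : ℝ))

theorem IsMetricAt.differentiableAt_fderiv (h : IsMetricAt G u) (X Y Z : E) :
    DifferentiableAt ℝ (fun t => fderiv ℝ (fun s => G s Y Z) t X) u :=
  (((h.contDiffAt_apply Y Z).fderiv_right (m := 1) (by norm_num)).differentiableAt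
    (by norm_num)).clm_apply (differentiableAt_const X)

theorem IsMetricAt.fderiv_symm (h : IsMetricAt G u) (X Y Z : E) :
    fderiv ℝ G u X Y Z = fderiv ℝ G u X Z Y := by
  rw [fderiv_metric_apply h.differentiableAt, fderiv_metric_apply h.differentiableAt]
  congr 1
  apply Filter.EventuallyEq.fderiv_eq
  filter_upwards [h.symm] with t ht using ht _ _

theorem IsMetricAt.secondDeriv_comm (h : IsMetricAt G u) (X Y Z T : E) :
    secondDeriv G u X Y Z T = secondDeriv G u Y X Z T := by
  have hd := ((h.contDiffAt_apply Z T).fderiv_right (m := 1) (by norm_num)).differentiableAt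
    (by norm_num)
  have e (A B : E) : secondDeriv G u A B Z T = fderiv ℝ (fderiv ℝ (fun s => G s Z T)) u A B := by
    unfold secondDeriv
    rw [(hd.hasFDerivAt.clm_apply (hasFDerivAt_const B u)).fderiv]; simp
  rw [e, e]
  exact ((h.contDiffAt_apply Z T).isSymmSndFDerivAt (by simp)) X Y

/-- Koszul's formula holds near `u`, so it can be differentiated in the direction `Y`; the product
rule leaves the correction in which the metric itself is differentiated. -/
theorem IsMetricAt.lower_fderiv_leviCivita [CompleteSpace E] (h : IsMetricAt G u) (X Y Z T : E) :
    G u (fderiv ℝ (fun t => leviCivita G t X Z) u Y) T =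
      1 / 2 * (secondDeriv G u Y X Z T + secondDeriv G u Y Z X T
        - secondDeriv G u Y T X Z) - fderiv ℝ G u Y (leviCivita G u X Z) T := by
  have hl := h.differentiableAt_leviCivita X Z
  have e : (fun t => G t (leviCivita G t X Z) T) =ᶠ[𝓝 u] fun t =>
      1 / 2 * (fderiv ℝ (fun s => G s Z T) t X + fderiv ℝ (fun s => G s X T) t Z
        - fderiv ℝ (fun s => G s X Z) t T) := by
    filter_upwards [h.invertible, h.eventually_differentiableAt] with t ht hdt
    rw [leviCivita_lower ht]
    simp only [fderiv_metric_apply hdt]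
  have e1 := congrArg (fun L : E →L[ℝ] ℝ => L Y) e.fderiv_eq
  have k (A B C : E) := (h.differentiableAt_fderiv A B C).hasFDerivAt
  have r0 := ((k X Z T).add (k Z X T)).sub (k T X Z)
  have r := (r0.const_mul (1 / 2 : ℝ)).fderiv
  have l := ((h.differentiableAt.hasFDerivAt.clm_apply hl.hasFDerivAt).clm_apply
    (hasFDerivAt_const T u)).fderiv
  have l' : fderiv ℝ (fun t => G t (leviCivita G t X Z) T) u Y = _ := congrArg (fun L : E →L[ℝ] ℝ => L Y) l
  have r' : fderiv ℝ (fun t => 1 / 2 * (fderiv ℝ (fun s => G s Z T) t X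
      + fderiv ℝ (fun s => G s X T) t Z - fderiv ℝ (fun s => G s X Z) t T)) u Y = _ :=
    congrArg (fun L : E →L[ℝ] ℝ => L Y) r
  rw [l', r'] at e1
  simp at e1
  unfold secondDeriv
  linarith

/-- Metric compatibility (`met`) rewrites each derivative of G as two Christoffel terms. The
iterated terms Γ(Y,Γ(X,Z)) then cancel, and so do the second derivatives in X and Y of G(Z,T). -/
theorem IsMetricAt.curvature_lower [CompleteSpace E] (h : IsMetricAt G u) (X Y Z T : E) :
    G u (curvature (leviCivita G) u X Y Z) T = loweredCurvature G u X Y Z T := by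
  have hs := h.symm.self_of_nhds
  have hi := h.invertible.self_of_nhds
  have met (A B C : E) : fderiv ℝ G u A B C
      = G u (leviCivita G u A B) C + G u (leviCivita G u A C) B := by
    rw [leviCivita_lower hi, leviCivita_lower hi, h.fderiv_symm A C B]
    ring
  unfold curvature loweredCurvature
  simp only [map_sub, map_add, sub_apply, add_apply]
  rw [h.lower_fderiv_leviCivita, h.lower_fderiv_leviCivita, met, met, h.secondDeriv_comm X Y,
    hs (leviCivita G u Y T), hs (leviCivita G u X T)]
  ring

theorem IsMetricAt.leviCivita_comm (h : IsMetricAt G u) (X Y : E) :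
    leviCivita G u X Y = leviCivita G u Y X := by
  unfold leviCivita
  congr 2
  ext Z
  simp [h.fderiv_symm Z X Y, add_comm]

theorem IsMetricAt.secondDeriv_symm (h : IsMetricAt G u) (X Y Z T : E) :
    secondDeriv G u X Y Z T = secondDeriv G u X Y T Z := by
  unfold secondDeriv
  congr 1
  apply Filter.EventuallyEq.fderiv_eq
  filter_upwards [h.symm.eventually_nhds] with t ht
  congr 1
  apply Filter.EventuallyEq.fderiv_eq
  filter_upwards [ht] with s hs using hs _ _

theorem loweredCurvature_swap_left (X Y Z T : E) :
    loweredCurvature G u X Y Z T = -loweredCurvature G u Y X Z T := by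
  unfold loweredCurvature
  ring

theorem IsMetricAt.loweredCurvature_swap_right (h : IsMetricAt G u) (X Y Z T : E) :
    loweredCurvature G u X Y Z T = -loweredCurvature G u X Y T Z := by
  unfold loweredCurvature
  rw [h.symm.self_of_nhds (leviCivita G u Y Z), h.symm.self_of_nhds (leviCivita G u X Z)]
  ring

theorem IsMetricAt.loweredCurvature_pair (h : IsMetricAt G u) (X Y Z T : E) :
    loweredCurvature G u X Y Z T = loweredCurvature G u Z T X Y := by
  unfold loweredCurvature
  rw [h.symm.self_of_nhds (leviCivita G u T X), h.secondDeriv_comm Y Z, h.secondDeriv_comm Y T,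
    h.secondDeriv_comm X Z, h.secondDeriv_comm X T, h.leviCivita_comm X T,
    h.leviCivita_comm Y Z, h.leviCivita_comm X Z, h.leviCivita_comm Y T,
    h.secondDeriv_symm _ _ X T, h.secondDeriv_symm _ _ X Z, h.secondDeriv_symm _ _ Y T,
    h.secondDeriv_symm _ _ Y Z]
  ring

section Multilinear

variable [CompleteSpace E]

/-- In the last slot linearity is that of G. The skew and pair symmetries carry it to the other
three slots, so linearity of the differentiated Christoffel symbols need not be proved. -/
theorem IsMetricAt.loweredCurvature_add₄ (h : IsMetricAt G u) (X Y Z T T' : E) :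
    loweredCurvature G u X Y Z (T + T')
      = loweredCurvature G u X Y Z T + loweredCurvature G u X Y Z T' := by
  simp only [← h.curvature_lower, map_add]

theorem IsMetricAt.loweredCurvature_smul₄ (h : IsMetricAt G u) (X Y Z T : E) (a : ℝ) :
    loweredCurvature G u X Y Z (a • T) = a * loweredCurvature G u X Y Z T := by
  simp only [← h.curvature_lower, map_smul, smul_eq_mul]

theorem IsMetricAt.loweredCurvature_add₃ (h : IsMetricAt G u) (X Y Z Z' T : E) :
    loweredCurvature G u X Y (Z + Z') T
      = loweredCurvature G u X Y Z T + loweredCurvature G u X Y Z' T := by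
  rw [h.loweredCurvature_swap_right, h.loweredCurvature_add₄, h.loweredCurvature_swap_right _ _ T,
    h.loweredCurvature_swap_right _ _ T]
  ring

theorem IsMetricAt.loweredCurvature_add₂ (h : IsMetricAt G u) (X Y Y' Z T : E) :
    loweredCurvature G u X (Y + Y') Z T
      = loweredCurvature G u X Y Z T + loweredCurvature G u X Y' Z T := by
  rw [h.loweredCurvature_pair, h.loweredCurvature_add₄, h.loweredCurvature_pair Z T,
    h.loweredCurvature_pair Z T]

theorem IsMetricAt.loweredCurvature_smul₂ (h : IsMetricAt G u) (X Y Z T : E) (a : ℝ) :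
    loweredCurvature G u X (a • Y) Z T = a * loweredCurvature G u X Y Z T := by
  rw [h.loweredCurvature_pair, h.loweredCurvature_smul₄, h.loweredCurvature_pair Z T]

theorem IsMetricAt.loweredCurvature_add₁ (h : IsMetricAt G u) (X X' Y Z T : E) :
    loweredCurvature G u (X + X') Y Z T
      = loweredCurvature G u X Y Z T + loweredCurvature G u X' Y Z T := by
  rw [loweredCurvature_swap_left, h.loweredCurvature_add₂, loweredCurvature_swap_left Y,
    loweredCurvature_swap_left Y]
  ring

theorem IsMetricAt.loweredCurvature_smul₁ (h : IsMetricAt G u) (X Y Z T : E) (a : ℝ) :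
    loweredCurvature G u (a • X) Y Z T = a * loweredCurvature G u X Y Z T := by
  rw [loweredCurvature_swap_left, h.loweredCurvature_smul₂, loweredCurvature_swap_left Y]
  ring

theorem IsMetricAt.loweredCurvature_smul₃ (h : IsMetricAt G u) (X Y Z T : E) (a : ℝ) :
    loweredCurvature G u X Y (a • Z) T = a * loweredCurvature G u X Y Z T := by
  rw [h.loweredCurvature_pair, h.loweredCurvature_smul₁, h.loweredCurvature_pair Z T]

theorem IsMetricAt.loweredCurvature_zero₂ (h : IsMetricAt G u) (X Z T : E) :
    loweredCurvature G u X 0 Z T = 0 := by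
  simpa using h.loweredCurvature_smul₂ X 0 Z T 0

theorem IsMetricAt.loweredCurvature_zero₃ (h : IsMetricAt G u) (X Y T : E) :
    loweredCurvature G u X Y 0 T = 0 := by
  simpa using h.loweredCurvature_smul₃ X Y 0 T 0

theorem IsMetricAt.loweredCurvature_zero₄ (h : IsMetricAt G u) (X Y Z : E) :
    loweredCurvature G u X Y Z 0 = 0 := by
  simpa using h.loweredCurvature_smul₄ X Y Z 0 0

end Multilinear

/-- The full contraction of a bilinear function does not depend on the basis. -/
theorem sum_dual_basis_eq [FiniteDimensional ℝ E] {ι κ : Type*} [Fintype ι] [Fintype κ]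
    (b : Module.Basis ι ℝ E) (n : Module.Basis κ ℝ E) (M : E →ₗ[ℝ] (E →L[ℝ] ℝ) →ₗ[ℝ] ℝ) :
    ∑ i, M (b i) (LinearMap.toContinuousLinearMap (b.coord i))
      = ∑ a, M (n a) (LinearMap.toContinuousLinearMap (n.coord a)) := by
  have e (a : κ) : LinearMap.toContinuousLinearMap (n.coord a)
      = ∑ i, n.coord a (b i) • LinearMap.toContinuousLinearMap (b.coord i) := by
    apply ContinuousLinearMap.coe_injective
    apply b.ext
    intro j
    classical simp [Module.Basis.repr_self, Finsupp.single_apply]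
  have e' (i : ι) : M (b i) = ∑ a, n.coord a (b i) • M (n a) := by
    conv_lhs => rw [← n.sum_repr (b i), map_sum]
    simp
  simp only [e, e', map_sum, map_smul, LinearMap.sum_apply, LinearMap.smul_apply]
  rw [Finset.sum_comm]

theorem isInvertible_of_injective [FiniteDimensional ℝ E] {g : E →L[ℝ] E →L[ℝ] ℝ}
    (h : ∀ X, (∀ Y, g X Y = 0) → X = 0) : g.IsInvertible := by
  have hinj : Function.Injective g := by
    rw [injective_iff_map_eq_zero]
    intro X hX
    exact h X (fun Y => by rw [hX]; rfl)
  have hr : Module.finrank ℝ E = Module.finrank ℝ (E →L[ℝ] ℝ) := by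
    rw [← Subspace.dual_finrank_eq]
    exact (LinearMap.toContinuousLinearMap (𝕜 := ℝ) (E := E) (F' := ℝ)).finrank_eq
  refine ⟨(LinearEquiv.ofBijective g.toLinearMap ⟨hinj, ?_⟩).toContinuousLinearEquiv, ?_⟩
  · exact (LinearMap.injective_iff_surjective_of_finrank_eq_finrank hr).1 hinj
  · ext; rfl

/-- The Ricci tensor as a contraction of the lowered curvature. -/
theorem IsMetricAt.ricci_eq [FiniteDimensional ℝ E] [CompleteSpace E] (h : IsMetricAt G u)
    {κ : Type*} [Fintype κ] (n : Module.Basis κ ℝ E) (X Y : E) :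
    ricci (leviCivita G) u X Y = ∑ a, loweredCurvature G u X (n a) Y
      ((G u).inverse (LinearMap.toContinuousLinearMap (n.coord a))) := by
  have hi := h.invertible.self_of_nhds
  let M : E →ₗ[ℝ] (E →L[ℝ] ℝ) →ₗ[ℝ] ℝ := LinearMap.mk₂ ℝ
    (fun Z φ => loweredCurvature G u X Z Y ((G u).inverse φ))
    (fun Z Z' φ => h.loweredCurvature_add₂ ..) (fun a Z φ => h.loweredCurvature_smul₂ ..)
    (fun Z φ φ' => by rw [map_add, h.loweredCurvature_add₄])
    (fun a Z φ => by rw [map_smul, h.loweredCurvature_smul₄, smul_eq_mul])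
  change _ = ∑ a, M (n a) (LinearMap.toContinuousLinearMap (n.coord a))
  rw [← sum_dual_basis_eq (Module.finBasis ℝ E) n M]
  unfold ricci
  refine Finset.sum_congr rfl fun i _ => ?_
  change _ = loweredCurvature G u X _ Y _
  -- Pairing with the metric dual of a coordinate covector returns that coordinate, which gives the
  -- diagonal entry of the trace.
  rw [← h.curvature_lower, h.symm.self_of_nhds, hi.self_apply_inverse]
  rfl

/-- The scalar curvature is a contraction of the Ricci tensor in any basis. -/
theorem IsMetricAt.contract_ricci [FiniteDimensional ℝ E] [CompleteSpace E] (h : IsMetricAt G u)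
    {ι κ : Type*} [Fintype ι] [Fintype κ] (b : Module.Basis ι ℝ E) (n : Module.Basis κ ℝ E) :
    ∑ i, ricci (leviCivita G) u (b i)
        ((G u).inverse (LinearMap.toContinuousLinearMap (b.coord i)))
      = ∑ a, ricci (leviCivita G) u (n a)
        ((G u).inverse (LinearMap.toContinuousLinearMap (n.coord a))) := by
  let M : E →ₗ[ℝ] (E →L[ℝ] ℝ) →ₗ[ℝ] ℝ := LinearMap.mk₂ ℝ
    (fun Z φ => ricci (leviCivita G) u Z ((G u).inverse φ))
    (fun Z Z' φ => by
      simp only [h.ricci_eq n, h.loweredCurvature_add₁, Finset.sum_add_distrib])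
    (fun a Z φ => by
      simp only [h.ricci_eq n, h.loweredCurvature_smul₁, Finset.mul_sum, smul_eq_mul])
    (fun Z φ φ' => by
      simp only [h.ricci_eq n, map_add, h.loweredCurvature_add₃, Finset.sum_add_distrib])
    (fun a Z φ => by
      simp only [h.ricci_eq n, map_smul, h.loweredCurvature_smul₃, Finset.mul_sum, smul_eq_mul])
  exact sum_dual_basis_eq b n M

end LeviCivita

/-! ### The modified Riemannian extension on V × V*: connection and curvature components. -/

section WalkerMetric

variable {V : Type*} [NormedAddCommGroup V] [NormedSpace ℝ V]

/-- The form `b - 2 α(γ) + c α ⊗ α` on the base, at a covector `α`. -/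
def extensionForm (γ : V →L[ℝ] V →L[ℝ] V) (b : V →L[ℝ] V →L[ℝ] ℝ) (c : ℝ) (α : V →L[ℝ] ℝ) :
    V →L[ℝ] V →L[ℝ] ℝ :=
  (-2 : ℝ) • (ContinuousLinearMap.compL ℝ V V ℝ α).comp γ + b + c • α.smulRight α

@[simp]
theorem extensionForm_apply (γ : V →L[ℝ] V →L[ℝ] V) (b : V →L[ℝ] V →L[ℝ] ℝ) (c : ℝ)
    (α : V →L[ℝ] ℝ) (v w : V) :
    extensionForm γ b c α v w = -2 * α (γ v w) + b v w + c * (α v * α w) := by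
  simp [extensionForm]

/-- The scalar product on `V × V*` given by the duality pairing and a bilinear form on `V`. -/
def walkerForm (b : V →L[ℝ] V →L[ℝ] ℝ) :
    (V × (V →L[ℝ] ℝ)) →L[ℝ] (V × (V →L[ℝ] ℝ)) →L[ℝ] ℝ :=
  (ContinuousLinearMap.id ℝ (V →L[ℝ] ℝ)).bilinearComp
      (ContinuousLinearMap.snd ℝ V (V →L[ℝ] ℝ)) (ContinuousLinearMap.fst ℝ V (V →L[ℝ] ℝ))
    + ((ContinuousLinearMap.id ℝ (V →L[ℝ] ℝ)).bilinearComp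
      (ContinuousLinearMap.snd ℝ V (V →L[ℝ] ℝ)) (ContinuousLinearMap.fst ℝ V (V →L[ℝ] ℝ))).flip
    + b.bilinearComp (ContinuousLinearMap.fst ℝ V (V →L[ℝ] ℝ))
      (ContinuousLinearMap.fst ℝ V (V →L[ℝ] ℝ))

@[simp]
theorem walkerForm_apply (b : V →L[ℝ] V →L[ℝ] ℝ) (X Y : V × (V →L[ℝ] ℝ)) :
    walkerForm b X Y = X.2 Y.1 + Y.2 X.1 + b X.1 Y.1 := by
  simp [walkerForm]

/-- A vector in the kernel has zero base component by pairing with all vertical vectors, and then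
zero covector by pairing with the base vectors. The form `b` plays no role. -/
theorem walkerForm_isInvertible [FiniteDimensional ℝ V] (b : V →L[ℝ] V →L[ℝ] ℝ) :
    (walkerForm b).IsInvertible := by
  apply isInvertible_of_injective
  intro X h
  have h1 : X.1 = 0 := by
    by_contra hne
    obtain ⟨φ, -, hφ⟩ := exists_dual_vector ℝ X.1 (norm_ne_zero_iff.2 hne)
    have := h (0, φ)
    simp [hφ, hne] at this
  have h2 : X.2 = 0 := by
    ext v
    simpa [h1] using h (v, 0)
  exact Prod.ext h1 h2

theorem walkerForm_inverse [FiniteDimensional ℝ V] (b : V →L[ℝ] V →L[ℝ] ℝ)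
    (φ : (V × (V →L[ℝ] ℝ)) →L[ℝ] ℝ) (X : V × (V →L[ℝ] ℝ)) (h : ∀ Y, walkerForm b X Y = φ Y) :
    (walkerForm b).inverse φ = X := by
  rw [(walkerForm_isInvertible b).inverse_apply_eq]
  ext Y <;> simp [← h]

/-- A connection, a symmetric bilinear form, and a function, all smooth on an open set. -/
structure IsExtensionData (U : Set V) (Γ : V → V →L[ℝ] V →L[ℝ] V) (Φ : V → V →L[ℝ] V →L[ℝ] ℝ)
    (c : V → ℝ) : Prop where
  isOpen : IsOpen U
  smooth_conn : ContDiffOn ℝ ∞ Γ U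
  symm_conn : ∀ u ∈ U, ∀ v w, Γ u v w = Γ u w v
  smooth_form : ContDiffOn ℝ ∞ Φ U
  symm_form : ∀ u ∈ U, ∀ v w, Φ u v w = Φ u w v
  smooth_factor : ContDiffOn ℝ ∞ c U

/-- The modified Riemannian extension in natural coordinates. -/
def walkerMetric (Γ : V → V →L[ℝ] V →L[ℝ] V) (Φ : V → V →L[ℝ] V →L[ℝ] ℝ) (c : V → ℝ)
    (w : V × (V →L[ℝ] ℝ)) : (V × (V →L[ℝ] ℝ)) →L[ℝ] (V × (V →L[ℝ] ℝ)) →L[ℝ] ℝ :=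
  walkerForm (extensionForm (Γ w.1) (Φ w.1) (c w.1) w.2)

variable {U : Set V} {Γ : V → V →L[ℝ] V →L[ℝ] V} {Φ : V → V →L[ℝ] V →L[ℝ] ℝ} {c : V → ℝ}

theorem walkerMetric_apply (w X Y : V × (V →L[ℝ] ℝ)) :
    walkerMetric Γ Φ c w X Y = X.2 Y.1 + Y.2 X.1
      + (-2 * w.2 (Γ w.1 X.1 Y.1) + Φ w.1 X.1 Y.1 + c w.1 * (w.2 X.1 * w.2 Y.1)) := by
  simp [walkerMetric]

namespace IsExtensionData

variable (h : IsExtensionData U Γ Φ c)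
include h

theorem contDiffOn_walkerMetric [FiniteDimensional ℝ V] :
    ContDiffOn ℝ ∞ (walkerMetric Γ Φ c) (U ×ˢ Set.univ) := by
  rw [contDiffOn_clm_apply]
  intro X
  rw [contDiffOn_clm_apply]
  intro Y
  simp only [walkerMetric_apply]
  have m : Set.MapsTo Prod.fst (U ×ˢ (Set.univ : Set (V →L[ℝ] ℝ))) U := fun w hw => hw.1
  have f1 : ContDiffOn ℝ ∞ (fun w : V × (V →L[ℝ] ℝ) => w.1) (U ×ˢ Set.univ) := contDiffOn_fst
  have f2 : ContDiffOn ℝ ∞ (fun w : V × (V →L[ℝ] ℝ) => w.2) (U ×ˢ Set.univ) := contDiffOn_snd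
  have a1 := ((h.smooth_conn.comp f1 m).clm_apply
    (contDiffOn_const (c := X.1))).clm_apply (contDiffOn_const (c := Y.1))
  have a2 := ((h.smooth_form.comp f1 m).clm_apply
    (contDiffOn_const (c := X.1))).clm_apply (contDiffOn_const (c := Y.1))
  have a3 := h.smooth_factor.comp f1 m
  exact contDiffOn_const.add (((contDiffOn_const.mul (f2.clm_apply a1)).add a2).add
    (a3.mul ((f2.clm_apply contDiffOn_const).mul (f2.clm_apply contDiffOn_const))))

theorem isMetricAt [FiniteDimensional ℝ V] {w : V × (V →L[ℝ] ℝ)} (hw : w.1 ∈ U) :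
    IsMetricAt (walkerMetric Γ Φ c) w where
  contDiffAt := ((h.contDiffOn_walkerMetric.contDiffAt
    ((h.isOpen.prod isOpen_univ).mem_nhds ⟨hw, trivial⟩))).of_le (WithTop.coe_le_coe.2 (le_top : (2 : ℕ∞) ≤ ⊤))
  symm := by
    filter_upwards [(h.isOpen.prod isOpen_univ).mem_nhds (show w ∈ U ×ˢ Set.univ from ⟨hw, trivial⟩)]
      with t ht X Y
    rw [walkerMetric_apply, walkerMetric_apply, h.symm_conn _ ht.1 X.1, h.symm_form _ ht.1 X.1]
    ring
  invertible := .of_forall fun _ => walkerForm_isInvertible _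

theorem hasFDerivAt_conn {u : V} (hu : u ∈ U) (v w : V) :
    HasFDerivAt (fun t => Γ t v w) (fderiv ℝ (fun t => Γ t v w) u) u :=
  ((((h.smooth_conn.contDiffAt (h.isOpen.mem_nhds hu)).clm_apply contDiffAt_const).clm_apply
    contDiffAt_const).differentiableAt (by simp)).hasFDerivAt

theorem hasFDerivAt_form {u : V} (hu : u ∈ U) (v w : V) :
    HasFDerivAt (fun t => Φ t v w) (fderiv ℝ (fun t => Φ t v w) u) u :=
  ((((h.smooth_form.contDiffAt (h.isOpen.mem_nhds hu)).clm_apply contDiffAt_const).clm_apply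
    contDiffAt_const).differentiableAt (by simp)).hasFDerivAt

theorem hasFDerivAt_factor {u : V} (hu : u ∈ U) : HasFDerivAt c (fderiv ℝ c u) u :=
  ((h.smooth_factor.contDiffAt (h.isOpen.mem_nhds hu)).differentiableAt (by simp)).hasFDerivAt

/-- Along a fibre only -2ω(Γ) + c ω⊗ω varies, a quadratic polynomial in the covector ω; no
derivative of Γ, Φ or c occurs. -/
theorem fderiv_walkerMetric_vertical {w : V × (V →L[ℝ] ℝ)} (hw : w.1 ∈ U)
    (ξ : V →L[ℝ] ℝ) (Z T : V × (V →L[ℝ] ℝ)) :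
    fderiv ℝ (fun t => walkerMetric Γ Φ c t Z T) w (0, ξ)
      = -2 * ξ (Γ w.1 Z.1 T.1) + c w.1 * (ξ Z.1 * w.2 T.1 + w.2 Z.1 * ξ T.1) := by
  simp only [walkerMetric_apply]
  have f1 : HasFDerivAt (fun w : V × (V →L[ℝ] ℝ) => w.1) _ w := hasFDerivAt_fst (𝕜 := ℝ)
  have f2 : HasFDerivAt (fun w : V × (V →L[ℝ] ℝ) => w.2) _ w := hasFDerivAt_snd (𝕜 := ℝ)
  have a1 := (h.hasFDerivAt_conn hw Z.1 T.1).comp w f1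
  have a2 := (h.hasFDerivAt_form hw Z.1 T.1).comp w f1
  have a3 := (h.hasFDerivAt_factor hw).comp w f1
  have k (v : V) := f2.clm_apply (hasFDerivAt_const v w)
  have e := (((((f2.clm_apply a1).const_mul (-2)).add a2).add (a3.mul ((k Z.1).mul (k T.1)))).const_add
    (Z.2 T.1 + T.2 Z.1)).fderiv
  have e' := congrArg (fun L : (V × (V →L[ℝ] ℝ)) →L[ℝ] ℝ => L (0, ξ)) e
  refine Eq.trans e' ?_
  simp
  ring

theorem secondDeriv_vertical {w : V × (V →L[ℝ] ℝ)} (hw : w.1 ∈ U)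
    (X : V × (V →L[ℝ] ℝ)) (ξ : V →L[ℝ] ℝ) (Z T : V × (V →L[ℝ] ℝ)) :
    secondDeriv (walkerMetric Γ Φ c) w X (0, ξ) Z T
      = -2 * ξ (fderiv ℝ (fun t => Γ t Z.1 T.1) w.1 X.1)
        + fderiv ℝ c w.1 X.1 * (ξ Z.1 * w.2 T.1 + w.2 Z.1 * ξ T.1)
        + c w.1 * (ξ Z.1 * X.2 T.1 + X.2 Z.1 * ξ T.1) := by
  have e : (fun t => fderiv ℝ (fun s => walkerMetric Γ Φ c s Z T) t (0, ξ)) =ᶠ[𝓝 w]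
      fun t => -2 * ξ (Γ t.1 Z.1 T.1) + c t.1 * (ξ Z.1 * t.2 T.1 + t.2 Z.1 * ξ T.1) := by
    filter_upwards [(h.isOpen.prod isOpen_univ).mem_nhds (show w ∈ U ×ˢ Set.univ from ⟨hw, trivial⟩)]
      with t ht
    exact h.fderiv_walkerMetric_vertical ht.1 ξ Z T
  unfold secondDeriv
  rw [e.fderiv_eq]
  have f1 : HasFDerivAt (fun w : V × (V →L[ℝ] ℝ) => w.1) _ w := hasFDerivAt_fst (𝕜 := ℝ)
  have f2 : HasFDerivAt (fun w : V × (V →L[ℝ] ℝ) => w.2) _ w := hasFDerivAt_snd (𝕜 := ℝ)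
  have a1 := ξ.hasFDerivAt.comp w ((h.hasFDerivAt_conn hw Z.1 T.1).comp w f1)
  have a3 := (h.hasFDerivAt_factor hw).comp w f1
  have k (v : V) := f2.clm_apply (hasFDerivAt_const v w)
  have e := ((a1.const_mul (-2)).add
    (a3.mul (((k T.1).const_mul (ξ Z.1)).add ((k Z.1).mul_const (ξ T.1))))).fderiv
  have e' := congrArg (fun L : (V × (V →L[ℝ] ℝ)) →L[ℝ] ℝ => L X) e
  refine Eq.trans e' ?_
  simp
  ring

variable [FiniteDimensional ℝ V] {w : V × (V →L[ℝ] ℝ)} (hw : w.1 ∈ U)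
include hw

omit h [FiniteDimensional ℝ V] hw in
-- A metric component with a vertical argument is a constant duality pairing. This removes most
-- terms from Koszul's formula and from the curvature.
theorem secondDeriv_eq_zero (X Y Z : V × (V →L[ℝ] ℝ)) (ξ : V →L[ℝ] ℝ) :
    secondDeriv (walkerMetric Γ Φ c) w X Y Z (0, ξ) = 0 := by
  simp [secondDeriv, walkerMetric_apply]

omit h [FiniteDimensional ℝ V] hw in
theorem secondDeriv_eq_zero' (X Y Z : V × (V →L[ℝ] ℝ)) (ξ : V →L[ℝ] ℝ) :
    secondDeriv (walkerMetric Γ Φ c) w X Y (0, ξ) Z = 0 := by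
  simp [secondDeriv, walkerMetric_apply]

theorem fderiv_walkerMetric_eq_zero (X Z : V × (V →L[ℝ] ℝ)) (ξ : V →L[ℝ] ℝ) :
    fderiv ℝ (walkerMetric Γ Φ c) w X Z (0, ξ) = 0 := by
  rw [fderiv_metric_apply (h.isMetricAt hw).differentiableAt]
  simp [walkerMetric_apply]

theorem fderiv_walkerMetric_eq_zero' (X Z : V × (V →L[ℝ] ℝ)) (ξ : V →L[ℝ] ℝ) :
    fderiv ℝ (walkerMetric Γ Φ c) w X (0, ξ) Z = 0 := by
  rw [fderiv_metric_apply (h.isMetricAt hw).differentiableAt]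
  simp [walkerMetric_apply]

/-- The horizontal component of the Levi-Civita connection. -/
theorem leviCivita_fst (X Y : V × (V →L[ℝ] ℝ)) :
    (leviCivita (walkerMetric Γ Φ c) w X Y).1
      = Γ w.1 X.1 Y.1 - (c w.1 / 2) • (w.2 Y.1 • X.1 + w.2 X.1 • Y.1) := by
  have hm := h.isMetricAt hw
  -- The value of ξ on the base component is the scalar product with the vertical vector (0,ξ). In
  -- Koszul's formula for that product only the derivative along (0,ξ) survives.
  refine (SeparatingDual.eq_iff_forall_dual_eq (R := ℝ)).2 fun ξ => ?_
  have := leviCivita_lower hm.invertible.self_of_nhds X Y (0, ξ)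
  rw [h.fderiv_walkerMetric_eq_zero hw, h.fderiv_walkerMetric_eq_zero hw,
    fderiv_metric_apply hm.differentiableAt, h.fderiv_walkerMetric_vertical hw,
    walkerMetric_apply] at this
  simp at this
  simp [this]
  ring

theorem leviCivita_vertical_lower (x : V) (ξ : V →L[ℝ] ℝ) (Z : V × (V →L[ℝ] ℝ)) :
    walkerMetric Γ Φ c w (leviCivita (walkerMetric Γ Φ c) w (x, 0) (0, ξ)) Z
      = -ξ (Γ w.1 x Z.1) + c w.1 / 2 * (ξ x * w.2 Z.1 + w.2 x * ξ Z.1) := by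
  have hm := h.isMetricAt hw
  rw [leviCivita_lower hm.invertible.self_of_nhds, h.fderiv_walkerMetric_eq_zero hw,
    h.fderiv_walkerMetric_eq_zero' hw, fderiv_metric_apply hm.differentiableAt,
    h.fderiv_walkerMetric_vertical hw]
  ring

/-- Each term of Koszul's formula differentiates a component with a vertical argument, hence a
constant. -/
theorem leviCivita_vertical_vertical (ξ η : V →L[ℝ] ℝ) :
    leviCivita (walkerMetric Γ Φ c) w (0, ξ) (0, η) = 0 := by
  have hm := h.isMetricAt hw
  have hi := hm.invertible.self_of_nhds
  obtain ⟨e, he⟩ := hi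
  apply e.injective
  refine ContinuousLinearMap.ext fun Z => ?_
  have he' (X) : e X = walkerMetric Γ Φ c w X := by rw [← he]; rfl
  rw [map_zero, he', leviCivita_lower ⟨e, he⟩, h.fderiv_walkerMetric_eq_zero' hw,
    h.fderiv_walkerMetric_eq_zero' hw, h.fderiv_walkerMetric_eq_zero' hw]
  simp

/-- Curvature components with exactly one vertical argument. -/
theorem loweredCurvature_one_vertical (x y z : V) (ξ : V →L[ℝ] ℝ) :
    loweredCurvature (walkerMetric Γ Φ c) w (x, 0) (y, 0) (z, 0) (0, ξ)
      = ξ (curvature (fun u v w => Γ u v w) w.1 x y z)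
        + 1 / 2 * (fderiv ℝ c w.1 x * (ξ y * w.2 z + w.2 y * ξ z)
          - fderiv ℝ c w.1 y * (ξ x * w.2 z + w.2 x * ξ z))
        - c w.1 / 4 * (ξ x * (-2 * w.2 (Γ w.1 y z) + c w.1 * (w.2 y * w.2 z))
          - ξ y * (-2 * w.2 (Γ w.1 x z) + c w.1 * (w.2 x * w.2 z))) := by
  have hs := (h.isMetricAt hw).symm.self_of_nhds
  unfold loweredCurvature
  -- The vertical argument is either a metric slot, where the second derivative vanishes, or a
  -- direction of differentiation along the fibre, where it is explicit.
  rw [secondDeriv_eq_zero, secondDeriv_eq_zero, h.secondDeriv_vertical hw,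
    h.secondDeriv_vertical hw, hs, h.leviCivita_vertical_lower hw, hs,
    h.leviCivita_vertical_lower hw, h.leviCivita_fst hw, h.leviCivita_fst hw]
  simp [curvature, h.symm_conn w.1 hw x y]
  ring

/-- Curvature components with one vertical argument in each pair. -/
theorem loweredCurvature_two_vertical (x z : V) (η ξ : V →L[ℝ] ℝ) :
    loweredCurvature (walkerMetric Γ Φ c) w (x, 0) (0, η) (z, 0) (0, ξ)
      = -(c w.1 / 2) * (η x * ξ z + η z * ξ x) := by
  have hm := h.isMetricAt hw
  unfold loweredCurvature
  rw [secondDeriv_eq_zero, secondDeriv_eq_zero', secondDeriv_eq_zero',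
    h.secondDeriv_vertical hw, h.leviCivita_vertical_vertical hw, hm.leviCivita_comm (0, η),
    walkerMetric_apply (Γ := Γ), h.leviCivita_fst hw, h.leviCivita_fst hw]
  simp
  ring

/-- Every second derivative here has a vertical metric argument, and Γ(vertical, ·) is vertical, so
the quadratic terms pair vectors of a null space. -/
theorem loweredCurvature_vertical_pair (η ξ : V →L[ℝ] ℝ) (Z T : V × (V →L[ℝ] ℝ)) :
    loweredCurvature (walkerMetric Γ Φ c) w (0, η) (0, ξ) Z T = 0 := by
  have hm := h.isMetricAt hw
  have f (ζ : V →L[ℝ] ℝ) (Z : V × (V →L[ℝ] ℝ)) :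
      (leviCivita (walkerMetric Γ Φ c) w (0, ζ) Z).1 = 0 := by
    rw [h.leviCivita_fst hw]; simp
  unfold loweredCurvature
  rw [secondDeriv_eq_zero', secondDeriv_eq_zero', secondDeriv_eq_zero', secondDeriv_eq_zero']
  simp [walkerMetric_apply, f]

end IsExtensionData

end WalkerMetric

theorem curvature_swap {V : Type*} [NormedAddCommGroup V] [NormedSpace ℝ V]
    (Γ : V → V → V → V) (u X Y Z : V) : curvature Γ u X Y Z = -curvature Γ u Y X Z := by
  simp [curvature]

@[simp]
theorem curvature_zero {V : Type*} [NormedAddCommGroup V] [NormedSpace ℝ V]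
    (Γ : V → V →L[ℝ] V →L[ℝ] V) (u Y Z : V) :
    curvature (fun u v w => Γ u v w) u 0 Y Z = 0 := by
  simp [curvature]

@[simp]
theorem curvature_zero₃ {V : Type*} [NormedAddCommGroup V] [NormedSpace ℝ V]
    (Γ : V → V →L[ℝ] V →L[ℝ] V) (u X Y : V) :
    curvature (fun u v w => Γ u v w) u X Y 0 = 0 := by
  simp [curvature]

/-! ### Coordinates and dual bases on the plane. -/

section Plane

/-- The coordinate covectors of the plane. -/
def coordCovec (i : Fin 2) : Plane →L[ℝ] ℝ := EuclideanSpace.proj i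

@[simp]
theorem coordCovec_apply (i : Fin 2) (v : Plane) : coordCovec i v = v i := rfl

@[simp]
theorem coordVec_apply (i j : Fin 2) : coordVec i j = if j = i then 1 else 0 := by
  simp [coordVec]

theorem plane_eq (v : Plane) : v = v 0 • coordVec 0 + v 1 • coordVec 1 := by
  ext i; fin_cases i <;> simp

theorem covector_eq (φ : Plane →L[ℝ] ℝ) :
    φ = φ (coordVec 0) • coordCovec 0 + φ (coordVec 1) • coordCovec 1 := by
  ext v
  conv_lhs => rw [plane_eq v]
  simp
  ring

theorem covector_apply (φ : Plane →L[ℝ] ℝ) (v : Plane) :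
    φ v = v 0 * φ (coordVec 0) + v 1 * φ (coordVec 1) := by
  conv_lhs => rw [plane_eq v]
  simp

/-- The standard basis of the plane. -/
def planeBasis : Module.Basis (Fin 2) ℝ Plane := (EuclideanSpace.basisFun (Fin 2) ℝ).toBasis

theorem planeBasis_apply (i : Fin 2) : planeBasis i = coordVec i := by
  simp [planeBasis, coordVec]

theorem planeBasis_coord (i : Fin 2) : planeBasis.coord i = (coordCovec i).toLinearMap := by
  apply planeBasis.ext
  intro j
  rw [Module.Basis.coord_apply, Module.Basis.repr_self, planeBasis_apply]
  simp [Finsupp.single_apply, eq_comm]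

/-- The coordinate covectors as a basis. -/
def covectorBasis : Module.Basis (Fin 2) ℝ (Plane →L[ℝ] ℝ) :=
  planeBasis.dualBasis.map (LinearMap.toContinuousLinearMap (𝕜 := ℝ) (E := Plane) (F' := ℝ))

theorem covectorBasis_apply (i : Fin 2) : covectorBasis i = coordCovec i := by
  simp [covectorBasis, planeBasis_coord]
  rfl

theorem covectorBasis_repr (φ : Plane →L[ℝ] ℝ) (i : Fin 2) :
    covectorBasis.repr φ i = φ (coordVec i) := by
  simp [covectorBasis, planeBasis_apply]

end Plane

/-! ### Ricci and Weyl tensors of the extension over a plane. -/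

namespace IsExtensionData

section PlaneExtension
variable {V : Type*} [NormedAddCommGroup V] [NormedSpace ℝ V]
  {U : Set V} {Γ : V → V →L[ℝ] V →L[ℝ] V} {Φ : V → V →L[ℝ] V →L[ℝ] ℝ} {c : V → ℝ}
  (h : IsExtensionData U Γ Φ c) [FiniteDimensional ℝ V] {w : V × (V →L[ℝ] ℝ)} (hw : w.1 ∈ U)
include h hw

/-- Multilinearity gives sixteen components. The seven with both arguments of a pair vertical
vanish, leaving one horizontal component, four with a single vertical argument and four with one in
each pair. -/
theorem loweredCurvature_eq (x y z t : V) (ξ η ζ τ : V →L[ℝ] ℝ) :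
    loweredCurvature (walkerMetric Γ Φ c) w (x, ξ) (y, η) (z, ζ) (t, τ)
      = loweredCurvature (walkerMetric Γ Φ c) w (x, 0) (y, 0) (z, 0) (t, 0)
        + loweredCurvature (walkerMetric Γ Φ c) w (x, 0) (y, 0) (z, 0) (0, τ)
        - loweredCurvature (walkerMetric Γ Φ c) w (x, 0) (y, 0) (t, 0) (0, ζ)
        + loweredCurvature (walkerMetric Γ Φ c) w (z, 0) (t, 0) (x, 0) (0, η)
        - loweredCurvature (walkerMetric Γ Φ c) w (z, 0) (t, 0) (y, 0) (0, ξ)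
        - c w.1 / 2 * ((η x * τ z + η z * τ x) - (ξ y * τ z + ξ z * τ y)
          - (η x * ζ t + η t * ζ x) + (ξ y * ζ t + ξ t * ζ y)) := by
  have hm := h.isMetricAt hw
  have s (v : V) (φ : V →L[ℝ] ℝ) : (v, φ) = (v, 0) + (0, φ) := by simp
  rw [s x, s y, s z, s t]
  simp only [hm.loweredCurvature_add₁, hm.loweredCurvature_add₂, hm.loweredCurvature_add₃,
    hm.loweredCurvature_add₄]
  have p0 (η ξ Z T) := h.loweredCurvature_vertical_pair hw η ξ Z T
  have p1 (η ξ Z T) : loweredCurvature (walkerMetric Γ Φ c) w Z T (0, η) (0, ξ) = 0 := by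
    rw [hm.loweredCurvature_pair, p0]
  have q2 (v : V) (φ : V →L[ℝ] ℝ) (Z T) : loweredCurvature (walkerMetric Γ Φ c) w Z T (0, φ) (v, 0)
    = -loweredCurvature (walkerMetric Γ Φ c) w Z T (v, 0) (0, φ) := hm.loweredCurvature_swap_right ..
  have q1 (v : V) (φ : V →L[ℝ] ℝ) (Z T) : loweredCurvature (walkerMetric Γ Φ c) w (0, φ) (v, 0) Z T
    = -loweredCurvature (walkerMetric Γ Φ c) w (v, 0) (0, φ) Z T := loweredCurvature_swap_left ..
  have q3 (v z t : V) (φ : V →L[ℝ] ℝ) :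
      loweredCurvature (walkerMetric Γ Φ c) w (v, 0) (0, φ) (z, 0) (t, 0)
        = loweredCurvature (walkerMetric Γ Φ c) w (z, 0) (t, 0) (v, 0) (0, φ) :=
    hm.loweredCurvature_pair ..
  simp only [p0, p1, q2, q1, h.loweredCurvature_two_vertical hw]
  simp only [q3]
  ring

end PlaneExtension

section Ricci

variable {U : Set Plane} {Γ : Plane → Plane →L[ℝ] Plane →L[ℝ] Plane}
  {Φ : Plane → Plane →L[ℝ] Plane →L[ℝ] ℝ} {c : Plane → ℝ}
  (h : IsExtensionData U Γ Φ c)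
include h

theorem curvature_add₂ {u : Plane} (hu : u ∈ U) (X Y Y' Z : Plane) :
    curvature (fun u v w => Γ u v w) u X (Y + Y') Z
      = curvature (fun u v w => Γ u v w) u X Y Z + curvature (fun u v w => Γ u v w) u X Y' Z := by
  have := ((h.hasFDerivAt_conn hu Y Z).add (h.hasFDerivAt_conn hu Y' Z)).fderiv
  simp only [curvature, map_add, add_apply]
  erw [this]
  simp
  abel

theorem curvature_smul₂ {u : Plane} (hu : u ∈ U) (X Y Z : Plane) (a : ℝ) :
    curvature (fun u v w => Γ u v w) u X (a • Y) Z
      = a • curvature (fun u v w => Γ u v w) u X Y Z := by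
  have := ((h.hasFDerivAt_conn hu Y Z).const_smul a).fderiv
  simp only [curvature, map_smul, smul_apply]
  erw [this]
  simp [smul_sub]

theorem ricci_base {u : Plane} (hu : u ∈ U) (x y : Plane) :
    ricci (fun u v w => Γ u v w) u x y
      = curvature (fun u v w => Γ u v w) u x (coordVec 0) y 0
        + curvature (fun u v w => Γ u v w) u x (coordVec 1) y 1 := by
  let M : Plane →ₗ[ℝ] (Plane →L[ℝ] ℝ) →ₗ[ℝ] ℝ := LinearMap.mk₂ ℝ
    (fun Z φ => φ (curvature (fun u v w => Γ u v w) u x Z y))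
    (fun Z Z' φ => by rw [h.curvature_add₂ hu, map_add])
    (fun a Z φ => by rw [h.curvature_smul₂ hu, map_smul])
    (fun Z φ φ' => rfl) (fun a Z φ => rfl)
  have e := sum_dual_basis_eq (Module.finBasis ℝ Plane) planeBasis M
  rw [Fin.sum_univ_two, planeBasis_apply, planeBasis_apply, planeBasis_coord, planeBasis_coord] at e
  exact e

theorem curvature_add₃ {u : Plane} (hu : u ∈ U) (X Y Z Z' : Plane) :
    curvature (fun u v w => Γ u v w) u X Y (Z + Z')
      = curvature (fun u v w => Γ u v w) u X Y Z + curvature (fun u v w => Γ u v w) u X Y Z' := by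
  have e := ((h.hasFDerivAt_conn hu Y Z).add (h.hasFDerivAt_conn hu Y Z')).fderiv
  have e' := ((h.hasFDerivAt_conn hu X Z).add (h.hasFDerivAt_conn hu X Z')).fderiv
  simp only [curvature, map_add]
  erw [e, e']
  simp
  abel

theorem curvature_smul₃ {u : Plane} (hu : u ∈ U) (X Y Z : Plane) (a : ℝ) :
    curvature (fun u v w => Γ u v w) u X Y (a • Z)
      = a • curvature (fun u v w => Γ u v w) u X Y Z := by
  have e := ((h.hasFDerivAt_conn hu Y Z).const_smul a).fderiv
  have e' := ((h.hasFDerivAt_conn hu X Z).const_smul a).fderiv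
  simp only [curvature, map_smul]
  erw [e, e']
  simp [smul_sub]

/-- In dimension two, skewness in the first two arguments leaves only the operator R(e₀,e₁), given
by its values on e₀ and e₁. -/
theorem curvature_plane {u : Plane} (hu : u ∈ U) (x y z : Plane) :
    curvature (fun u v w => Γ u v w) u x y z = (x 0 * y 1 - x 1 * y 0) •
      (z 0 • curvature (fun u v w => Γ u v w) u (coordVec 0) (coordVec 1) (coordVec 0)
        + z 1 • curvature (fun u v w => Γ u v w) u (coordVec 0) (coordVec 1) (coordVec 1)) := by
  have d (v z : Plane) : curvature (fun u v w => Γ u v w) u v v z = 0 := by simp [curvature]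
  have e (y z : Plane) (v : Plane) : curvature (fun u v w => Γ u v w) u v y z
      = y 0 • curvature (fun u v w => Γ u v w) u v (coordVec 0) z
        + y 1 • curvature (fun u v w => Γ u v w) u v (coordVec 1) z := by
    conv_lhs => rw [plane_eq y, h.curvature_add₂ hu, h.curvature_smul₂ hu, h.curvature_smul₂ hu]
  have e1 (z : Plane) : curvature (fun u v w => Γ u v w) u (coordVec 1) x z
      = -(x 0 • curvature (fun u v w => Γ u v w) u (coordVec 0) (coordVec 1) z) := by
    rw [e, d, curvature_swap]
    simp
  have e0 (z : Plane) : curvature (fun u v w => Γ u v w) u (coordVec 0) x z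
      = x 1 • curvature (fun u v w => Γ u v w) u (coordVec 0) (coordVec 1) z := by
    rw [e, d]
    simp
  have e2 (z : Plane) : curvature (fun u v w => Γ u v w) u x y z = (x 0 * y 1 - x 1 * y 0) •
      curvature (fun u v w => Γ u v w) u (coordVec 0) (coordVec 1) z := by
    rw [e y z x, curvature_swap _ _ x, curvature_swap _ _ x, e0, e1]
    module
  rw [e2]
  conv_lhs => rw [plane_eq z, h.curvature_add₃ hu, h.curvature_smul₃ hu, h.curvature_smul₃ hu]

/-- This and the three existence statements below name finitely many real unknowns, so that the
Ricci and Weyl identities become polynomial identities within reach of `ring`. -/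
theorem exists_curvature_coord {u : Plane} (hu : u ∈ U) : ∃ K₀ K₁ : Plane, ∀ x y z : Plane,
    curvature (fun u v w => Γ u v w) u x y z
      = (x 0 * y 1 - x 1 * y 0) • (z 0 • K₀ + z 1 • K₁) :=
  ⟨_, _, h.curvature_plane hu⟩

variable {w : Plane × (Plane →L[ℝ] ℝ)}

omit h in
theorem exists_conn_coord (hu : ∀ v v', Γ w.1 v v' = Γ w.1 v' v) : ∃ g₀ g₁ g₂ : ℝ, ∀ v v',
    w.2 (Γ w.1 v v') = v 0 * v' 0 * g₀ + (v 0 * v' 1 + v 1 * v' 0) * g₁ + v 1 * v' 1 * g₂ := by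
  refine ⟨w.2 (Γ w.1 (coordVec 0) (coordVec 0)), w.2 (Γ w.1 (coordVec 0) (coordVec 1)),
    w.2 (Γ w.1 (coordVec 1) (coordVec 1)), fun v v' => ?_⟩
  conv_lhs => rw [plane_eq v, plane_eq v']
  simp [hu (coordVec 1) (coordVec 0)]
  ring

omit h in
theorem exists_form_coord (hu : ∀ v v', Φ w.1 v v' = Φ w.1 v' v) : ∃ g₀ g₁ g₂ : ℝ, ∀ v v',
    Φ w.1 v v' = v 0 * v' 0 * g₀ + (v 0 * v' 1 + v 1 * v' 0) * g₁ + v 1 * v' 1 * g₂ := by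
  refine ⟨Φ w.1 (coordVec 0) (coordVec 0), Φ w.1 (coordVec 0) (coordVec 1),
    Φ w.1 (coordVec 1) (coordVec 1), fun v v' => ?_⟩
  conv_lhs => rw [plane_eq v, plane_eq v']
  simp [hu (coordVec 1) (coordVec 0)]
  ring

omit h in
theorem exists_covector_coord (φ : Plane →L[ℝ] ℝ) :
    ∃ a₀ a₁ : ℝ, ∀ v, φ v = v 0 * a₀ + v 1 * a₁ :=
  ⟨_, _, covector_apply φ⟩

/-- The vector metrically dual to the fibre coordinate `i`. -/
def dualFibre (Γ : Plane → Plane →L[ℝ] Plane →L[ℝ] Plane) (Φ : Plane → Plane →L[ℝ] Plane →L[ℝ] ℝ)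
    (c : Plane → ℝ) (w : Plane × (Plane →L[ℝ] ℝ)) (i : Fin 2) : Plane × (Plane →L[ℝ] ℝ) :=
  (coordVec i, -extensionForm (Γ w.1) (Φ w.1) (c w.1) w.2 (coordVec i))

omit h in
-- The metric dual of dxⁱ is a fibre direction and that of dx_{i'} is `dualFibre`. Hence each of the
-- four terms of a contraction contains a vertical vector.
theorem sum_contract
    (F : Plane × (Plane →L[ℝ] ℝ) → Plane × (Plane →L[ℝ] ℝ) → ℝ) :
    ∑ a, F (planeBasis.prod covectorBasis a) ((walkerMetric Γ Φ c w).inverse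
        (LinearMap.toContinuousLinearMap ((planeBasis.prod covectorBasis).coord a)))
      = F (coordVec 0, 0) (0, coordCovec 0) + F (coordVec 1, 0) (0, coordCovec 1)
        + (F (0, coordCovec 0) (dualFibre Γ Φ c w 0)
          + F (0, coordCovec 1) (dualFibre Γ Φ c w 1)) := by
  have e1 (i : Fin 2) : (walkerMetric Γ Φ c w).inverse (LinearMap.toContinuousLinearMap
      ((planeBasis.prod covectorBasis).coord (Sum.inl i))) = (0, coordCovec i) := by
    apply walkerForm_inverse
    intro Y
    have : planeBasis.repr Y.1 i = Y.1 i := by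
      rw [← Module.Basis.coord_apply, planeBasis_coord]; rfl
    simp [this]
  have e2 (i : Fin 2) : (walkerMetric Γ Φ c w).inverse (LinearMap.toContinuousLinearMap
      ((planeBasis.prod covectorBasis).coord (Sum.inr i))) = dualFibre Γ Φ c w i := by
    apply walkerForm_inverse
    intro Y
    simp [dualFibre, covectorBasis_repr]
    ring
  rw [Fintype.sum_sum_type, Fin.sum_univ_two, Fin.sum_univ_two]
  simp only [e1, e2]
  simp [planeBasis_apply, covectorBasis_apply]

/-- The Ricci tensor of the modified Riemannian extension. -/
theorem ricci_walkerMetric (hw : w.1 ∈ U) (X Y : Plane × (Plane →L[ℝ] ℝ)) :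
    ricci (leviCivita (walkerMetric Γ Φ c)) w X Y
      = 3 / 2 * c w.1 * walkerMetric Γ Φ c w X Y
        + (ricci (fun u v w => Γ u v w) w.1 X.1 Y.1 + ricci (fun u v w => Γ u v w) w.1 Y.1 X.1
          - c w.1 / 2 * Φ w.1 X.1 Y.1
          + 1 / 2 * (w.2 X.1 * fderiv ℝ c w.1 Y.1 + fderiv ℝ c w.1 X.1 * w.2 Y.1)) := by
  have hm := h.isMetricAt hw
  obtain ⟨x, ξ⟩ := X
  obtain ⟨y, η⟩ := Y
  rw [hm.ricci_eq (planeBasis.prod covectorBasis),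
    sum_contract fun A B => loweredCurvature (walkerMetric Γ Φ c) w (x, ξ) A (y, η) B]
  simp only [dualFibre]
  rw [h.loweredCurvature_eq hw x (coordVec 0) y 0 ξ 0 η (coordCovec 0),
    h.loweredCurvature_eq hw x (coordVec 1) y 0 ξ 0 η (coordCovec 1),
    h.loweredCurvature_eq hw x 0 y (coordVec 0) ξ (coordCovec 0) η,
    h.loweredCurvature_eq hw x 0 y (coordVec 1) ξ (coordCovec 1) η]
  -- A zero base component in each contracted term annihilates the purely horizontal curvature; only
  -- the components with one or two vertical arguments remain.
  simp only [Prod.mk_zero_zero, hm.loweredCurvature_zero₂, hm.loweredCurvature_zero₃,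
    hm.loweredCurvature_zero₄, h.loweredCurvature_one_vertical hw,
    h.ricci_base hw, walkerMetric_apply]
  obtain ⟨K₀, K₁, hK⟩ := h.exists_curvature_coord hw
  obtain ⟨g₀, g₁, g₂, hg⟩ := exists_conn_coord (h.symm_conn _ hw)
  obtain ⟨p₀, p₁, p₂, hp⟩ := exists_form_coord (h.symm_form _ hw)
  obtain ⟨a₀, a₁, ha⟩ := exists_covector_coord w.2
  obtain ⟨b₀, b₁, hb⟩ := exists_covector_coord ξ
  obtain ⟨d₀, d₁, hd⟩ := exists_covector_coord η
  obtain ⟨c₀, c₁, hc⟩ := exists_covector_coord (fderiv ℝ c w.1)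
  simp [hg, hp, ha, hb, hd, hc, hK]
  ring

/-- The contraction of the Ricci tensor of the modified Riemannian extension. -/
theorem contract_ricci_walkerMetric (hw : w.1 ∈ U) {ι : Type*} [Fintype ι]
    (b : Module.Basis ι ℝ (Plane × (Plane →L[ℝ] ℝ))) :
    ∑ i, ricci (leviCivita (walkerMetric Γ Φ c)) w (b i) ((walkerMetric Γ Φ c w).inverse
        (LinearMap.toContinuousLinearMap (b.coord i))) = 6 * c w.1 := by
  have hm := h.isMetricAt hw
  rw [hm.contract_ricci b (planeBasis.prod covectorBasis), sum_contract fun A B =>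
    ricci (leviCivita (walkerMetric Γ Φ c)) w A B]
  -- Apart from (3/2) c g, the Ricci tensor depends only on base components and so vanishes on every
  -- term of the contraction. The trace of g is 4, whence 6c.
  simp only [h.ricci_walkerMetric hw, dualFibre]
  simp [walkerMetric_apply, h.ricci_base hw, curvature_zero, curvature_zero₃]
  ring

/-- The Weyl tensor of the modified Riemannian extension. -/
def walkerWeyl (Γ : Plane → Plane →L[ℝ] Plane →L[ℝ] Plane)
    (Φ : Plane → Plane →L[ℝ] Plane →L[ℝ] ℝ) (c : Plane → ℝ) (w X Y Z T : Plane × (Plane →L[ℝ] ℝ)) :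
    ℝ :=
  let g := walkerMetric Γ Φ c w
  let ρ := ricci (leviCivita (walkerMetric Γ Φ c)) w
  loweredCurvature (walkerMetric Γ Φ c) w X Y Z T
    -- The scalar curvature 6c is left unsimplified so that the expression has literally the shape
    -- of `weyl`.
    + 6 * c w.1 / 6 * (g X Z * g Y T - g X T * g Y Z)
    + 1 / 2 * (ρ X T * g Y Z - ρ X Z * g Y T + ρ Y Z * g X T - ρ Y T * g X Z)

/-- The null vector complementary to the fibres which projects to the coordinate vector `i`. -/
def nullLift (Γ : Plane → Plane →L[ℝ] Plane →L[ℝ] Plane) (Φ : Plane → Plane →L[ℝ] Plane →L[ℝ] ℝ)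
    (c : Plane → ℝ) (w : Plane × (Plane →L[ℝ] ℝ)) (i : Fin 2) : Plane × (Plane →L[ℝ] ℝ) :=
  (coordVec i, (-1 / 2 : ℝ) • extensionForm (Γ w.1) (Φ w.1) (c w.1) w.2 (coordVec i))

/-- The mixed block being a multiple of the identity is exactly what `IsNullBasis.isSelfDualForm`
asks of a 2-form. One argument is vertical, so the purely horizontal curvature is again absent. -/
theorem walkerWeyl_mixed (hw : w.1 ∈ U) (i j : Fin 2) (Z T : Plane × (Plane →L[ℝ] ℝ)) :
    walkerWeyl Γ Φ c w (nullLift Γ Φ c w i) (0, coordCovec j) Z T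
      = if i = j then walkerWeyl Γ Φ c w (nullLift Γ Φ c w 0) (0, coordCovec 0) Z T else 0 := by
  have hm := h.isMetricAt hw
  obtain ⟨z, ζ⟩ := Z
  obtain ⟨t, τ⟩ := T
  simp only [walkerWeyl, nullLift]
  rw [h.loweredCurvature_eq hw (coordVec i) 0 z t _ (coordCovec j) ζ τ,
    h.loweredCurvature_eq hw (coordVec 0) 0 z t _ (coordCovec 0) ζ τ]
  simp only [Prod.mk_zero_zero, hm.loweredCurvature_zero₂, hm.loweredCurvature_zero₃,
    h.loweredCurvature_one_vertical hw, h.ricci_walkerMetric hw, h.ricci_base hw, walkerMetric_apply]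
  obtain ⟨K₀, K₁, hK⟩ := h.exists_curvature_coord hw
  obtain ⟨g₀, g₁, g₂, hg⟩ := exists_conn_coord (h.symm_conn _ hw)
  obtain ⟨p₀, p₁, p₂, hp⟩ := exists_form_coord (h.symm_form _ hw)
  obtain ⟨a₀, a₁, ha⟩ := exists_covector_coord w.2
  obtain ⟨b₀, b₁, hb⟩ := exists_covector_coord ζ
  obtain ⟨d₀, d₁, hd⟩ := exists_covector_coord τ
  obtain ⟨c₀, c₁, hc⟩ := exists_covector_coord (fderiv ℝ c w.1)
  fin_cases i <;> fin_cases j <;> simp [hg, hp, ha, hb, hd, hc, hK] <;> ring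

end Ricci

end IsExtensionData

/-! ### Self-dual 2-forms in a null basis. -/

section SelfDual

variable {V : Type*} [AddCommGroup V] [Module ℝ V] [TopologicalSpace V]
  {g : V →L[ℝ] V →L[ℝ] ℝ}

/-- Laplace expansion along the first two columns: it exhibits the 2×2 minors that are the
components of bivectors. -/
theorem det_fin_four (M : Matrix (Fin 4) (Fin 4) ℝ) : M.det =
    (M 0 0 * M 1 1 - M 1 0 * M 0 1) * (M 2 2 * M 3 3 - M 3 2 * M 2 3)
    - (M 0 0 * M 2 1 - M 2 0 * M 0 1) * (M 1 2 * M 3 3 - M 3 2 * M 1 3)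
    + (M 0 0 * M 3 1 - M 3 0 * M 0 1) * (M 1 2 * M 2 3 - M 2 2 * M 1 3)
    + (M 1 0 * M 2 1 - M 2 0 * M 1 1) * (M 0 2 * M 3 3 - M 3 2 * M 0 3)
    - (M 1 0 * M 3 1 - M 3 0 * M 1 1) * (M 0 2 * M 2 3 - M 2 2 * M 0 3)
    + (M 2 0 * M 3 1 - M 3 0 * M 2 1) * (M 0 2 * M 1 3 - M 1 2 * M 0 3) := by
  simp [Matrix.det_succ_row_zero, Fin.sum_univ_succ, Fin.succAbove]
  ring

/-- A basis of two pairs of dual null vectors. -/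
structure IsNullBasis (g : V →L[ℝ] V →L[ℝ] ℝ) (n : Module.Basis (Fin 4) ℝ V) : Prop where
  symm : ∀ X Y, g X Y = g Y X
  g00 : g (n 0) (n 0) = 0
  g01 : g (n 0) (n 1) = 0
  g02 : g (n 0) (n 2) = 1
  g03 : g (n 0) (n 3) = 0
  g11 : g (n 1) (n 1) = 0
  g12 : g (n 1) (n 2) = 0
  g13 : g (n 1) (n 3) = 1
  g22 : g (n 2) (n 2) = 0
  g23 : g (n 2) (n 3) = 0
  g33 : g (n 3) (n 3) = 0

variable {n b : Module.Basis (Fin 4) ℝ V}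

theorem IsNullBasis.apply (h : IsNullBasis g n) (X Y : V) : g X Y =
    n.repr X 0 * n.repr Y 2 + n.repr X 2 * n.repr Y 0 + n.repr X 1 * n.repr Y 3
      + n.repr X 3 * n.repr Y 1 := by
  conv_lhs => rw [← n.sum_repr X, ← n.sum_repr Y]
  simp [-Module.Basis.sum_repr, Fin.sum_univ_four, h.g00, h.g01, h.g02, h.g03, h.g11, h.g12, h.g13, h.g22, h.g23, h.g33,
    h.symm (n 1) (n 0), h.symm (n 2) (n 0), h.symm (n 3) (n 0), h.symm (n 2) (n 1),
    h.symm (n 3) (n 1), h.symm (n 3) (n 2)]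
  ring

theorem IsOrthonormal.repr_eq (h : IsOrthonormal g b) (X : V) (i : Fin 4) :
    b.repr X i = g (b i) (b i) * g (b i) X := by
  have e : g (b i) X = b.repr X i * g (b i) (b i) := by
    conv_lhs => rw [← b.sum_repr X]
    rw [map_sum, Finset.sum_eq_single i]
    · simp
    · intro j _ hj
      simp [h.1 i j hj.symm]
    · simp
  rw [e]
  rcases h.2 i with h | h <;> rw [h] <;> ring

/-- The Gram matrix J of a null basis has determinant 1. With P the transition matrix, PᵀJP =
diag(±1) makes det² equal to ±1, hence 1, and the common orientation selects the positive root. -/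
theorem IsNullBasis.det_eq_one (h : IsNullBasis g n) (hb : IsOrthonormal g b)
    (ho : b.orientation = n.orientation) : n.det b = 1 := by
  have hpos : 0 < n.det b := (n.orientation_eq_iff_det_pos b).1 ho.symm
  have key : n.det b ^ 2 = g (b 0) (b 0) * g (b 1) (b 1) * g (b 2) (b 2) * g (b 3) (b 3) := by
    let J : Matrix (Fin 4) (Fin 4) ℝ := !![0, 0, 1, 0; 0, 0, 0, 1; 1, 0, 0, 0; 0, 1, 0, 0]
    have e : (n.toMatrix b).transpose * J * n.toMatrix b
        = Matrix.diagonal fun i => g (b i) (b i) := by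
      ext i j
      have e1 : ((n.toMatrix b).transpose * J * n.toMatrix b) i j = g (b i) (b j) := by
        rw [h.apply]
        simp [Matrix.mul_apply, Fin.sum_univ_four, J, Module.Basis.toMatrix_apply]
        ring
      rw [e1, Matrix.diagonal_apply]
      split_ifs with hij
      · rw [hij]
      · exact hb.1 i j hij
    have hJ : J.det = 1 := by rw [det_fin_four]; simp [J]
    have := congrArg Matrix.det e
    rw [Matrix.det_mul, Matrix.det_mul, hJ, Matrix.det_transpose, Matrix.det_diagonal,
      Fin.prod_univ_four] at this
    rw [n.det_apply, ← this]
    ring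
  have : n.det b ^ 2 = 1 := by
    have p : 0 < n.det b ^ 2 := by positivity
    rcases hb.2 0 with h0 | h0 <;> rcases hb.2 1 with h1 | h1 <;> rcases hb.2 2 with h2 | h2 <;>
      rcases hb.2 3 with h3 | h3 <;> rw [h0, h1, h2, h3] at key <;> linarith
  nlinarith

/-- The null and the orthonormal basis have the same volume form. The star operator can therefore be
read off in the null basis, where it fixes the 01 and 23 components and exchanges 02 with 13. -/
theorem IsNullBasis.isSelfDualForm (h : IsNullBasis g n) (β : V →ₗ[ℝ] V →ₗ[ℝ] ℝ)
    (hβ : ∀ X, β X X = 0) (h03 : β (n 0) (n 3) = 0) (h12 : β (n 1) (n 2) = 0)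
    (h13 : β (n 1) (n 3) = β (n 0) (n 2)) :
    IsSelfDualForm g n.orientation fun X Y => β X Y := by
  intro b hb ho
  have hdet : n.det = b.det := by
    rw [n.det.eq_smul_basis_det b, h.det_eq_one hb ho, one_smul]
  -- The volume form with b₀, b₁ inserted is the minor in the b₂, b₃ coordinates; passing from
  -- coordinates to scalar products costs the signs ε₂ε₃. On pairs from the null basis this compares
  -- the components of b₀∧b₁ with those of b₂∧b₃.
  have key (X Y : V) : n.det ![b 0, b 1, X, Y] = g (b 2) (b 2) * g (b 3) (b 3) *
      (g (b 2) X * g (b 3) Y - g (b 3) X * g (b 2) Y) := by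
    rw [hdet, b.det_apply, det_fin_four]
    simp [Module.Basis.toMatrix_apply, hb.repr_eq]
    ring
  have hanti (X Y : V) : β X Y = -β Y X := by
    have := hβ (X + Y)
    simp [hβ] at this
    linarith
  have expand (X Y : V) : β X Y =
      (n.repr X 0 * n.repr Y 1 - n.repr X 1 * n.repr Y 0) * β (n 0) (n 1)
      + (n.repr X 2 * n.repr Y 3 - n.repr X 3 * n.repr Y 2) * β (n 2) (n 3)
      + ((n.repr X 0 * n.repr Y 2 - n.repr X 2 * n.repr Y 0)
        + (n.repr X 1 * n.repr Y 3 - n.repr X 3 * n.repr Y 1)) * β (n 0) (n 2) := by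
    conv_lhs => rw [← n.sum_repr X, ← n.sum_repr Y]
    simp [-Module.Basis.sum_repr, Fin.sum_univ_four, hβ, h03, h12, h13, hanti (n 1) (n 0), hanti (n 2) (n 0),
      hanti (n 3) (n 0), hanti (n 2) (n 1), hanti (n 3) (n 1), hanti (n 3) (n 2)]
    ring
  have k01 := key (n 2) (n 3)
  have k23 := key (n 0) (n 1)
  have k13 := key (n 0) (n 2)
  have k02 := key (n 1) (n 3)
  simp only [n.det_apply, det_fin_four] at k01 k23 k13 k02
  simp [Module.Basis.toMatrix_apply, h.apply] at k01 k23 k13 k02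
  simp only [h.apply (b 2) (b 2), h.apply (b 3) (b 3)]
  rw [expand (b 0), expand (b 2)]
  linear_combination β (n 0) (n 1) * k01 + β (n 2) (n 3) * k23 - β (n 0) (n 2) * (k13 + k02)

end SelfDual

/-! ### Preferred charts of the surface and their coordinate fields. -/

section Charts

variable {S : Type*} [TopologicalSpace S] [ChartedSpace Plane S] [IsManifold (𝓡 2) ∞ S]

/-- The derivative at `x` of the preferred chart around `p`. -/
def chartDeriv (p x : S) : TangentSpace (𝓡 2) x →L[ℝ] Plane :=
  mfderiv (𝓡 2) 𝓘(ℝ, Plane) (extChartAt (𝓡 2) p) x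

/-- The components of a vector field in the preferred chart around `p`. -/
def components (p : S) (Y : Π x : S, TangentSpace (𝓡 2) x) (u : Plane) : Plane :=
  chartDeriv p ((extChartAt (𝓡 2) p).symm u) (Y ((extChartAt (𝓡 2) p).symm u))

omit [IsManifold (𝓡 2) ∞ S] in
theorem isOpen_chart_source (p : S) : IsOpen (extChartAt (𝓡 2) p).source :=
  isOpen_extChartAt_source p

omit [IsManifold (𝓡 2) ∞ S] in
theorem isOpen_chart_target (p : S) : IsOpen (extChartAt (𝓡 2) p).target :=
  isOpen_extChartAt_target p

variable {p q x : S}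

theorem chartDeriv_isInvertible (hx : x ∈ (extChartAt (𝓡 2) p).source) :
    (chartDeriv p x).IsInvertible :=
  isInvertible_mfderiv_extChartAt hx

theorem chartDeriv_coordField (hx : x ∈ (extChartAt (𝓡 2) p).source) (w : Plane) :
    chartDeriv p x (coordField (𝓡 2) p w x) = w :=
  (chartDeriv_isInvertible hx).self_apply_inverse w

theorem coordField_chartDeriv (hx : x ∈ (extChartAt (𝓡 2) p).source) (v : TangentSpace (𝓡 2) x) :
    coordField (𝓡 2) p (chartDeriv p x v) x = v :=
  (chartDeriv_isInvertible hx).inverse_apply_self v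

omit [IsManifold (𝓡 2) ∞ S] in
theorem coordField_add (w w' : Plane) :
    coordField (𝓡 2) p (w + w') x = coordField (𝓡 2) p w x + coordField (𝓡 2) p w' x :=
  map_add (chartDeriv p x).inverse w w'

omit [IsManifold (𝓡 2) ∞ S] in
theorem coordField_smul (a : ℝ) (w : Plane) :
    coordField (𝓡 2) p (a • w) x = a • coordField (𝓡 2) p w x :=
  map_smul (chartDeriv p x).inverse a w

omit [IsManifold (𝓡 2) ∞ S] in
theorem eventually_mem_chart_source (hx : x ∈ (extChartAt (𝓡 2) p).source) :
    ∀ᶠ y in 𝓝 x, y ∈ (extChartAt (𝓡 2) p).source :=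
  (isOpen_chart_source p).mem_nhds hx

theorem trivialization_snd (hx : x ∈ (extChartAt (𝓡 2) p).source) (v : TangentSpace (𝓡 2) x) :
    (trivializationAt Plane (TangentSpace (𝓡 2) : S → Type _) p ⟨x, v⟩).2 = chartDeriv p x v := by
  have hx' : x ∈ (chartAt Plane p).source := by rwa [extChartAt_source] at hx
  unfold chartDeriv
  rw [← TangentBundle.continuousLinearMapAt_trivializationAt hx',
    Bundle.Trivialization.continuousLinearMapAt_apply, Bundle.Trivialization.linearMapAt_apply,
    if_pos (by simpa using hx')]

theorem contMDiffAt_field_iff {n : WithTop ℕ∞} (hn : n ≤ ∞)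
    (hx : x ∈ (extChartAt (𝓡 2) p).source) (Y : Π x : S, TangentSpace (𝓡 2) x) :
    ContMDiffAt (𝓡 2) (𝓡 2).tangent n (fun y => (⟨y, Y y⟩ : TangentBundle (𝓡 2) S)) x ↔
      ContMDiffAt (𝓡 2) 𝓘(ℝ, Plane) n (fun y => chartDeriv p y (Y y)) x := by
  have hx' : x ∈ (chartAt Plane p).source := by rwa [extChartAt_source] at hx
  have : ContMDiffVectorBundle n Plane (TangentSpace (𝓡 2) : S → Type _) (𝓡 2) :=
    ContMDiffVectorBundle.of_le hn
  refine (Bundle.Trivialization.contMDiffAt_section_iff (IB := 𝓡 2)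
    (trivializationAt Plane (TangentSpace (𝓡 2) : S → Type _) p) (by simpa using hx')).trans ?_
  apply Filter.EventuallyEq.contMDiffAt_iff
  filter_upwards [eventually_mem_chart_source hx] with y hy using trivialization_snd hy _

theorem contMDiffAt_coordField (hx : x ∈ (extChartAt (𝓡 2) p).source) (w : Plane) :
    ContMDiffAt (𝓡 2) (𝓡 2).tangent ∞
      (fun y => (⟨y, coordField (𝓡 2) p w y⟩ : TangentBundle (𝓡 2) S)) x := by
  rw [contMDiffAt_field_iff le_rfl hx]
  refine contMDiffAt_const (c := w) |>.congr_of_eventuallyEq ?_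
  filter_upwards [eventually_mem_chart_source hx] with y hy using chartDeriv_coordField hy _

theorem contMDiffAt_chart_symm {u : Plane} (hu : u ∈ (extChartAt (𝓡 2) p).target) :
    ContMDiffAt 𝓘(ℝ, Plane) (𝓡 2) ∞ (extChartAt (𝓡 2) p).symm u :=
  (contMDiffOn_extChartAt_symm p).contMDiffAt ((isOpen_chart_target p).mem_nhds hu)

theorem contDiffAt_components {u : Plane} (hu : u ∈ (extChartAt (𝓡 2) p).target)
    {Y : Π x : S, TangentSpace (𝓡 2) x} (hY : ContMDiffAt (𝓡 2) (𝓡 2).tangent ∞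
      (fun y => (⟨y, Y y⟩ : TangentBundle (𝓡 2) S)) ((extChartAt (𝓡 2) p).symm u)) :
    ContDiffAt ℝ ∞ (components p Y) u := by
  rw [contMDiffAt_field_iff le_rfl ((extChartAt (𝓡 2) p).map_target hu)] at hY
  exact (hY.comp u (contMDiffAt_chart_symm hu)).contDiffAt

theorem mfderiv_chart {F : Type*} [NormedAddCommGroup F] [NormedSpace ℝ F] {f : S → F}
    (hx : x ∈ (extChartAt (𝓡 2) p).source) (hf : MDifferentiableAt (𝓡 2) 𝓘(ℝ, F) f x)
    (X : TangentSpace (𝓡 2) x) :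
    (mfderiv (𝓡 2) 𝓘(ℝ, F) f x : TangentSpace (𝓡 2) x →L[ℝ] F) X
      = fderiv ℝ (f ∘ (extChartAt (𝓡 2) p).symm) (extChartAt (𝓡 2) p x) (chartDeriv p x X) := by
  have hl := (extChartAt (𝓡 2) p).left_inv hx
  have h1 : MDifferentiableAt 𝓘(ℝ, Plane) 𝓘(ℝ, F) (f ∘ (extChartAt (𝓡 2) p).symm)
      (extChartAt (𝓡 2) p x) := by
    refine MDifferentiableAt.comp (I' := 𝓡 2) _ (by rwa [hl]) ?_
    exact (contMDiffAt_chart_symm ((extChartAt (𝓡 2) p).map_source hx)).mdifferentiableAt (by simp)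
  have h2 : MDifferentiableAt (𝓡 2) 𝓘(ℝ, Plane) (extChartAt (𝓡 2) p) x :=
    mdifferentiableAt_extChartAt (by rwa [extChartAt_source] at hx)
  have e : f =ᶠ[𝓝 x] (f ∘ (extChartAt (𝓡 2) p).symm) ∘ extChartAt (𝓡 2) p := by
    filter_upwards [eventually_mem_chart_source hx] with y hy
    simp only [Function.comp_apply, (extChartAt (𝓡 2) p).left_inv hy]
  have k := mfderiv_comp x h1 h2
  rw [← e.mfderiv_eq, mfderiv_eq_fderiv] at k
  exact congrArg (fun L : TangentSpace (𝓡 2) x →L[ℝ] F => L X) k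

theorem mvfderiv_chart {f : S → ℝ} (hx : x ∈ (extChartAt (𝓡 2) p).source)
    (hf : MDifferentiableAt (𝓡 2) 𝓘(ℝ) f x) (X : TangentSpace (𝓡 2) x) :
    mvfderiv (𝓡 2) f x X
      = fderiv ℝ (f ∘ (extChartAt (𝓡 2) p).symm) (extChartAt (𝓡 2) p x) (chartDeriv p x X) :=
  mfderiv_chart hx hf X

/-- The coordinate change between two preferred charts. -/
def transition (p q : S) (u : Plane) : Plane :=
  extChartAt (𝓡 2) q ((extChartAt (𝓡 2) p).symm u)

/-- The domain of the coordinate change between two preferred charts. -/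
def overlap (p q : S) : Set Plane :=
  (extChartAt (𝓡 2) p).target ∩ (extChartAt (𝓡 2) p).symm ⁻¹' (extChartAt (𝓡 2) q).source

omit [IsManifold (𝓡 2) ∞ S] in
theorem isOpen_overlap (p q : S) : IsOpen (overlap p q) :=
  (continuousOn_extChartAt_symm p).isOpen_inter_preimage (isOpen_chart_target p)
    (isOpen_chart_source q)

omit [IsManifold (𝓡 2) ∞ S] in
theorem mem_overlap (hp : x ∈ (extChartAt (𝓡 2) p).source)
    (hq : x ∈ (extChartAt (𝓡 2) q).source) : extChartAt (𝓡 2) p x ∈ overlap p q :=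
  ⟨(extChartAt (𝓡 2) p).map_source hp, by
    rw [Set.mem_preimage, (extChartAt (𝓡 2) p).left_inv hp]
    exact hq⟩

omit [IsManifold (𝓡 2) ∞ S] in
theorem components_transition (Y : Π x : S, TangentSpace (𝓡 2) x) {u : Plane}
    (hu : u ∈ overlap p q) : components q Y (transition p q u)
      = chartDeriv q ((extChartAt (𝓡 2) p).symm u) (Y ((extChartAt (𝓡 2) p).symm u)) :=
  congrArg (fun y => chartDeriv q y (Y y)) ((extChartAt (𝓡 2) q).left_inv hu.2)

theorem contDiffOn_transition (p q : S) : ContDiffOn ℝ ∞ (transition p q) (overlap p q) := by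
  intro u hu
  have h1 := contMDiffAt_chart_symm hu.1
  have hq := hu.2
  rw [Set.mem_preimage, extChartAt_source] at hq
  exact ((contMDiffAt_extChartAt' (n := ∞) hq).comp u h1).contDiffAt.contDiffWithinAt

theorem chartDeriv_transition (hp : x ∈ (extChartAt (𝓡 2) p).source)
    (hq : x ∈ (extChartAt (𝓡 2) q).source) (X : TangentSpace (𝓡 2) x) :
    chartDeriv q x X = fderiv ℝ (transition p q) (extChartAt (𝓡 2) p x) (chartDeriv p x X) :=
  mfderiv_chart hp (mdifferentiableAt_extChartAt (by rwa [extChartAt_source] at hq)) X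

end Charts

/-! ### Christoffel symbols of the affine connection in charts. -/

section Connection

variable {S : Type*} [TopologicalSpace S] [ChartedSpace Plane S] [IsManifold (𝓡 2) ∞ S]
  (D : CovariantDerivative (𝓡 2) Plane (TangentSpace (𝓡 2) : S → Type _)) {p q x : S}

theorem affineChristoffel_apply (u v w : Plane) : affineChristoffel D p u v w =
    chartDeriv p ((extChartAt (𝓡 2) p).symm u) (D (coordField (𝓡 2) p w)
      ((extChartAt (𝓡 2) p).symm u) (coordField (𝓡 2) p v ((extChartAt (𝓡 2) p).symm u))) := rfl

theorem affineChristoffel_chart (hx : x ∈ (extChartAt (𝓡 2) p).source) (v w : Plane) :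
    affineChristoffel D p (extChartAt (𝓡 2) p x) v w
      = chartDeriv p x (D (coordField (𝓡 2) p w) x (coordField (𝓡 2) p v x)) := by
  rw [affineChristoffel_apply, (extChartAt (𝓡 2) p).left_inv hx]

theorem mdifferentiableAt_of_contMDiffAt {Y : Π x : S, TangentSpace (𝓡 2) x}
    (hY : ContMDiffAt (𝓡 2) (𝓡 2).tangent ∞ (fun y => (⟨y, Y y⟩ : TangentBundle (𝓡 2) S)) x) :
    MDifferentiableAt (𝓡 2) (𝓡 2).tangent (fun y => (⟨y, Y y⟩ : TangentBundle (𝓡 2) S)) x :=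
  hY.mdifferentiableAt (by simp)

/-- The covariant derivative in a chart. -/
theorem chartDeriv_covariantDerivative (hx : x ∈ (extChartAt (𝓡 2) p).source)
    {Y : Π x : S, TangentSpace (𝓡 2) x} (hY : ContMDiffAt (𝓡 2) (𝓡 2).tangent ∞
      (fun y => (⟨y, Y y⟩ : TangentBundle (𝓡 2) S)) x) (X : TangentSpace (𝓡 2) x) :
    chartDeriv p x (D Y x X)
      = fderiv ℝ (components p Y) (extChartAt (𝓡 2) p x) (chartDeriv p x X)
        + (chartDeriv p x (Y x) 0 • affineChristoffel D p (extChartAt (𝓡 2) p x)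
            (chartDeriv p x X) (coordVec 0)
          + chartDeriv p x (Y x) 1 • affineChristoffel D p (extChartAt (𝓡 2) p x)
            (chartDeriv p x X) (coordVec 1)) := by
  let f (i : Fin 2) : S → ℝ := fun y => chartDeriv p y (Y y) i
  have hY' := (contMDiffAt_field_iff le_rfl hx Y).1 hY
  have hf (i : Fin 2) : MDifferentiableAt (𝓡 2) 𝓘(ℝ) (f i) x :=
    ((coordCovec i).contMDiff.contMDiffAt.comp x hY').mdifferentiableAt (by simp)
  have hC (i : Fin 2) := mdifferentiableAt_of_contMDiffAt (contMDiffAt_coordField hx (coordVec i))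
  have hfC (i : Fin 2) := (hf i).smul_section (hC i)
  have hcov := D.isCovariantDerivativeOn (s := Set.univ)
  -- Near x the field Y equals its coordinate expansion. Since D is local, additivity and the
  -- Leibniz rule apply to that expansion.
  have e : D Y x = D (f 0 • coordField (𝓡 2) p (coordVec 0)
      + f 1 • coordField (𝓡 2) p (coordVec 1)) x := by
    apply hcov.congr_of_eventuallyEq (mdifferentiableAt_of_contMDiffAt hY)
      (mdifferentiableAt_add_section (hfC 0) (hfC 1)) Filter.univ_mem
    filter_upwards [eventually_mem_chart_source hx] with y hy
    conv_lhs => rw [← coordField_chartDeriv hy (Y y), plane_eq (chartDeriv p y (Y y))]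
    rw [coordField_add, coordField_smul, coordField_smul]
    rfl
  rw [e, hcov.add (hfC 0) (hfC 1), hcov.leibniz (hC 0) (hf 0), hcov.leibniz (hC 1) (hf 1)]
  have hfd (i : Fin 2) : mvfderiv (𝓡 2) (f i) x X
      = fderiv ℝ (components p Y) (extChartAt (𝓡 2) p x) (chartDeriv p x X) i := by
    have hl := (extChartAt (𝓡 2) p).left_inv hx
    have hd : DifferentiableAt ℝ (components p Y) (extChartAt (𝓡 2) p x) :=
      (contDiffAt_components ((extChartAt (𝓡 2) p).map_source hx) (by rwa [hl])).differentiableAt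
        (by simp)
    rw [mvfderiv_chart hx (hf i)]
    have := ((coordCovec i).hasFDerivAt.comp _ hd.hasFDerivAt).fderiv
    exact congrArg (fun L : Plane →L[ℝ] ℝ => L (chartDeriv p x X)) this
  have k (i : Fin 2) : affineChristoffel D p (extChartAt (𝓡 2) p x) (chartDeriv p x X) (coordVec i)
      = chartDeriv p x (D (coordField (𝓡 2) p (coordVec i)) x X) := by
    rw [affineChristoffel_chart D hx, coordField_chartDeriv hx]
  rw [k, k, plane_eq (fderiv ℝ (components p Y) _ _), ← hfd, ← hfd]
  simp only [add_apply, smul_apply, ContinuousLinearMap.smulRight_apply, map_add, map_smul,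
    chartDeriv_coordField hx]
  simp only [f]
  abel

theorem affineChristoffel_add_left (u v v' w : Plane) : affineChristoffel D p u (v + v') w
    = affineChristoffel D p u v w + affineChristoffel D p u v' w := by
  simp only [affineChristoffel_apply, coordField_add, map_add]

theorem affineChristoffel_smul_left (u v w : Plane) (a : ℝ) : affineChristoffel D p u (a • v) w
    = a • affineChristoffel D p u v w := by
  simp only [affineChristoffel_apply, coordField_smul, map_smul]

/-- The Christoffel symbols in the preferred chart around `p`, as a bilinear map. -/
def chartConn (p : S) (u : Plane) : Plane →L[ℝ] Plane →L[ℝ] Plane :=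
  ∑ i, ∑ j, (coordCovec i).smulRight
    ((coordCovec j).smulRight (affineChristoffel D p u (coordVec i) (coordVec j)))

theorem components_coordField {u : Plane} (hu : u ∈ (extChartAt (𝓡 2) p).target) (w : Plane) :
    components p (coordField (𝓡 2) p w) u = w :=
  chartDeriv_coordField ((extChartAt (𝓡 2) p).map_target hu) w

/-- Linearity in `w` comes from the coordinate formula for D, applied to a coordinate field: its
components are constant, so the derivative term drops out. -/
theorem chartConn_apply {u : Plane} (hu : u ∈ (extChartAt (𝓡 2) p).target) (v w : Plane) :
    chartConn D p u v w = affineChristoffel D p u v w := by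
  have hx := (extChartAt (𝓡 2) p).map_target hu
  have hr := (extChartAt (𝓡 2) p).right_inv hu
  have e : fderiv ℝ (components p (coordField (𝓡 2) p w)) u = 0 := by
    have : components p (coordField (𝓡 2) p w) =ᶠ[𝓝 u] fun _ => w := by
      filter_upwards [(isOpen_chart_target p).mem_nhds hu] with t ht
        using components_coordField ht w
    rw [this.fderiv_eq]
    simp
  have k := chartDeriv_covariantDerivative D hx (contMDiffAt_coordField hx w)
    (coordField (𝓡 2) p v ((extChartAt (𝓡 2) p).symm u))
  simp only [hr, e, chartDeriv_coordField hx] at k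
  rw [affineChristoffel_apply, k]
  conv_rhs => rw [plane_eq v]
  simp only [affineChristoffel_add_left, affineChristoffel_smul_left]
  simp [chartConn, Fin.sum_univ_two]
  module

theorem chartDeriv_covariantDerivative' (hx : x ∈ (extChartAt (𝓡 2) p).source)
    {Y : Π x : S, TangentSpace (𝓡 2) x} (hY : ContMDiffAt (𝓡 2) (𝓡 2).tangent ∞
      (fun y => (⟨y, Y y⟩ : TangentBundle (𝓡 2) S)) x) (X : TangentSpace (𝓡 2) x) :
    chartDeriv p x (D Y x X)
      = fderiv ℝ (components p Y) (extChartAt (𝓡 2) p x) (chartDeriv p x X)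
        + chartConn D p (extChartAt (𝓡 2) p x) (chartDeriv p x X) (chartDeriv p x (Y x)) := by
  have hu := (extChartAt (𝓡 2) p).map_source hx
  rw [chartDeriv_covariantDerivative D hx hY, ← chartConn_apply D hu, ← chartConn_apply D hu]
  conv_rhs => rw [plane_eq (chartDeriv p x (Y x))]
  simp

/-- The transformation law of the Christoffel symbols. -/
theorem chartConn_transition {u : Plane} (hu : u ∈ overlap p q) (v w : Plane) :
    fderiv ℝ (transition p q) u (chartConn D p u v w)
      = fderiv ℝ (fun t => fderiv ℝ (transition p q) t w) u v
        + chartConn D q (transition p q u) (fderiv ℝ (transition p q) u v)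
          (fderiv ℝ (transition p q) u w) := by
  have hp := (extChartAt (𝓡 2) p).map_target hu.1
  have hq := hu.2
  rw [Set.mem_preimage] at hq
  have hr := (extChartAt (𝓡 2) p).right_inv hu.1
  have hY := contMDiffAt_coordField hp w
  -- The covariant derivative of one coordinate field of `p` along another is evaluated in the chart
  -- around `q`, where their components are the images under the differential of the transition.
  have k := chartDeriv_covariantDerivative' D hq hY
    (coordField (𝓡 2) p v ((extChartAt (𝓡 2) p).symm u))
  have tr := chartDeriv_transition hp hq
  rw [hr] at tr
  rw [tr, tr, tr, chartDeriv_coordField hp, chartDeriv_coordField hp, ← affineChristoffel_apply,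
    ← chartConn_apply D hu.1] at k
  rw [k]
  change _ = _ + chartConn D q (extChartAt (𝓡 2) q ((extChartAt (𝓡 2) p).symm u)) _ _
  congr 1
  have hO := (isOpen_overlap p q).mem_nhds hu
  have hτ := ((contDiffOn_transition p q).contDiffAt hO).differentiableAt (by simp)
  have hc : DifferentiableAt ℝ (components q (coordField (𝓡 2) p w)) (transition p q u) := by
    refine (contDiffAt_components ((extChartAt (𝓡 2) q).map_source hq) ?_).differentiableAt (by simp)
    rwa [(extChartAt (𝓡 2) q).left_inv hq]
  have e : (fun t => fderiv ℝ (transition p q) t w) =ᶠ[𝓝 u]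
      components q (coordField (𝓡 2) p w) ∘ transition p q := by
    filter_upwards [hO] with t ht
    have hpt := (extChartAt (𝓡 2) p).map_target ht.1
    have hqt := ht.2
    rw [Set.mem_preimage] at hqt
    rw [Function.comp_apply, components_transition _ ht, chartDeriv_transition hpt hqt,
      chartDeriv_coordField hpt, (extChartAt (𝓡 2) p).right_inv ht.1]
  rw [e.fderiv_eq, (hc.hasFDerivAt.comp u hτ.hasFDerivAt).fderiv]
  rfl

theorem mlieBracket_eq_lieBracket {E : Type*} [NormedAddCommGroup E] [NormedSpace ℝ E]
    (V W : Π y : E, TangentSpace 𝓘(ℝ, E) y) (y : E) :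
    VectorField.mlieBracket 𝓘(ℝ, E) V W y = VectorField.lieBracket ℝ V W y := by
  rw [← VectorField.mlieBracketWithin_univ, VectorField.mlieBracketWithin_eq_lieBracketWithin]
  exact congrFun (VectorField.lieBracketWithin_univ (𝕜 := ℝ) (V := fun y => (V y : E))
    (W := fun y => (W y : E))) y

/-- Coordinate fields are pull-backs of constant fields and so commute; vanishing torsion is then
symmetry of the Christoffel symbols. -/
theorem chartConn_symm (htorsion : D.torsion = 0) {u : Plane}
    (hu : u ∈ (extChartAt (𝓡 2) p).target) (v w : Plane) :
    chartConn D p u v w = chartConn D p u w v := by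
  have hx := (extChartAt (𝓡 2) p).map_target hu
  have hC (w : Plane) := mdifferentiableAt_of_contMDiffAt (contMDiffAt_coordField hx w)
  have t := (CovariantDerivative.torsion_eq_zero_iff D).1 htorsion (hC v) (hC w)
  have hb : VectorField.mlieBracket (𝓡 2) (coordField (𝓡 2) p v) (coordField (𝓡 2) p w)
      ((extChartAt (𝓡 2) p).symm u) = 0 := by
    have hs : (extChartAt (𝓡 2) p).symm u ∈ (chartAt Plane p).source := by
      rwa [extChartAt_source] at hx
    have hc (w : Plane) (y : Plane) : MDifferentiableAt 𝓘(ℝ, Plane) 𝓘(ℝ, Plane).tangent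
        (fun y => (⟨y, w⟩ : TangentBundle 𝓘(ℝ, Plane) Plane)) y :=
      (contMDiffAt_vectorSpace_iff_contDiffAt (n := 1) (V := fun _ : Plane => w)).2
        contDiffAt_const |>.mdifferentiableAt (by simp)
    have h2 : (2 : WithTop ℕ∞) ≤ ∞ := ENat.LEInfty.out
    have : IsManifold (𝓡 2) (minSmoothness ℝ 2) S := by
      rw [minSmoothness_of_isRCLikeNormedField]
      exact IsManifold.of_le h2
    refine (VectorField.mpullback_mlieBracket (hc v _) (hc w _)
      (contMDiffAt_extChartAt' (n := ∞) hs) (by simpa using h2)).symm.trans ?_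
    have h0 (y : Plane) : VectorField.mlieBracket 𝓘(ℝ, Plane)
        (fun y => (v : TangentSpace 𝓘(ℝ, Plane) y)) (fun _ => w) y = 0 := by
      refine (mlieBracket_eq_lieBracket _ _ y).trans ?_
      rw [VectorField.lieBracket_eq]
      change fderiv ℝ (fun _ : Plane => w) y v - fderiv ℝ (fun _ : Plane => v) y w = 0
      simp
    exact (congrArg (chartDeriv p ((extChartAt (𝓡 2) p).symm u)).inverse (h0 _)).trans
      (map_zero _)
  rw [hb, sub_eq_zero] at t
  rw [chartConn_apply D hu, chartConn_apply D hu, affineChristoffel_apply, affineChristoffel_apply,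
    t]

/-- Smoothness of `D` is applied to a globally smooth field, so the coordinate field is cut off by a
bump function. Near x nothing changes, as D is local. -/
theorem contMDiffAt_covariantDerivative [T2Space S]
    (hD : CovariantDerivative.ContMDiffCovariantDerivative D ∞)
    (hx : x ∈ (extChartAt (𝓡 2) p).source) (v w : Plane) :
    ContMDiffAt (𝓡 2) (𝓡 2).tangent ∞ (fun y => (⟨y, D (coordField (𝓡 2) p w) y
      (coordField (𝓡 2) p v y)⟩ : TangentBundle (𝓡 2) S)) x := by
  obtain ⟨χ, -, hχ⟩ := (SmoothBumpFunction.nhds_basis_tsupport (I := 𝓡 2) x).mem_iff.1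
    ((isOpen_chart_source p).mem_nhds hx)
  have hσ : ContMDiff (𝓡 2) (𝓡 2).tangent ∞ (fun y =>
      (⟨y, ((χ : S → ℝ) • coordField (𝓡 2) p w) y⟩ : TangentBundle (𝓡 2) S)) :=
    χ.contMDiff.contMDiffOn.smul_section_of_tsupport (isOpen_chart_source p) hχ
      fun y hy => (contMDiffAt_coordField hy w).contMDiffWithinAt
  have h1 := (hD.contMDiff.contMDiff (σ := (χ : S → ℝ) • coordField (𝓡 2) p w)
    hσ.contMDiffOn).contMDiffAt (x := x) Filter.univ_mem
  refine ContMDiffAt.congr_of_eventuallyEq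
    (h1.clm_bundle_apply (contMDiffAt_coordField hx v)) ?_
  have h2 := χ.eventuallyEq_one.eventuallyEq_nhds
  filter_upwards [h2, eventually_mem_chart_source hx] with y hy hyp
  have hcov := D.isCovariantDerivativeOn (s := Set.univ)
  have : D (coordField (𝓡 2) p w) y = D ((χ : S → ℝ) • coordField (𝓡 2) p w) y := by
    apply hcov.congr_of_eventuallyEq
      (mdifferentiableAt_of_contMDiffAt (contMDiffAt_coordField hyp w))
      (mdifferentiableAt_of_contMDiffAt hσ.contMDiffAt) Filter.univ_mem
    filter_upwards [hy] with z hz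
    rw [Pi.smul_apply', hz, Pi.one_apply, one_smul]
  rw [this]

theorem contDiffOn_chartConn [T2Space S] (hD : CovariantDerivative.ContMDiffCovariantDerivative D ∞)
    (p : S) : ContDiffOn ℝ ∞ (chartConn D p) (extChartAt (𝓡 2) p).target := by
  have key (i j : Fin 2) : ContDiffOn ℝ ∞
      (fun u => affineChristoffel D p u (coordVec i) (coordVec j)) (extChartAt (𝓡 2) p).target := by
    intro u hu
    exact (contDiffAt_components hu (contMDiffAt_covariantDerivative D hD
      ((extChartAt (𝓡 2) p).map_target hu) (coordVec i) (coordVec j))).contDiffWithinAt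
  refine ContDiffOn.sum fun i _ => ContDiffOn.sum fun j _ => ?_
  exact contDiffOn_const.smulRight (contDiffOn_const.smulRight (key i j))

end Connection

/-! ### Tensoriality of curvature, Ricci tensor and Hessian. -/

section CoordinateChange

variable {V : Type*} [NormedAddCommGroup V] [NormedSpace ℝ V]
  {Γ Γ' : V → V →L[ℝ] V →L[ℝ] V} {u : V} {X Y Z : V}

theorem curvature_clm (hΓ : DifferentiableAt ℝ Γ u) (X Y Z : V) :
    curvature (fun t v w => Γ t v w) u X Y Z
      = (fderiv ℝ Γ u Y X Z + Γ u Y (Γ u X Z)) - (fderiv ℝ Γ u X Y Z + Γ u X (Γ u Y Z)) := by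
  have key (X Y Z : V) : fderiv ℝ (fun t => Γ t X Z) u Y = fderiv ℝ Γ u Y X Z := by
    have h1 := (hΓ.hasFDerivAt.clm_apply (hasFDerivAt_const X u)).clm_apply (hasFDerivAt_const Z u)
    rw [h1.fderiv]
    simp
  rw [curvature, key, key]

theorem hessian_clm {f : V → ℝ} (hf : ContDiffAt ℝ 2 f u) (Γ : V → V → V → V) (X Y : V) :
    hessian Γ f u X Y = fderiv ℝ (fderiv ℝ f) u X Y - fderiv ℝ f u (Γ u X Y) := by
  have hd : DifferentiableAt ℝ (fderiv ℝ f) u :=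
    (hf.fderiv_right (m := 1) (by norm_num)).differentiableAt (by simp)
  rw [hessian, (hd.hasFDerivAt.clm_apply (hasFDerivAt_const Y u)).fderiv]
  simp

/-- The map `Z ↦ R(X,Z)Y` whose trace is the Ricci tensor. -/
def ricciOperator (Γ : V → V →L[ℝ] V →L[ℝ] V) (u X Y : V) : V →ₗ[ℝ] V :=
  (((fderiv ℝ Γ u).flip X).flip Y + (Γ u).flip (Γ u X Y)
    - ((fderiv ℝ Γ u X).flip Y + (Γ u X).comp ((Γ u).flip Y))).toLinearMap

theorem ricciOperator_apply (hΓ : DifferentiableAt ℝ Γ u) (X Y Z : V) :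
    ricciOperator Γ u X Y Z = curvature (fun t v w => Γ t v w) u X Z Y := by
  rw [curvature_clm hΓ]
  simp [ricciOperator]

theorem ricci_eq_trace [FiniteDimensional ℝ V] (hΓ : DifferentiableAt ℝ Γ u) (X Y : V) :
    ricci (fun t v w => Γ t v w) u X Y = LinearMap.trace ℝ V (ricciOperator Γ u X Y) := by
  rw [LinearMap.trace_eq_matrix_trace ℝ (Module.finBasis ℝ V), Matrix.trace]
  refine Finset.sum_congr rfl fun i _ => ?_
  rw [Matrix.diag_apply, LinearMap.toMatrix_apply, ricciOperator_apply hΓ]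
  rfl

theorem ricciOperator_add_left (X X' Y : V) :
    ricciOperator Γ u (X + X') Y = ricciOperator Γ u X Y + ricciOperator Γ u X' Y := by
  ext Z
  simp [ricciOperator]
  abel

theorem ricciOperator_add_right (X Y Y' : V) :
    ricciOperator Γ u X (Y + Y') = ricciOperator Γ u X Y + ricciOperator Γ u X Y' := by
  ext Z
  simp [ricciOperator]
  abel

theorem ricciOperator_smul_left (a : ℝ) (X Y : V) :
    ricciOperator Γ u (a • X) Y = a • ricciOperator Γ u X Y := by
  ext Z
  simp [ricciOperator]
  module

theorem ricciOperator_smul_right (a : ℝ) (X Y : V) :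
    ricciOperator Γ u X (a • Y) = a • ricciOperator Γ u X Y := by
  ext Z
  simp [ricciOperator]
  module

/-- The coordinate change `τ` carries the Christoffel symbols `Γ` near `u` to `Γ'`. -/
structure IsConnectionChange (τ : V → V) (Γ Γ' : V → V →L[ℝ] V →L[ℝ] V) (u : V) : Prop where
  smooth : ContDiffAt ℝ ∞ τ u
  smooth_left : ContDiffAt ℝ ∞ Γ u
  smooth_right : ContDiffAt ℝ ∞ Γ' (τ u)
  law : ∀ᶠ t in 𝓝 u, ∀ v w, fderiv ℝ τ t (Γ t v w)
    = fderiv ℝ (fun s => fderiv ℝ τ s w) t v + Γ' (τ t) (fderiv ℝ τ t v) (fderiv ℝ τ t w)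

namespace IsConnectionChange

variable {τ : V → V}

theorem law_clm (h : IsConnectionChange τ Γ Γ' u) : ∀ᶠ t in 𝓝 u, ∀ v w,
    fderiv ℝ τ t (Γ t v w) = fderiv ℝ (fderiv ℝ τ) t v w
      + Γ' (τ t) (fderiv ℝ τ t v) (fderiv ℝ τ t w) := by
  have h2 : ContDiffAt ℝ 2 τ u := h.smooth.of_le ENat.LEInfty.out
  filter_upwards [h.law, h2.eventually (by simp)] with t ht ht2 v w
  have hd : DifferentiableAt ℝ (fderiv ℝ τ) t :=
    (ht2.fderiv_right (m := 1) (by norm_num)).differentiableAt (by simp)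
  rw [ht, (hd.hasFDerivAt.clm_apply (hasFDerivAt_const w t)).fderiv]
  simp

/-- Differentiate the transformation law and skew-symmetrise in X, Y: the third derivative of τ and
the terms with its Hessian cancel by symmetry, and the tensor law remains. -/
theorem curvature_change (h : IsConnectionChange τ Γ Γ' u) (X Y Z : V) :
    fderiv ℝ τ u (curvature (fun t v w => Γ t v w) u X Y Z)
      = curvature (fun t v w => Γ' t v w) (τ u) (fderiv ℝ τ u X) (fderiv ℝ τ u Y)
          (fderiv ℝ τ u Z) := by
  have hΓ := h.smooth_left.differentiableAt (by simp)
  have hΓ' := h.smooth_right.differentiableAt (by simp)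
  have hA' : ContDiffAt ℝ ∞ (fderiv ℝ τ) u := h.smooth.fderiv_right (by simp)
  have hA := hA'.differentiableAt (by simp)
  have hB : DifferentiableAt ℝ (fderiv ℝ (fderiv ℝ τ)) u :=
    (hA'.fderiv_right (m := ∞) (by simp)).differentiableAt (by simp)
  have hτ := h.smooth.differentiableAt (by simp)
  have s2 (v w : V) : fderiv ℝ (fderiv ℝ τ) u v w = fderiv ℝ (fderiv ℝ τ) u w v :=
    h.smooth.isSymmSndFDerivAt (by simpa using ENat.LEInfty.out) v w
  have s3 (v w : V) : fderiv ℝ (fderiv ℝ (fderiv ℝ τ)) u v w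
      = fderiv ℝ (fderiv ℝ (fderiv ℝ τ)) u w v :=
    hA'.isSymmSndFDerivAt (by simpa using ENat.LEInfty.out) v w
  have key (X Y Z : V) : fderiv ℝ (fderiv ℝ τ) u Y (Γ u X Z) + fderiv ℝ τ u (fderiv ℝ Γ u Y X Z)
      = fderiv ℝ (fderiv ℝ (fderiv ℝ τ)) u Y X Z
        + (fderiv ℝ Γ' (τ u) (fderiv ℝ τ u Y) (fderiv ℝ τ u X) (fderiv ℝ τ u Z)
        + Γ' (τ u) (fderiv ℝ (fderiv ℝ τ) u Y X) (fderiv ℝ τ u Z)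
        + Γ' (τ u) (fderiv ℝ τ u X) (fderiv ℝ (fderiv ℝ τ) u Y Z)) := by
    have e : (fun t => fderiv ℝ τ t (Γ t X Z)) =ᶠ[𝓝 u] fun t => fderiv ℝ (fderiv ℝ τ) t X Z
        + Γ' (τ t) (fderiv ℝ τ t X) (fderiv ℝ τ t Z) := h.law_clm.mono fun t ht => ht X Z
    have hl := hA.hasFDerivAt.clm_apply ((hΓ.hasFDerivAt.clm_apply
      (hasFDerivAt_const X u)).clm_apply (hasFDerivAt_const Z u))
    have hr1 := (hB.hasFDerivAt.clm_apply (hasFDerivAt_const X u)).clm_apply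
      (hasFDerivAt_const Z u)
    have hr2 := ((hΓ'.hasFDerivAt.comp u hτ.hasFDerivAt).clm_apply
      (hA.hasFDerivAt.clm_apply (hasFDerivAt_const X u))).clm_apply
      (hA.hasFDerivAt.clm_apply (hasFDerivAt_const Z u))
    have k := e.fderiv_eq (𝕜 := ℝ)
    rw [hl.fderiv] at k
    have k2 := (hr1.add hr2).fderiv
    have k3 := congrArg (fun L : V →L[ℝ] V => L Y) (k.trans k2)
    simp at k3
    rw [add_comm, k3]
    abel
  have law := h.law_clm.self_of_nhds
  rw [curvature_clm hΓ, curvature_clm hΓ', map_sub, map_add, map_add, law Y, law X (Γ u Y Z),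
    law X Z, law Y Z, map_add, map_add]
  have k1 := key X Y Z
  have k2 := key Y X Z
  rw [s3 X Y, s2 X Y] at k2
  rw [← sub_eq_zero] at k1 k2 ⊢
  rw [← sub_eq_zero.2 (k1.trans k2.symm)]
  abel

/-- By `curvature_change` the two Ricci operators are conjugate under the differential of τ, so
their traces agree. -/
theorem ricci_change [FiniteDimensional ℝ V] (h : IsConnectionChange τ Γ Γ' u)
    (hA : Function.Bijective (fderiv ℝ τ u)) (X Y : V) :
    ricci (fun t v w => Γ t v w) u X Y
      = ricci (fun t v w => Γ' t v w) (τ u) (fderiv ℝ τ u X) (fderiv ℝ τ u Y) := by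
  have hΓ := h.smooth_left.differentiableAt (by simp)
  have hΓ' := h.smooth_right.differentiableAt (by simp)
  rw [ricci_eq_trace hΓ, ricci_eq_trace hΓ',
    ← LinearMap.trace_conj' _ (LinearEquiv.ofBijective (fderiv ℝ τ u).toLinearMap hA)]
  congr 1
  ext Z
  obtain ⟨Z, rfl⟩ := hA.2 Z
  have e : (LinearEquiv.ofBijective (fderiv ℝ τ u).toLinearMap hA).symm (fderiv ℝ τ u Z) = Z :=
    (LinearEquiv.ofBijective (fderiv ℝ τ u).toLinearMap hA).symm_apply_apply Z
  rw [LinearEquiv.conj_apply_apply, e, ricciOperator_apply hΓ, ricciOperator_apply hΓ',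
    ← h.curvature_change]
  rfl

/-- The second derivative of f' ∘ τ contains df' applied to the Hessian of τ, which the
inhomogeneous term of the transformation law cancels. -/
theorem hessian_change (h : IsConnectionChange τ Γ Γ' u) {f f' : V → ℝ}
    (hf' : ContDiffAt ℝ 2 f' (τ u)) (hff' : f =ᶠ[𝓝 u] f' ∘ τ) (X Y : V) :
    hessian (fun t v w => Γ t v w) f u X Y
      = hessian (fun t v w => Γ' t v w) f' (τ u) (fderiv ℝ τ u X) (fderiv ℝ τ u Y) := by
  have h2 : ContDiffAt ℝ 2 τ u := h.smooth.of_le ENat.LEInfty.out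
  have hf : ContDiffAt ℝ 2 f u := (hf'.comp u h2).congr_of_eventuallyEq hff'
  have hA : DifferentiableAt ℝ (fderiv ℝ τ) u :=
    (h2.fderiv_right (m := 1) (by norm_num)).differentiableAt (by simp)
  have hτ := h2.differentiableAt (by simp)
  have hd' : DifferentiableAt ℝ (fderiv ℝ f') (τ u) :=
    (hf'.fderiv_right (m := 1) (by norm_num)).differentiableAt (by simp)
  have e : fderiv ℝ f =ᶠ[𝓝 u] fun t => (fderiv ℝ f' (τ t)).comp (fderiv ℝ τ t) := by
    filter_upwards [hff'.eventuallyEq_nhds, h2.eventually (by simp),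
      h2.continuousAt.eventually (hf'.eventually (by simp))] with t ht ht2 htf
    rw [ht.fderiv_eq]
    exact ((htf.differentiableAt (by simp)).hasFDerivAt.comp t
      (ht2.differentiableAt (by simp)).hasFDerivAt).fderiv
  have k := e.fderiv_eq (𝕜 := ℝ)
  have k2 := ((hd'.hasFDerivAt.comp u hτ.hasFDerivAt).clm_comp hA.hasFDerivAt).fderiv
  have k3 := congrArg (fun L : V →L[ℝ] V →L[ℝ] ℝ => L X Y) (k.trans k2)
  simp at k3
  rw [hessian_clm hf, hessian_clm hf', k3, e.self_of_nhds, ContinuousLinearMap.comp_apply,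
    h.law_clm.self_of_nhds, map_add]
  abel

end IsConnectionChange

end CoordinateChange

/-! ### Curvature and Ricci tensor depend only on the germ of the connection. -/

section Congruence

variable {V : Type*} [NormedAddCommGroup V] [NormedSpace ℝ V] {Γ Γ' : V → V → V → V} {u : V}

theorem curvature_congr (h : ∀ᶠ t in 𝓝 u, ∀ v w, Γ t v w = Γ' t v w) (X Y Z : V) :
    curvature Γ u X Y Z = curvature Γ' u X Y Z := by
  have e (X Z : V) : (fun t => Γ t X Z) =ᶠ[𝓝 u] fun t => Γ' t X Z := h.mono fun t ht => ht X Z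
  simp only [curvature, (e _ _).fderiv_eq, h.self_of_nhds]

theorem ricci_congr [FiniteDimensional ℝ V] (h : ∀ᶠ t in 𝓝 u, ∀ v w, Γ t v w = Γ' t v w)
    (X Y : V) : ricci Γ u X Y = ricci Γ' u X Y := by
  simp only [ricci, curvature_congr h]

end Congruence

/-! ### The tensor Q on the surface: chart independence, bilinearity, smoothness. -/

section SurfaceTensor

variable {S : Type*} [TopologicalSpace S] [ChartedSpace Plane S] [IsManifold (𝓡 2) ∞ S]
  {p q x : S}

theorem chartDeriv_self (x : S) (X : TangentSpace (𝓡 2) x) : chartDeriv x x X = X := by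
  unfold chartDeriv
  rw [mfderiv_extChartAt_self]
  rfl

theorem mfderiv_chart_symm {u : Plane} (hu : u ∈ (extChartAt (𝓡 2) p).target) (X : Plane) :
    mfderiv 𝓘(ℝ, Plane) (𝓡 2) (extChartAt (𝓡 2) p).symm u X
      = coordField (𝓡 2) p X ((extChartAt (𝓡 2) p).symm u) := by
  have hx := (extChartAt (𝓡 2) p).map_target hu
  have h1 : MDifferentiableAt (𝓡 2) 𝓘(ℝ, Plane) (extChartAt (𝓡 2) p)
      ((extChartAt (𝓡 2) p).symm u) :=
    mdifferentiableAt_extChartAt (by rwa [extChartAt_source] at hx)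
  have h2 := (contMDiffAt_chart_symm hu).mdifferentiableAt (by simp)
  have e : extChartAt (𝓡 2) p ∘ (extChartAt (𝓡 2) p).symm =ᶠ[𝓝 u] id := by
    filter_upwards [(isOpen_chart_target p).mem_nhds hu] with t ht
      using (extChartAt (𝓡 2) p).right_inv ht
  have k := mfderiv_comp u h1 h2
  rw [e.mfderiv_eq, mfderiv_id] at k
  have k2 : X = chartDeriv p ((extChartAt (𝓡 2) p).symm u)
      (mfderiv 𝓘(ℝ, Plane) (𝓡 2) (extChartAt (𝓡 2) p).symm u X) :=
    congrArg (fun L : Plane →L[ℝ] Plane => L X) k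
  conv_rhs => rw [k2]
  exact (coordField_chartDeriv hx _).symm

theorem inChart_surface (Φ : Π x : S, TangentSpace (𝓡 2) x →L[ℝ] TangentSpace (𝓡 2) x →L[ℝ] ℝ)
    {u : Plane} (hu : u ∈ (extChartAt (𝓡 2) p).target) (X Y : Plane) :
    inChart Φ p u X Y = Φ ((extChartAt (𝓡 2) p).symm u)
      (coordField (𝓡 2) p X ((extChartAt (𝓡 2) p).symm u))
      (coordField (𝓡 2) p Y ((extChartAt (𝓡 2) p).symm u)) := by
  rw [← mfderiv_chart_symm hu, ← mfderiv_chart_symm hu]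
  rfl

theorem inChart_chartDeriv
    (Φ : Π x : S, TangentSpace (𝓡 2) x →L[ℝ] TangentSpace (𝓡 2) x →L[ℝ] ℝ)
    (hx : x ∈ (extChartAt (𝓡 2) p).source) (X Y : TangentSpace (𝓡 2) x) :
    inChart Φ p (extChartAt (𝓡 2) p x) (chartDeriv p x X) (chartDeriv p x Y) = Φ x X Y := by
  rw [inChart_surface Φ ((extChartAt (𝓡 2) p).map_source hx)]
  refine (congrArg (fun y => Φ y (coordField (𝓡 2) p (chartDeriv p x X) y)
    (coordField (𝓡 2) p (chartDeriv p x Y) y)) ((extChartAt (𝓡 2) p).left_inv hx)).trans ?_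
  rw [coordField_chartDeriv hx, coordField_chartDeriv hx]

variable (D : CovariantDerivative (𝓡 2) Plane (TangentSpace (𝓡 2) : S → Type _))
  [T2Space S] (hD : CovariantDerivative.ContMDiffCovariantDerivative D ∞)

include hD in
theorem contDiffAt_chartConn {u : Plane} (hu : u ∈ (extChartAt (𝓡 2) p).target) :
    ContDiffAt ℝ ∞ (chartConn D p) u :=
  (contDiffOn_chartConn D hD p).contDiffAt ((isOpen_chart_target p).mem_nhds hu)

include hD in
theorem isConnectionChange_transition {u : Plane} (hu : u ∈ overlap p q) :
    IsConnectionChange (transition p q) (chartConn D p) (chartConn D q) u where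
  smooth := (contDiffOn_transition p q).contDiffAt ((isOpen_overlap p q).mem_nhds hu)
  smooth_left := contDiffAt_chartConn D hD hu.1
  smooth_right := contDiffAt_chartConn D hD ((extChartAt (𝓡 2) q).map_source hu.2)
  law := by
    filter_upwards [(isOpen_overlap p q).mem_nhds hu] with t ht v w
      using chartConn_transition D ht v w

omit [T2Space S] in
theorem bijective_fderiv_transition {u : Plane} (hu : u ∈ overlap p q) :
    Function.Bijective (fderiv ℝ (transition p q) u) := by
  have hp := (extChartAt (𝓡 2) p).map_target hu.1
  have hq := hu.2
  rw [Set.mem_preimage] at hq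
  have tr := chartDeriv_transition hp hq
  rw [(extChartAt (𝓡 2) p).right_inv hu.1] at tr
  constructor
  · intro v w h
    rw [← chartDeriv_coordField hp v, ← chartDeriv_coordField hp w, ← tr, ← tr] at h
    rw [← chartDeriv_coordField hp v, ← chartDeriv_coordField hp w,
      (chartDeriv_isInvertible hq).injective h]
  · intro v
    exact ⟨chartDeriv p _ (coordField (𝓡 2) q v _), by rw [← tr, chartDeriv_coordField hq]⟩

variable (f : S → ℝ) (μ : ℝ)

/-- The components of `Hes^D_f + 2 ρ^D_s - μ df ⊗ df` in the preferred chart around `p`. -/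
def chartQETensor (p : S) (u X Y : Plane) : ℝ :=
  hessian (fun t v w => chartConn D p t v w) (f ∘ (extChartAt (𝓡 2) p).symm) u X Y
    + (ricci (fun t v w => chartConn D p t v w) u X Y
      + ricci (fun t v w => chartConn D p t v w) u Y X)
    - μ * (fderiv ℝ (f ∘ (extChartAt (𝓡 2) p).symm) u X
      * fderiv ℝ (f ∘ (extChartAt (𝓡 2) p).symm) u Y)

variable {f}

omit [T2Space S] in
theorem contDiffAt_comp_chart_symm (hf : ContMDiff (𝓡 2) 𝓘(ℝ) ∞ f) {u : Plane}
    (hu : u ∈ (extChartAt (𝓡 2) p).target) :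
    ContDiffAt ℝ ∞ (f ∘ (extChartAt (𝓡 2) p).symm) u :=
  (hf.contMDiffAt.comp u (contMDiffAt_chart_symm hu)).contDiffAt

omit [T2Space S] in
theorem affineQETensor_self (hf : ContMDiff (𝓡 2) 𝓘(ℝ) ∞ f) (X Y : TangentSpace (𝓡 2) x) :
    affineQETensor D f μ x X Y = chartQETensor D f μ x (extChartAt (𝓡 2) x x) X Y := by
  have hx := mem_extChartAt_source (I := 𝓡 2) x
  have hu := (extChartAt (𝓡 2) x).map_source hx
  have e : ∀ᶠ t in 𝓝 (extChartAt (𝓡 2) x x), ∀ v w,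
      affineChristoffel D x t v w = chartConn D x t v w := by
    filter_upwards [(isOpen_chart_target x).mem_nhds hu] with t ht v w
      using (chartConn_apply D ht v w).symm
  have hd (X : TangentSpace (𝓡 2) x) : mvfderiv (𝓡 2) f x X
      = fderiv ℝ (f ∘ (extChartAt (𝓡 2) x).symm) (extChartAt (𝓡 2) x x) X := by
    rw [mvfderiv_chart hx (hf.mdifferentiableAt (by simp)), chartDeriv_self]
  have key (X Y : Plane) (a : ℝ) :
      hessian (affineChristoffel D x) (f ∘ (extChartAt (𝓡 2) x).symm) (extChartAt (𝓡 2) x x) X Y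
        + 2 * (1 / 2 * (ricci (affineChristoffel D x) (extChartAt (𝓡 2) x x) X Y
          + ricci (affineChristoffel D x) (extChartAt (𝓡 2) x x) Y X)) - a
      = hessian (fun t v w => chartConn D x t v w) (f ∘ (extChartAt (𝓡 2) x).symm)
          (extChartAt (𝓡 2) x x) X Y
        + (ricci (fun t v w => chartConn D x t v w) (extChartAt (𝓡 2) x x) X Y
          + ricci (fun t v w => chartConn D x t v w) (extChartAt (𝓡 2) x x) Y X) - a := by
    rw [ricci_congr e, ricci_congr e]
    simp only [hessian, e.self_of_nhds]
    ring
  refine (key X Y _).trans ?_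
  rw [hd, hd]
  rfl

include hD in
theorem chartQETensor_transition (hf : ContMDiff (𝓡 2) 𝓘(ℝ) ∞ f) {u : Plane}
    (hu : u ∈ overlap p q) (X Y : Plane) : chartQETensor D f μ p u X Y
      = chartQETensor D f μ q (transition p q u) (fderiv ℝ (transition p q) u X)
        (fderiv ℝ (transition p q) u Y) := by
  have h := isConnectionChange_transition D hD hu
  have hA := bijective_fderiv_transition hu
  have hq : transition p q u ∈ (extChartAt (𝓡 2) q).target := (extChartAt (𝓡 2) q).map_source hu.2
  have hfq := contDiffAt_comp_chart_symm hf hq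
  have e : f ∘ (extChartAt (𝓡 2) p).symm =ᶠ[𝓝 u]
      (f ∘ (extChartAt (𝓡 2) q).symm) ∘ transition p q := by
    filter_upwards [(isOpen_overlap p q).mem_nhds hu] with t ht
      using congrArg f ((extChartAt (𝓡 2) q).left_inv ht.2).symm
  have e' := e.fderiv_eq.trans ((hfq.differentiableAt (by simp)).hasFDerivAt.comp u
    (h.smooth.differentiableAt (by simp)).hasFDerivAt).fderiv
  unfold chartQETensor
  rw [h.ricci_change hA, h.ricci_change hA, h.hessian_change (hfq.of_le ENat.LEInfty.out) e, e']
  rfl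

include hD in
-- The tensor is defined at each x in the chart around x itself. Smoothness needs one chart for all
-- nearby points, which the transformation law provides.
theorem affineQETensor_chart (hf : ContMDiff (𝓡 2) 𝓘(ℝ) ∞ f)
    (hx : x ∈ (extChartAt (𝓡 2) p).source) (X Y : TangentSpace (𝓡 2) x) :
    affineQETensor D f μ x X Y
      = chartQETensor D f μ p (extChartAt (𝓡 2) p x) (chartDeriv p x X) (chartDeriv p x Y) := by
  have hx' := mem_extChartAt_source (I := 𝓡 2) x
  have tr := chartDeriv_transition hx hx'
  rw [affineQETensor_self D μ hf, chartQETensor_transition D hD μ hf (mem_overlap hx hx'), ← tr,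
    ← tr, chartDeriv_self, chartDeriv_self, transition, (extChartAt (𝓡 2) p).left_inv hx]

include hD in
theorem chartQETensor_isBilinear (hf : ContMDiff (𝓡 2) 𝓘(ℝ) ∞ f) {u : Plane}
    (hu : u ∈ (extChartAt (𝓡 2) p).target) :
    ∃ B : Plane →L[ℝ] Plane →L[ℝ] ℝ, ∀ X Y, B X Y = chartQETensor D f μ p u X Y := by
  have hΓ := (contDiffAt_chartConn D hD hu).differentiableAt (by simp)
  have hf2 := (contDiffAt_comp_chart_symm hf hu).of_le (m := 2) ENat.LEInfty.out
  have e (X Y : Plane) : chartQETensor D f μ p u X Y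
      = fderiv ℝ (fderiv ℝ (f ∘ (extChartAt (𝓡 2) p).symm)) u X Y
        - fderiv ℝ (f ∘ (extChartAt (𝓡 2) p).symm) u (chartConn D p u X Y)
        + (LinearMap.trace ℝ Plane (ricciOperator (chartConn D p) u X Y)
          + LinearMap.trace ℝ Plane (ricciOperator (chartConn D p) u Y X))
        - μ * (fderiv ℝ (f ∘ (extChartAt (𝓡 2) p).symm) u X
          * fderiv ℝ (f ∘ (extChartAt (𝓡 2) p).symm) u Y) := by
    rw [chartQETensor, hessian_clm hf2, ricci_eq_trace hΓ, ricci_eq_trace hΓ]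
  refine ⟨LinearMap.toContinuousBilinearMap (LinearMap.mk₂ ℝ (chartQETensor D f μ p u)
    ?_ ?_ ?_ ?_), fun X Y => rfl⟩ <;> intros <;>
  simp only [e, map_add, map_smul, add_apply, smul_apply, smul_eq_mul, ricciOperator_add_left,
    ricciOperator_add_right, ricciOperator_smul_left, ricciOperator_smul_right] <;> ring

include hD in
theorem contDiffOn_chartQETensor (hf : ContMDiff (𝓡 2) 𝓘(ℝ) ∞ f) (X Y : Plane) :
    ContDiffOn ℝ ∞ (fun u => chartQETensor D f μ p u X Y) (extChartAt (𝓡 2) p).target := by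
  intro u hu
  have hΓ := contDiffAt_chartConn D hD hu
  have hf := contDiffAt_comp_chart_symm hf hu
  have hd {F : Type} [NormedAddCommGroup F] [NormedSpace ℝ F] {g : Plane → F}
      (hg : ContDiffAt ℝ ∞ g u) (X : Plane) : ContDiffAt ℝ ∞ (fun t => fderiv ℝ g t X) u :=
    (hg.fderiv_right (by simp)).clm_apply contDiffAt_const
  have hΓa {Y Z : Plane → Plane} (hY : ContDiffAt ℝ ∞ Y u) (hZ : ContDiffAt ℝ ∞ Z u) :
      ContDiffAt ℝ ∞ (fun t => chartConn D p t (Y t) (Z t)) u :=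
    (hΓ.clm_apply hY).clm_apply hZ
  have hR (X Y : Plane) :
      ContDiffAt ℝ ∞ (fun t => ricci (fun t v w => chartConn D p t v w) t X Y) u := by
    refine ContDiffAt.sum fun i _ => ?_
    refine (LinearMap.toContinuousLinearMap ((Module.finBasis ℝ Plane).coord i)).contDiff.contDiffAt
      |>.comp u ?_
    have k (X Y Z : Plane) : ContDiffAt ℝ ∞ (fun u => fderiv ℝ (fun t => chartConn D p t X Z) u Y
        + chartConn D p u Y (chartConn D p u X Z)) u :=
      (hd (hΓa contDiffAt_const contDiffAt_const) _).add
        (hΓa contDiffAt_const (hΓa contDiffAt_const contDiffAt_const))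
    exact (k _ _ _).sub (k _ _ _)
  refine ContDiffAt.contDiffWithinAt ?_
  exact (((hd (hd hf _) _).sub ((hf.fderiv_right (by simp)).clm_apply
    (hΓa contDiffAt_const contDiffAt_const))).add ((hR _ _).add (hR _ _))).sub
    (contDiffAt_const.mul ((hd hf _).mul (hd hf _)))

include hD in
/-- `Hes^D_f + 2 ρ^D_s - μ df ⊗ df` is a smooth symmetric tensor. -/
theorem exists_affineQETensor (htorsion : D.torsion = 0) (hf : ContMDiff (𝓡 2) 𝓘(ℝ) ∞ f) :
    ∃ Q : Π x : S, TangentSpace (𝓡 2) x →L[ℝ] TangentSpace (𝓡 2) x →L[ℝ] ℝ,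
      IsSmoothTensor Q ∧ (∀ x v w, Q x v w = Q x w v) ∧
        ∀ x v w, Q x v w = affineQETensor D f μ x v w := by
  have hu (x : S) := mem_extChartAt_target (I := 𝓡 2) x
  have hb (x : S) : ∃ B : TangentSpace (𝓡 2) x →L[ℝ] TangentSpace (𝓡 2) x →L[ℝ] ℝ,
      ∀ v w, B v w = affineQETensor D f μ x v w := by
    obtain ⟨B, hB⟩ := chartQETensor_isBilinear D hD μ hf (hu x)
    exact ⟨B, fun v w => (hB v w).trans (affineQETensor_self D μ hf v w).symm⟩
  choose Q hQ using hb
  refine ⟨Q, fun p => ?_, fun x v w => ?_, hQ⟩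
  · rw [contDiffOn_clm_apply]
    intro X
    rw [contDiffOn_clm_apply]
    intro Y
    refine (contDiffOn_chartQETensor D hD μ hf X Y).congr fun u hu => ?_
    have hx := (extChartAt (𝓡 2) p).map_target hu
    rw [inChart_surface _ hu, hQ, affineQETensor_chart D hD μ hf hx, chartDeriv_coordField hx,
      chartDeriv_coordField hx, (extChartAt (𝓡 2) p).right_inv hu]
  · have key (v w : Plane) : chartQETensor D f μ x (extChartAt (𝓡 2) x x) v w
        = chartQETensor D f μ x (extChartAt (𝓡 2) x x) w v := by
      have h2 := (contDiffAt_comp_chart_symm hf (hu x)).of_le (m := 2) ENat.LEInfty.out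
      simp only [chartQETensor, hessian_clm h2]
      rw [chartConn_symm D htorsion (hu x) v w, h2.isSymmSndFDerivAt (by simp) v w]
      ring
    rw [hQ, hQ, affineQETensor_self D μ hf, affineQETensor_self D μ hf]
    exact key v w

end SurfaceTensor

/-! ### Natural charts of the cotangent bundle and their transitions. -/

section CotangentChart

variable {S : Type*} [TopologicalSpace S] [ChartedSpace Plane S] [IsManifold (𝓡 2) ∞ S]
  {q y : Cotangent S}

theorem cotangentChart_source (q : Cotangent S) : (extChartAt cotangentModel q).source
    = Bundle.TotalSpace.proj ⁻¹' (extChartAt (𝓡 2) q.proj).source := by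
  have hs : (trivializationAt (Plane →L[ℝ] ℝ)
      (fun x : S => TangentSpace (𝓡 2) x →L[ℝ] ℝ) q.proj).source
        = Bundle.TotalSpace.proj ⁻¹' (extChartAt (𝓡 2) q.proj).source := by
    rw [Bundle.Trivialization.source_eq]
    simp
  rw [FiberBundle.extChartAt]
  ext y
  rw [PartialEquiv.trans_source, Set.mem_inter_iff]
  refine ⟨fun h => hs ▸ h.1, fun h => ⟨hs ▸ h, ?_⟩⟩
  refine ⟨?_, trivial⟩
  have k := Bundle.Trivialization.coe_fst (trivializationAt (Plane →L[ℝ] ℝ)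
      (fun x : S => TangentSpace (𝓡 2) x →L[ℝ] ℝ) q.proj) (x := y) (hs ▸ h)
  exact (congrArg (· ∈ (extChartAt (𝓡 2) q.proj).source) k).mpr h

theorem cotangentChart_apply (q y : Cotangent S) :
    extChartAt cotangentModel q y
      = (extChartAt (𝓡 2) q.proj (trivializationAt (Plane →L[ℝ] ℝ)
          (fun x : S => TangentSpace (𝓡 2) x →L[ℝ] ℝ) q.proj y).1,
        (trivializationAt (Plane →L[ℝ] ℝ)
          (fun x : S => TangentSpace (𝓡 2) x →L[ℝ] ℝ) q.proj y).2) := by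
  rw [FiberBundle.extChartAt]
  rfl

theorem cotangentChart_fst (hy : y.proj ∈ (extChartAt (𝓡 2) q.proj).source) :
    (extChartAt cotangentModel q y).1 = extChartAt (𝓡 2) q.proj y.proj := by
  rw [cotangentChart_apply, Bundle.Trivialization.coe_fst]
  rw [extChartAt_source] at hy
  rw [Bundle.Trivialization.mem_source]
  simpa using hy

/-- The dual bundle is trivialised by composing a covector with the inverse of the tangent
trivialisation, so evaluating covectors on vectors is unaffected by the chart. -/
theorem cotangentChart_snd (hy : y.proj ∈ (extChartAt (𝓡 2) q.proj).source)
    (X : TangentSpace (𝓡 2) y.proj) :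
    (extChartAt cotangentModel q y).2 (chartDeriv q.proj y.proj X) = y.2 X := by
  rw [extChartAt_source] at hy
  rw [cotangentChart_apply]
  unfold chartDeriv
  rw [← TangentBundle.continuousLinearMapAt_trivializationAt hy]
  have hb : y.proj ∈ (trivializationAt Plane (TangentSpace (𝓡 2) : S → Type _) q.proj).baseSet := by
    simpa using hy
  have k := Trivialization.symmL_continuousLinearMapAt (R := ℝ)
    (trivializationAt Plane (TangentSpace (𝓡 2) : S → Type _) q.proj) hb X
  refine Eq.trans ?_ (congrArg y.2 k)
  rw [hom_trivializationAt_apply]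
  unfold ContinuousLinearMap.inCoordinates
  exact congrArg (fun L : ℝ →L[ℝ] ℝ => L (y.2 (Trivialization.symmL ℝ
    (trivializationAt Plane (TangentSpace (𝓡 2) : S → Type _) q.proj) y.proj
    (Trivialization.continuousLinearMapAt ℝ
      (trivializationAt Plane (TangentSpace (𝓡 2) : S → Type _) q.proj) y.proj X))))
    (Bundle.Trivial.continuousLinearMapAt_trivialization ℝ S ℝ y.proj)

theorem cotangentChart_snd_self (q : Cotangent S) : (extChartAt cotangentModel q q).2 = q.2 := by
  ext X
  have := cotangentChart_snd (q := q) (y := q) (mem_extChartAt_source q.proj) X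
  exact (congrArg _ (chartDeriv_self q.proj X).symm).trans this

theorem cotangentChart_target (q : Cotangent S) : (extChartAt cotangentModel q).target
    = (extChartAt (𝓡 2) q.proj).target ×ˢ Set.univ := by
  rw [FiberBundle.extChartAt_target]
  congr 1
  apply Set.inter_eq_left.2
  intro u hu
  have := (extChartAt (𝓡 2) q.proj).map_target hu
  rw [extChartAt_source] at this
  simpa using this

variable {w : Plane × (Plane →L[ℝ] ℝ)}

theorem proj_cotangentChart_symm_mem (hw : w ∈ (extChartAt cotangentModel q).target) :
    ((extChartAt cotangentModel q).symm w).proj ∈ (extChartAt (𝓡 2) q.proj).source := by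
  have := (extChartAt cotangentModel q).map_target hw
  rwa [cotangentChart_source] at this

theorem chart_proj_cotangentChart_symm (hw : w ∈ (extChartAt cotangentModel q).target) :
    extChartAt (𝓡 2) q.proj ((extChartAt cotangentModel q).symm w).proj = w.1 := by
  rw [← cotangentChart_fst (proj_cotangentChart_symm_mem hw),
    (extChartAt cotangentModel q).right_inv hw]

theorem proj_cotangentChart_symm (hw : w ∈ (extChartAt cotangentModel q).target) :
    ((extChartAt cotangentModel q).symm w).proj = (extChartAt (𝓡 2) q.proj).symm w.1 := by
  rw [← chart_proj_cotangentChart_symm hw,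
    (extChartAt (𝓡 2) q.proj).left_inv (proj_cotangentChart_symm_mem hw)]

theorem snd_cotangentChart_symm (hw : w ∈ (extChartAt cotangentModel q).target)
    (X : TangentSpace (𝓡 2) ((extChartAt cotangentModel q).symm w).proj) :
    ((extChartAt cotangentModel q).symm w).2 X
      = w.2 (chartDeriv q.proj ((extChartAt cotangentModel q).symm w).proj X) := by
  rw [← cotangentChart_snd (proj_cotangentChart_symm_mem hw),
    (extChartAt cotangentModel q).right_inv hw]

theorem contMDiffAt_cotangentChart_symm (hw : w ∈ (extChartAt cotangentModel q).target) :
    ContMDiffAt 𝓘(ℝ, Plane × (Plane →L[ℝ] ℝ)) cotangentModel ∞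
      (extChartAt cotangentModel q).symm w :=
  (contMDiffOn_extChartAt_symm q).contMDiffAt ((isOpen_extChartAt_target q).mem_nhds hw)

theorem chartDeriv_dproj (hy : y ∈ (extChartAt cotangentModel q).source)
    (W : TangentSpace cotangentModel y) : chartDeriv q.proj y.proj (dproj y W)
      = (show Plane × (Plane →L[ℝ] ℝ) from mfderiv cotangentModel
        𝓘(ℝ, Plane × (Plane →L[ℝ] ℝ)) (extChartAt cotangentModel q) y W).1 := by
  have hy' := hy
  rw [cotangentChart_source, Set.mem_preimage, extChartAt_source] at hy'
  have h1 : MDifferentiableAt (𝓡 2) 𝓘(ℝ, Plane) (extChartAt (𝓡 2) q.proj) y.proj :=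
    mdifferentiableAt_extChartAt hy'
  have h2 : MDifferentiableAt cotangentModel (𝓡 2) (fun r : Cotangent S => r.proj) y :=
    (contMDiff_proj (n := ∞) (fun x : S => TangentSpace (𝓡 2) x →L[ℝ] ℝ)).mdifferentiableAt
      (by simp)
  have h3 : MDifferentiableAt cotangentModel 𝓘(ℝ, Plane × (Plane →L[ℝ] ℝ))
      (extChartAt cotangentModel q) y :=
    mdifferentiableAt_extChartAt (by rwa [extChartAt_source] at hy)
  have h4 := (ContinuousLinearMap.fst ℝ Plane (Plane →L[ℝ] ℝ)).hasMFDerivAt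
    (x := extChartAt cotangentModel q y)
  have e : extChartAt (𝓡 2) q.proj ∘ (fun r : Cotangent S => r.proj) =ᶠ[𝓝 y]
      ContinuousLinearMap.fst ℝ Plane (Plane →L[ℝ] ℝ) ∘ extChartAt cotangentModel q := by
    filter_upwards [(isOpen_extChartAt_source (I := cotangentModel) q).mem_nhds hy] with z hz
    rw [cotangentChart_source] at hz
    exact (cotangentChart_fst hz).symm
  have k := (mfderiv_comp y h1 h2).symm.trans (e.mfderiv_eq.trans (h4.comp y h3.hasMFDerivAt).mfderiv)
  exact congrArg (fun L : TangentSpace cotangentModel y →L[ℝ] Plane => L W) k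

theorem dproj_apply (q : Cotangent S) (W : TangentSpace cotangentModel q) :
    dproj q W = (W : Plane × (Plane →L[ℝ] ℝ)).1 := by
  have k := chartDeriv_dproj (mem_extChartAt_source (I := cotangentModel) q) W
  rw [mfderiv_extChartAt_self, chartDeriv_self] at k
  exact k

/-- The coordinate change between the natural charts around `q` and `r`. -/
def cotangentTransition (q r : Cotangent S) (w : Plane × (Plane →L[ℝ] ℝ)) :
    Plane × (Plane →L[ℝ] ℝ) :=
  extChartAt cotangentModel r ((extChartAt cotangentModel q).symm w)

/-- A tangent vector at a point is its components in the chart centred there, so the derivative of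
the inverse chart is that of the transition into the chart centred at the image. -/
theorem mfderiv_cotangentChart_symm (hw : w ∈ (extChartAt cotangentModel q).target)
    (W : Plane × (Plane →L[ℝ] ℝ)) :
    mfderiv 𝓘(ℝ, Plane × (Plane →L[ℝ] ℝ)) cotangentModel (extChartAt cotangentModel q).symm w W
      = fderiv ℝ (cotangentTransition q ((extChartAt cotangentModel q).symm w)) w W := by
  set r := (extChartAt cotangentModel q).symm w with hr
  have h2 := (contMDiffAt_cotangentChart_symm hw).mdifferentiableAt (by simp)
  have h1 : MDifferentiableAt cotangentModel 𝓘(ℝ, Plane × (Plane →L[ℝ] ℝ))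
      (extChartAt cotangentModel r) ((extChartAt cotangentModel q).symm w) :=
    mdifferentiableAt_extChartAt (mem_chart_source _ _)
  have k := mfderiv_comp w h1 h2
  rw [← hr, mfderiv_extChartAt_self] at k
  rw [mfderiv_eq_fderiv] at k
  exact (congrArg (fun L : Plane × (Plane →L[ℝ] ℝ) →L[ℝ] Plane × (Plane →L[ℝ] ℝ) => L W) k).symm

theorem mem_cotangentChart_target (hu : w.1 ∈ (extChartAt (𝓡 2) q.proj).target) :
    w ∈ (extChartAt cotangentModel q).target := by
  rw [cotangentChart_target]
  exact ⟨hu, trivial⟩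

section Transition

variable (hw : w ∈ (extChartAt cotangentModel q).target)

include hw

theorem fst_mem_overlap : w.1 ∈ overlap q.proj ((extChartAt cotangentModel q).symm w).proj := by
  refine ⟨by rw [cotangentChart_target] at hw; exact hw.1, ?_⟩
  rw [Set.mem_preimage, ← proj_cotangentChart_symm hw]
  exact mem_extChartAt_source _

theorem eventually_fst_mem_overlap : ∀ᶠ t in 𝓝 w,
    t.1 ∈ overlap q.proj ((extChartAt cotangentModel q).symm w).proj :=
  continuous_fst.continuousAt.eventually ((isOpen_overlap _ _).mem_nhds (fst_mem_overlap hw))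

theorem contDiffAt_cotangentTransition : ContDiffAt ℝ ∞
    (cotangentTransition q ((extChartAt cotangentModel q).symm w)) w :=
  ((contMDiffAt_extChartAt' (n := ∞) (mem_chart_source _ _)).comp w
    (contMDiffAt_cotangentChart_symm hw)).contDiffAt

omit hw in
theorem cotangentTransition_fst {r : Cotangent S} (hu : w.1 ∈ overlap q.proj r.proj) :
    (cotangentTransition q r w).1 = transition q.proj r.proj w.1 := by
  have hw := mem_cotangentChart_target hu.1
  have hr : ((extChartAt cotangentModel q).symm w).proj ∈ (extChartAt (𝓡 2) r.proj).source := by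
    rw [proj_cotangentChart_symm hw]
    exact hu.2
  rw [cotangentTransition, cotangentChart_fst hr, proj_cotangentChart_symm hw, transition]

omit hw in
-- Invariance of the pairing determines the new covector implicitly; no inverse of the differential
-- has to be written, or differentiated in the next lemmas.
theorem cotangentTransition_snd {r : Cotangent S} (hu : w.1 ∈ overlap q.proj r.proj) (v : Plane) :
    (cotangentTransition q r w).2 (fderiv ℝ (transition q.proj r.proj) w.1 v) = w.2 v := by
  have hw := mem_cotangentChart_target hu.1
  have hr : ((extChartAt cotangentModel q).symm w).proj ∈ (extChartAt (𝓡 2) r.proj).source := by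
    rw [proj_cotangentChart_symm hw]
    exact hu.2
  have hq := proj_cotangentChart_symm_mem hw
  have tr := chartDeriv_transition hq hr
    (coordField (𝓡 2) q.proj v ((extChartAt cotangentModel q).symm w).proj)
  rw [chartDeriv_coordField hq, chart_proj_cotangentChart_symm hw] at tr
  rw [← tr, cotangentTransition, cotangentChart_snd hr, snd_cotangentChart_symm hw,
    chartDeriv_coordField hq]

theorem fderiv_cotangentTransition_fst (W : Plane × (Plane →L[ℝ] ℝ)) :
    (fderiv ℝ (cotangentTransition q ((extChartAt cotangentModel q).symm w)) w W).1
      = fderiv ℝ (transition q.proj ((extChartAt cotangentModel q).symm w).proj) w.1 W.1 := by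
  have hF := (contDiffAt_cotangentTransition hw).differentiableAt (by simp)
  have hu := fst_mem_overlap hw
  have hτ := ((contDiffOn_transition _ _).contDiffAt ((isOpen_overlap _ _).mem_nhds hu)
    ).differentiableAt (by simp)
  have e : (fun t => (cotangentTransition q ((extChartAt cotangentModel q).symm w) t).1) =ᶠ[𝓝 w]
      fun t => transition q.proj ((extChartAt cotangentModel q).symm w).proj t.1 := by
    filter_upwards [eventually_fst_mem_overlap hw] with t ht using cotangentTransition_fst ht
  have k := hF.hasFDerivAt.fst.fderiv.symm.trans
    (e.fderiv_eq.trans (hτ.hasFDerivAt.comp w hasFDerivAt_fst).fderiv)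
  exact congrArg (fun L : Plane × (Plane →L[ℝ] ℝ) →L[ℝ] Plane => L W) k

theorem fderiv_cotangentTransition_snd (W : Plane × (Plane →L[ℝ] ℝ)) (v : Plane) :
    (fderiv ℝ (cotangentTransition q ((extChartAt cotangentModel q).symm w)) w W).2
        (fderiv ℝ (transition q.proj ((extChartAt cotangentModel q).symm w).proj) w.1 v)
      = W.2 v - (cotangentTransition q ((extChartAt cotangentModel q).symm w) w).2
        (fderiv ℝ (fun t => fderiv ℝ (transition q.proj
          ((extChartAt cotangentModel q).symm w).proj) t v) w.1 W.1) := by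
  have hF := (contDiffAt_cotangentTransition hw).differentiableAt (by simp)
  have hu := fst_mem_overlap hw
  have hτ : DifferentiableAt ℝ (fun t => fderiv ℝ (transition q.proj
      ((extChartAt cotangentModel q).symm w).proj) t v) w.1 :=
    ((((contDiffOn_transition _ _).contDiffAt ((isOpen_overlap _ _).mem_nhds hu)).fderiv_right
      (m := ∞) (by simp)).differentiableAt (by simp)).clm_apply (differentiableAt_const v)
  have e : (fun t => (cotangentTransition q ((extChartAt cotangentModel q).symm w) t).2
      (fderiv ℝ (transition q.proj ((extChartAt cotangentModel q).symm w).proj) t.1 v)) =ᶠ[𝓝 w]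
      fun t => t.2 v := by
    filter_upwards [eventually_fst_mem_overlap hw] with t ht using cotangentTransition_snd ht v
  have h2 : HasFDerivAt (fun t : Plane × (Plane →L[ℝ] ℝ) => t.2 v) _ w :=
    hasFDerivAt_snd.clm_apply (hasFDerivAt_const v w)
  have k := (hF.hasFDerivAt.snd.clm_apply (hτ.hasFDerivAt.comp w hasFDerivAt_fst)).fderiv.symm.trans
    (e.fderiv_eq.trans h2.fderiv)
  have k2 := congrArg (fun L : Plane × (Plane →L[ℝ] ℝ) →L[ℝ] ℝ => L W) k
  simp at k2
  exact eq_sub_of_add_eq' k2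

end Transition

end CotangentChart

/-! ### The metric on the cotangent bundle in a fixed natural chart. -/

section Extension

variable {S : Type*} [TopologicalSpace S] [ChartedSpace Plane S] [IsManifold (𝓡 2) ∞ S]
  (D : CovariantDerivative (𝓡 2) Plane (TangentSpace (𝓡 2) : S → Type _))
  (Φ : Π x : S, TangentSpace (𝓡 2) x →L[ℝ] TangentSpace (𝓡 2) x →L[ℝ] ℝ) (c : S → ℝ)

/-- The Riemannian extension `c ι(Id) ∘ ι(Id) + g_{D,Φ}`. -/
abbrev scalarExtension (q : Cotangent S) :
    TangentSpace cotangentModel q →L[ℝ] TangentSpace cotangentModel q →L[ℝ] ℝ :=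
  modifiedExtension D (fun x v w => Φ x v w)
    (fun x => c x • ContinuousLinearMap.id ℝ (TangentSpace (𝓡 2) x))
    (fun x => ContinuousLinearMap.id ℝ (TangentSpace (𝓡 2) x)) q

variable (htorsion : D.torsion = 0) (hΦ : ∀ x v w, Φ x v w = Φ x w v)

/-- The metric of the cotangent bundle in the natural chart around `p`. -/
def chartExtension (p : S) (w : Plane × (Plane →L[ℝ] ℝ)) :
    Plane × (Plane →L[ℝ] ℝ) →L[ℝ] Plane × (Plane →L[ℝ] ℝ) →L[ℝ] ℝ :=
  walkerMetric (chartConn D p) (inChart Φ p) (c ∘ (extChartAt (𝓡 2) p).symm) w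

theorem chartExtension_apply (p : S) (w X Y : Plane × (Plane →L[ℝ] ℝ)) :
    chartExtension D Φ c p w X Y = X.2 Y.1 + Y.2 X.1 + (-2 * w.2 (chartConn D p w.1 X.1 Y.1)
      + inChart Φ p w.1 X.1 Y.1
      + c ((extChartAt (𝓡 2) p).symm w.1) * (w.2 X.1 * w.2 Y.1)) := by
  rw [chartExtension, walkerMetric_apply]
  rfl

theorem inChart_transition {p r : S} {u : Plane} (hu : u ∈ overlap p r) (X Y : Plane) :
    inChart Φ r (transition p r u) (fderiv ℝ (transition p r) u X) (fderiv ℝ (transition p r) u Y)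
      = inChart Φ p u X Y := by
  have hp := (extChartAt (𝓡 2) p).map_target hu.1
  have hr := hu.2
  rw [Set.mem_preimage] at hr
  have tr := chartDeriv_transition hp hr
  rw [(extChartAt (𝓡 2) p).right_inv hu.1] at tr
  have k := inChart_chartDeriv Φ hr (coordField (𝓡 2) p X _) (coordField (𝓡 2) p Y _)
  rw [tr, tr, chartDeriv_coordField hp, chartDeriv_coordField hp] at k
  rw [inChart_surface Φ hu.1, ← k, transition]

omit [IsManifold (𝓡 2) ∞ S] in
theorem transition_symm {p r : S} {u : Plane} (hu : u ∈ overlap p r) :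
    (extChartAt (𝓡 2) r).symm (transition p r u) = (extChartAt (𝓡 2) p).symm u :=
  (extChartAt (𝓡 2) r).left_inv hu.2

theorem inChart_self {x : S} (v w : TangentSpace (𝓡 2) x) :
    inChart Φ x (extChartAt (𝓡 2) x x) v w = Φ x v w := by
  refine Eq.trans ?_ (inChart_chartDeriv Φ (mem_extChartAt_source x) v w)
  rw [chartDeriv_self, chartDeriv_self]

theorem symProd_apply {V : Type*} [AddCommGroup V] [Module ℝ V] [TopologicalSpace V]
    (α β : V →L[ℝ] ℝ) (X Y : V) : symProd α β X Y = 1 / 2 * (α X * β Y + β X * α Y) := by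
  simp [symProd]
  ring

theorem sum_symProd_apply {V : Type*} [AddCommGroup V] [Module ℝ V] [TopologicalSpace V]
    (ξ η : Fin 2 → V →L[ℝ] ℝ) (m : Fin 2 → Fin 2 → ℝ) (X Y : V) :
    ((2 : ℝ) • ∑ i, symProd (ξ i) (η i) + ∑ i, ∑ j, m i j • symProd (ξ i) (ξ j)) X Y
      = 2 * ∑ i, 1 / 2 * (ξ i X * η i Y + η i X * ξ i Y)
        + ∑ i, ∑ j, m i j * (1 / 2 * (ξ i X * ξ j Y + ξ j X * ξ i Y)) := by
  simp only [Fin.sum_univ_two, add_apply, smul_apply, symProd_apply, smul_eq_mul]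

/-- A symmetric scalar product on `V × V*` in terms of components. -/
theorem sum_components_eq (B : Plane →L[ℝ] Plane →L[ℝ] ℝ) (G : Plane →L[ℝ] Plane →L[ℝ] Plane)
    (hB : ∀ v w, B v w = B w v) (hG : ∀ v w, G v w = G w v) (α : Plane →L[ℝ] ℝ)
    (X Y : Plane × (Plane →L[ℝ] ℝ)) :
    2 * ∑ i, 1 / 2 * (X.1 i * Y.2 (coordVec i) + X.2 (coordVec i) * Y.1 i)
        + ∑ i, ∑ j, (-2 * (∑ k, α (coordVec k) * G (coordVec i) (coordVec j) k)
          + B (coordVec i) (coordVec j)) * (1 / 2 * (X.1 i * Y.1 j + X.1 j * Y.1 i))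
      = X.2 Y.1 + Y.2 X.1 + (-2 * α (G X.1 Y.1) + B X.1 Y.1) := by
  obtain ⟨X, β⟩ := X
  obtain ⟨Y, γ⟩ := Y
  have e : G X Y = (X 0 * Y 0) • G (coordVec 0) (coordVec 0)
      + (X 0 * Y 1 + X 1 * Y 0) • G (coordVec 0) (coordVec 1)
      + (X 1 * Y 1) • G (coordVec 1) (coordVec 1) := by
    conv_lhs => rw [plane_eq X, plane_eq Y]
    simp only [map_add, map_smul, add_apply, smul_apply, hG (coordVec 1) (coordVec 0)]
    module
  have e' : B X Y = (X 0 * Y 0) * B (coordVec 0) (coordVec 0)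
      + (X 0 * Y 1 + X 1 * Y 0) * B (coordVec 0) (coordVec 1)
      + (X 1 * Y 1) * B (coordVec 1) (coordVec 1) := by
    conv_lhs => rw [plane_eq X, plane_eq Y]
    simp only [map_add, map_smul, add_apply, smul_apply, hB (coordVec 1) (coordVec 0), smul_eq_mul]
    ring
  simp only [e, e', map_add, map_smul, covector_apply β Y, covector_apply γ X, smul_eq_mul,
    covector_apply α (G _ _), Fin.sum_univ_two, hG (coordVec 1) (coordVec 0),
    hB (coordVec 1) (coordVec 0)]
  ring

include htorsion in
theorem deformedExtension_apply (q : Cotangent S) (B : Plane →L[ℝ] Plane →L[ℝ] ℝ)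
    (hB : ∀ v w, B v w = B w v)
    {Φ : Π x : S, TangentSpace (𝓡 2) x → TangentSpace (𝓡 2) x → ℝ} (hΦ : ∀ v w, Φ q.proj v w = B v w)
    (X Y : Plane × (Plane →L[ℝ] ℝ)) :
    deformedExtension D Φ q X Y
      = X.2 Y.1 + Y.2 X.1 + (-2 * (show Plane →L[ℝ] ℝ from q.2)
        (chartConn D q.proj (extChartAt (𝓡 2) q.proj q.proj) X.1 Y.1) + B X.1 Y.1) := by
  have hu := mem_extChartAt_target (I := 𝓡 2) q.proj
  rw [← sum_components_eq B _ hB (chartConn_symm D htorsion hu)]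
  refine (sum_symProd_apply (V := TangentSpace cotangentModel q) _ _ _ _ _).trans ?_
  simp only [chartConn_apply D hu]
  congr 1
  exact Finset.sum_congr rfl fun i _ => Finset.sum_congr rfl fun j _ =>
    congrArg (fun b => (-2 * _ + b) * _) (hΦ _ _)

theorem modifiedExtension_apply (Φ : Π x : S, TangentSpace (𝓡 2) x → TangentSpace (𝓡 2) x → ℝ)
    (q : Cotangent S) (X Y : Plane × (Plane →L[ℝ] ℝ)) :
    modifiedExtension D Φ (fun x => c x • ContinuousLinearMap.id ℝ (TangentSpace (𝓡 2) x))
      (fun x => ContinuousLinearMap.id ℝ (TangentSpace (𝓡 2) x)) q X Y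
      = deformedExtension D Φ q X Y + c q.proj * ((show Plane →L[ℝ] ℝ from q.2) X.1
        * (show Plane →L[ℝ] ℝ from q.2) Y.1) := by
  have h (Z : Plane × (Plane →L[ℝ] ℝ)) : evalForm
      (fun x => c x • ContinuousLinearMap.id ℝ (TangentSpace (𝓡 2) x)) q Z
        = c q.proj * (show Plane →L[ℝ] ℝ from q.2) Z.1 :=
    (congrArg (fun v : TangentSpace (𝓡 2) q.proj => q.2 (c q.proj • v)) (dproj_apply q Z)).trans
      (map_smul q.2 _ _)
  have h' (Z : Plane × (Plane →L[ℝ] ℝ)) : evalForm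
      (fun x => ContinuousLinearMap.id ℝ (TangentSpace (𝓡 2) x)) q Z
        = (show Plane →L[ℝ] ℝ from q.2) Z.1 :=
    congrArg (fun v : TangentSpace (𝓡 2) q.proj => q.2 v) (dproj_apply q Z)
  have k := symProd_apply (V := TangentSpace cotangentModel q) (evalForm
      (fun x => c x • ContinuousLinearMap.id ℝ (TangentSpace (𝓡 2) x)) q)
      (evalForm (fun x => ContinuousLinearMap.id ℝ (TangentSpace (𝓡 2) x)) q) X Y
  refine (congrArg (· + deformedExtension D Φ q X Y) k).trans ?_
  simp only [h, h']
  ring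

include htorsion hΦ in
-- The metric is defined through the natural chart centred at the point, so at the centre the
-- comparison is linear algebra.
theorem scalarExtension_self (q : Cotangent S) (X Y : Plane × (Plane →L[ℝ] ℝ)) :
    scalarExtension D Φ c q X Y
      = chartExtension D Φ c q.proj (extChartAt cotangentModel q q) X Y := by
  have hs := mem_extChartAt_source (I := 𝓡 2) q.proj
  have hu := mem_extChartAt_target (I := 𝓡 2) q.proj
  have hf : (extChartAt cotangentModel q q).1 = extChartAt (𝓡 2) q.proj q.proj :=
    cotangentChart_fst hs
  have hB (v w : TangentSpace (𝓡 2) q.proj) := inChart_self Φ v w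
  refine (modifiedExtension_apply D c _ q X Y).trans ?_
  rw [deformedExtension_apply D htorsion q (inChart Φ q.proj (extChartAt (𝓡 2) q.proj q.proj))
    (fun v w => (hB v w).trans ((hΦ _ v w).trans (hB w v).symm)) (fun v w => (hB v w).symm),
    chartExtension_apply, cotangentChart_snd_self, hf, (extChartAt (𝓡 2) q.proj).left_inv hs]
  ring

include htorsion hΦ in
-- At a point away from the centre, pass to the chart centred at that point. The Hessian of the
-- transition enters twice through the differentials of the fibre coordinates, and -2ω(Γ) changes by
-- the same amount with opposite sign.
theorem inChart_scalarExtension (q : Cotangent S) {w : Plane × (Plane →L[ℝ] ℝ)}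
    (hw : w ∈ (extChartAt cotangentModel q).target) :
    inChart (scalarExtension D Φ c) q w = chartExtension D Φ c q.proj w := by
  have key (X Y : Plane × (Plane →L[ℝ] ℝ)) : inChart (scalarExtension D Φ c) q w X Y
      = chartExtension D Φ c q.proj w X Y := by
    have h0 : inChart (scalarExtension D Φ c) q w X Y
        = scalarExtension D Φ c ((extChartAt cotangentModel q).symm w)
          (mfderiv 𝓘(ℝ, Plane × (Plane →L[ℝ] ℝ)) cotangentModel
            (extChartAt cotangentModel q).symm w X)
          (mfderiv 𝓘(ℝ, Plane × (Plane →L[ℝ] ℝ)) cotangentModel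
            (extChartAt cotangentModel q).symm w Y) := rfl
    have hu := fst_mem_overlap hw
    have hp := proj_cotangentChart_symm_mem hw
    have hs := mem_extChartAt_source (I := 𝓡 2) ((extChartAt cotangentModel q).symm w).proj
    have hFd := fderiv_cotangentTransition_snd hw
    have hF1 := fderiv_cotangentTransition_fst hw
    have hF2 := cotangentTransition_snd hu
    have hc := chart_proj_cotangentChart_symm hw
    have hx := proj_cotangentChart_symm hw
    rw [h0, mfderiv_cotangentChart_symm hw, mfderiv_cotangentChart_symm hw]
    refine (scalarExtension_self D Φ c htorsion hΦ _ _ _).trans ?_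
    have e0 : extChartAt cotangentModel ((extChartAt cotangentModel q).symm w)
      ((extChartAt cotangentModel q).symm w)
        = cotangentTransition q ((extChartAt cotangentModel q).symm w) w := rfl
    have law := chartConn_transition D hu
    have hp' := chartConn_symm D htorsion hu.1 X.1 Y.1
    have hx' := chartConn_symm D htorsion ((extChartAt (𝓡 2) _).map_source hu.2)
      (fderiv ℝ (transition q.proj ((extChartAt cotangentModel q).symm w).proj) w.1 X.1)
      (fderiv ℝ (transition q.proj ((extChartAt cotangentModel q).symm w).proj) w.1 Y.1)
    -- The transformation law is used in both orders of its arguments, one for each fibre-coordinate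
    -- term of the metric.
    have l1 := congrArg (cotangentTransition q ((extChartAt cotangentModel q).symm w) w).2
      (law X.1 Y.1)
    have l2 := congrArg (cotangentTransition q ((extChartAt cotangentModel q).symm w) w).2
      (law Y.1 X.1)
    rw [← hp'] at l2
    rw [map_add, hF2] at l1 l2
    rw [e0, chartExtension_apply, chartExtension_apply, hF1, hF1, hFd, hFd, hF2, hF2,
      cotangentTransition_fst hu, inChart_transition Φ hu, transition_symm hu]
    unfold transition at hx' l1 l2 ⊢
    rw [← hx'] at l2
    linarith
  exact ContinuousLinearMap.ext fun X => ContinuousLinearMap.ext fun Y => key X Y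

end Extension

/-! ### Null bases and neutral signature. -/

section NullFrame

variable {V : Type*} [AddCommGroup V] [Module ℝ V] [TopologicalSpace V]
  {g : V →L[ℝ] V →L[ℝ] ℝ}

theorem linearIndependent_of_dual {ι : Type*} [Fintype ι] [DecidableEq ι] {n m : ι → V}
    (h : ∀ i j, g (n i) (m j) = if i = j then 1 else 0) : LinearIndependent ℝ n := by
  rw [Fintype.linearIndependent_iff]
  intro c hc j
  have := congrArg (fun X => g X (m j)) hc
  simpa [map_sum, sum_apply, h] using this

/-- A null basis from vectors `a i` and null vectors `v j` with `g (a i) (v j) = δ_ij`. -/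
theorem exists_isNullBasis (hV : Module.finrank ℝ V = 4) (hs : ∀ X Y, g X Y = g Y X)
    {a v : Fin 2 → V} (haa : ∀ i j, g (a i) (a j) = 0)
    (hav : ∀ i j, g (a i) (v j) = if i = j then 1 else 0) (hvv : ∀ i j, g (v i) (v j) = 0) :
    ∃ n : Module.Basis (Fin 4) ℝ V, IsNullBasis g n ∧ n 0 = a 0 ∧ n 1 = a 1 ∧ n 2 = v 0 ∧
      n 3 = v 1 := by
  have hva (i j) : g (v i) (a j) = if i = j then 1 else 0 := by
    rw [hs, hav]
    simp [eq_comm]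
  have hl : LinearIndependent ℝ ![a 0, a 1, v 0, v 1] := by
    refine linearIndependent_of_dual (g := g) (m := ![v 0, v 1, a 0, a 1]) fun i j => ?_
    fin_cases i <;> fin_cases j <;> simp [haa, hav, hva, hvv]
  let n := basisOfLinearIndependentOfCardEqFinrank hl (by simp [hV])
  have hn : ⇑n = ![a 0, a 1, v 0, v 1] := coe_basisOfLinearIndependentOfCardEqFinrank _ _
  refine ⟨n, ?_, by simp [hn], by simp [hn], by simp [hn], by simp [hn]⟩
  constructor
  · exact hs
  all_goals simp [hn, haa, hav, hvv]

/-- Each dual null pair spans a hyperbolic plane, in which n ± ½n' have squares ±1. -/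
theorem IsNullBasis.hasNeutralSignature {n : Module.Basis (Fin 4) ℝ V} (h : IsNullBasis g n) :
    HasNeutralSignature g := by
  have hV : Module.finrank ℝ V = 4 := by simp [Module.finrank_eq_card_basis n]
  let b : Fin 4 → V := ![n 0 + (1 / 2 : ℝ) • n 2, n 1 + (1 / 2 : ℝ) • n 3,
    n 0 - (1 / 2 : ℝ) • n 2, n 1 - (1 / 2 : ℝ) • n 3]
  let ε : Fin 4 → ℝ := ![1, 1, -1, -1]
  have hb (i j : Fin 4) : g (b i) (b j) = if i = j then ε i else 0 := by
    fin_cases i <;> fin_cases j <;> simp [b, ε, h.apply] <;> norm_num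
  have hl : LinearIndependent ℝ b := by
    refine linearIndependent_of_dual (g := g) (m := fun j => ε j • b j) fun i j => ?_
    fin_cases i <;> fin_cases j <;> simp [hb] <;> simp [ε]
  let B := basisOfLinearIndependentOfCardEqFinrank hl (by simp [hV])
  have hB : ⇑B = b := coe_basisOfLinearIndependentOfCardEqFinrank _ _
  refine ⟨B, fun i j hij => ?_, ?_, ?_, ?_, ?_⟩
  · rw [hB, hb, if_neg hij]
  all_goals rw [hB, hb]; simp [ε]

end NullFrame

/-! ### Canonical orientation and self-duality in coordinates. -/

namespace IsExtensionData

variable {U : Set Plane} {Γ : Plane → Plane →L[ℝ] Plane →L[ℝ] Plane}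
  {Φ : Plane → Plane →L[ℝ] Plane →L[ℝ] ℝ} {c : Plane → ℝ} (h : IsExtensionData U Γ Φ c)
  {w : Plane × (Plane →L[ℝ] ℝ)} (hw : w.1 ∈ U)
include h hw

theorem exists_nullLift_basis : ∃ n : Module.Basis (Fin 4) ℝ (Plane × (Plane →L[ℝ] ℝ)),
    IsNullBasis (walkerMetric Γ Φ c w) n ∧ n 0 = nullLift Γ Φ c w 0 ∧ n 1 = nullLift Γ Φ c w 1 ∧
      n 2 = (0, coordCovec 0) ∧ n 3 = (0, coordCovec 1) := by
  refine exists_isNullBasis (a := nullLift Γ Φ c w) (v := fun i => (0, coordCovec i)) ?_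
    (h.isMetricAt hw).symm.self_of_nhds ?_ ?_ ?_
  · rw [Module.finrank_eq_card_basis (planeBasis.prod covectorBasis)]
    simp
  · intro i j
    have e : extensionForm (Γ w.1) (Φ w.1) (c w.1) w.2 (coordVec j) (coordVec i)
        = extensionForm (Γ w.1) (Φ w.1) (c w.1) w.2 (coordVec i) (coordVec j) := by
      simp only [extensionForm_apply, h.symm_conn _ hw (coordVec j), h.symm_form _ hw (coordVec j)]
      ring
    change walkerForm _ _ _ = 0
    simp only [walkerForm_apply, nullLift, smul_apply, e, smul_eq_mul]
    ring
  · intro i j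
    simp [walkerMetric_apply, nullLift, eq_comm]
  · intro i j
    simp [walkerMetric_apply]

theorem hasNeutralSignature_walkerMetric : HasNeutralSignature (walkerMetric Γ Φ c w) := by
  obtain ⟨n, hn, -⟩ := h.exists_nullLift_basis hw
  exact hn.hasNeutralSignature

/-- The orientation for which the vertical plane is self-dual; the Weyl tensor is self-dual. -/
theorem exists_orientation : ∃ o : Orientation ℝ (Plane × (Plane →L[ℝ] ℝ)) (Fin 4),
    (∀ X Y : Plane × (Plane →L[ℝ] ℝ), X.1 = 0 → Y.1 = 0 →
      IsSelfDualForm (walkerMetric Γ Φ c w) o fun Z T => walkerMetric Γ Φ c w X Z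
        * walkerMetric Γ Φ c w Y T - walkerMetric Γ Φ c w X T * walkerMetric Γ Φ c w Y Z) ∧
    ∀ Z T, IsSelfDualForm (walkerMetric Γ Φ c w) o fun X Y => walkerWeyl Γ Φ c w X Y Z T := by
  obtain ⟨n, hn, h0, h1, h2, h3⟩ := h.exists_nullLift_basis hw
  have hm := h.isMetricAt hw
  refine ⟨n.orientation, fun X Y hX hY => ?_, fun Z T => ?_⟩
  · let β := LinearMap.mk₂ ℝ (fun Z T => walkerMetric Γ Φ c w X Z
        * walkerMetric Γ Φ c w Y T - walkerMetric Γ Φ c w X T * walkerMetric Γ Φ c w Y Z)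
        (fun _ _ _ => by simp only [map_add]; ring) (fun _ _ _ => by simp only [map_smul, smul_eq_mul]; ring)
        (fun _ _ _ => by simp only [map_add]; ring) (fun _ _ _ => by simp only [map_smul, smul_eq_mul]; ring)
    -- Vertical vectors are orthogonal to n₂ and n₃, so the form dual to a vertical bivector has
    -- only its 01 component, which is self-dual.
    have hv (X : Plane × (Plane →L[ℝ] ℝ)) (hX : X.1 = 0) (j : Fin 2) :
        walkerMetric Γ Φ c w X (0, coordCovec j) = 0 := by
      simp [walkerMetric_apply, hX]
    refine hn.isSelfDualForm β (fun Z => ?_) ?_ ?_ ?_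
    · simp only [β, LinearMap.mk₂_apply]
      ring
    all_goals simp [β, h0, h1, h2, h3, hv X hX, hv Y hY]
  · have ρ_add (X X' Y) : ricci (leviCivita (walkerMetric Γ Φ c)) w (X + X') Y
        = ricci (leviCivita (walkerMetric Γ Φ c)) w X Y
          + ricci (leviCivita (walkerMetric Γ Φ c)) w X' Y := by
      simp only [hm.ricci_eq n, hm.loweredCurvature_add₁, Finset.sum_add_distrib]
    have ρ_smul (a : ℝ) (X Y) : ricci (leviCivita (walkerMetric Γ Φ c)) w (a • X) Y
        = a * ricci (leviCivita (walkerMetric Γ Φ c)) w X Y := by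
      simp only [hm.ricci_eq n, hm.loweredCurvature_smul₁, Finset.mul_sum]
    let β := LinearMap.mk₂ ℝ (fun X Y => walkerWeyl Γ Φ c w X Y Z T)
        (fun _ _ _ => by
          simp only [walkerWeyl, map_add, add_apply, hm.loweredCurvature_add₁, ρ_add]; ring)
        (fun _ _ _ => by
          simp only [walkerWeyl, map_smul, smul_apply, smul_eq_mul, hm.loweredCurvature_smul₁,
            ρ_smul]; ring)
        (fun _ _ _ => by
          simp only [walkerWeyl, map_add, add_apply, hm.loweredCurvature_add₂, ρ_add]; ring)
        (fun _ _ _ => by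
          simp only [walkerWeyl, map_smul, smul_apply, smul_eq_mul, hm.loweredCurvature_smul₂,
            ρ_smul]; ring)
    refine hn.isSelfDualForm β (fun X => ?_) ?_ ?_ ?_
    · have := loweredCurvature_swap_left (G := walkerMetric Γ Φ c) (u := w) X X Z T
      simp only [β, LinearMap.mk₂_apply, walkerWeyl]
      linarith
    all_goals simp only [β, LinearMap.mk₂_apply, h0, h1, h2, h3]
    · rw [h.walkerWeyl_mixed hw, if_neg (by decide)]
    · rw [h.walkerWeyl_mixed hw, if_neg (by decide)]
    · rw [h.walkerWeyl_mixed hw, if_pos rfl]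

end IsExtensionData

/-! ### The Levi-Civita connection depends only on the germ of the metric. -/

section LocalCongruence

variable {V : Type*} [NormedAddCommGroup V] [NormedSpace ℝ V] [FiniteDimensional ℝ V]
  {G G' : V → V →L[ℝ] V →L[ℝ] ℝ} {u : V}

omit [FiniteDimensional ℝ V] in
theorem leviCivita_congr (h : G =ᶠ[𝓝 u] G') (X Y : V) : leviCivita G u X Y = leviCivita G' u X Y := by
  simp only [leviCivita, h.self_of_nhds, h.fderiv_eq]

omit [FiniteDimensional ℝ V] in
theorem eventually_leviCivita_congr (h : G =ᶠ[𝓝 u] G') :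
    ∀ᶠ t in 𝓝 u, ∀ X Y, leviCivita G t X Y = leviCivita G' t X Y := by
  filter_upwards [h.eventuallyEq_nhds] with t ht X Y using leviCivita_congr ht X Y

end LocalCongruence

/-! ### Smoothness and signature on the cotangent bundle. -/

section Geometry

variable {S : Type*} [TopologicalSpace S] [T2Space S] [ChartedSpace Plane S]
  [IsManifold (𝓡 2) ∞ S]
  {D : CovariantDerivative (𝓡 2) Plane (TangentSpace (𝓡 2) : S → Type _)}
  (hD : CovariantDerivative.ContMDiffCovariantDerivative D ∞) (htorsion : D.torsion = 0)
  {Φ : Π x : S, TangentSpace (𝓡 2) x →L[ℝ] TangentSpace (𝓡 2) x →L[ℝ] ℝ}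
  (hΦ : IsSmoothTensor Φ) (hΦs : ∀ x v w, Φ x v w = Φ x w v) {c : S → ℝ}
  (hc : ContMDiff (𝓡 2) 𝓘(ℝ) ∞ c)

include hD htorsion hΦ hΦs hc in
theorem isExtensionData_chart (p : S) : IsExtensionData (extChartAt (𝓡 2) p).target (chartConn D p)
    (inChart Φ p) (c ∘ (extChartAt (𝓡 2) p).symm) where
  isOpen := isOpen_chart_target p
  smooth_conn := contDiffOn_chartConn D hD p
  symm_conn _ hu := chartConn_symm D htorsion hu
  smooth_form := hΦ p
  symm_form u hu v w := by rw [inChart_surface Φ hu, inChart_surface Φ hu, hΦs]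
  smooth_factor u hu := (contDiffAt_comp_chart_symm hc hu).contDiffWithinAt

omit [T2Space S] in
include htorsion hΦs in
theorem inChart_eventuallyEq (q : Cotangent S) : inChart (scalarExtension D Φ c) q
    =ᶠ[𝓝 (extChartAt cotangentModel q q)] chartExtension D Φ c q.proj := by
  filter_upwards [(isOpen_extChartAt_target q).mem_nhds (mem_extChartAt_target q)] with w hw
    using inChart_scalarExtension D Φ c htorsion hΦs q hw

omit [T2Space S] in
theorem cotangentChart_fst_mem (q : Cotangent S) :
    (extChartAt cotangentModel q q).1 ∈ (extChartAt (𝓡 2) q.proj).target := by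
  rw [cotangentChart_fst (mem_extChartAt_source _)]
  exact mem_extChartAt_target _

omit [T2Space S] in
include htorsion hΦs in
theorem scalarExtension_eq (q : Cotangent S) :
    (scalarExtension D Φ c q : Plane × (Plane →L[ℝ] ℝ) →L[ℝ] Plane × (Plane →L[ℝ] ℝ) →L[ℝ] ℝ)
      = chartExtension D Φ c q.proj (extChartAt cotangentModel q q) :=
  ContinuousLinearMap.ext fun X => ContinuousLinearMap.ext fun Y =>
    scalarExtension_self D Φ c htorsion hΦs q X Y

include hD htorsion hΦ hΦs hc in
theorem isNeutralMetric_scalarExtension : IsNeutralMetric (scalarExtension D Φ c) := by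
  refine ⟨fun q => ?_, fun q => ?_⟩
  · have := (isExtensionData_chart hD htorsion hΦ hΦs hc q.proj).contDiffOn_walkerMetric
    rw [← cotangentChart_target] at this
    exact this.congr fun w hw => inChart_scalarExtension D Φ c htorsion hΦs q hw
  · have := (isExtensionData_chart hD htorsion hΦ hΦs hc q.proj).hasNeutralSignature_walkerMetric
      (cotangentChart_fst_mem q)
    exact (congrArg HasNeutralSignature (scalarExtension_eq htorsion hΦs q)).mpr this

end Geometry

/-! ### The vertical distribution. -/

section Vertical

variable {S : Type*} [TopologicalSpace S] [ChartedSpace Plane S] [IsManifold (𝓡 2) ∞ S]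

theorem mem_vertical {q : Cotangent S} {W : TangentSpace cotangentModel q} :
    W ∈ vertical q ↔ (show Plane × (Plane →L[ℝ] ℝ) from W).1 = 0 := by
  have := dproj_apply q W
  unfold vertical
  rw [LinearMap.mem_ker]
  exact ⟨fun h => this.symm.trans h, fun h => this.trans h⟩

theorem mem_vertical_iff_chart {q y : Cotangent S} (hy : y ∈ (extChartAt cotangentModel q).source)
    {W : TangentSpace cotangentModel y} : W ∈ vertical y ↔
      (show Plane × (Plane →L[ℝ] ℝ) from mfderiv cotangentModel
        𝓘(ℝ, Plane × (Plane →L[ℝ] ℝ)) (extChartAt cotangentModel q) y W).1 = 0 := by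
  have hy' := hy
  rw [cotangentChart_source] at hy'
  rw [← chartDeriv_dproj hy W]
  unfold vertical
  rw [LinearMap.mem_ker]
  constructor
  · intro h
    exact (congrArg (chartDeriv q.proj y.proj) h).trans (map_zero _)
  · intro h
    exact (chartDeriv_isInvertible hy').injective (h.trans (map_zero _).symm)

theorem finrank_vertical (q : Cotangent S) : Module.finrank ℝ (vertical q) = 2 := by
  let f : Plane × (Plane →L[ℝ] ℝ) →ₗ[ℝ] Plane := LinearMap.fst ℝ Plane (Plane →L[ℝ] ℝ)
  have e : vertical q = LinearMap.ker f := by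
    ext W
    exact mem_vertical
  have h1 := f.finrank_range_add_finrank_ker
  have h2 : LinearMap.range f = ⊤ := LinearMap.range_eq_top.2 fun v => ⟨(v, 0), rfl⟩
  have h3 : Module.finrank ℝ (Plane × (Plane →L[ℝ] ℝ)) = 4 := by
    rw [Module.finrank_eq_card_basis (planeBasis.prod covectorBasis)]
    simp
  rw [h2, h3, finrank_top, finrank_euclideanSpace_fin] at h1
  have h4 : Module.finrank ℝ (LinearMap.ker f) = 2 := by omega
  exact (congrArg (fun P : Submodule ℝ (Plane × (Plane →L[ℝ] ℝ)) => Module.finrank ℝ P) e).trans h4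

/-- The coordinate vector field `∂_{x_{i'}}` of the natural chart around `q`. -/
def verticalField (q : Cotangent S) (i : Fin 2) : Π y : Cotangent S, TangentSpace cotangentModel y :=
  coordField cotangentModel q (0, coordCovec i)

theorem contMDiffAt_verticalField (q : Cotangent S) (i : Fin 2) :
    ContMDiffAt cotangentModel cotangentModel.tangent ∞
      (fun y => (⟨y, verticalField q i y⟩ : TangentBundle cotangentModel (Cotangent S))) q := by
  have hc : ContMDiffAt 𝓘(ℝ, Plane × (Plane →L[ℝ] ℝ)) 𝓘(ℝ, Plane × (Plane →L[ℝ] ℝ)).tangent ∞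
      (fun w => (⟨w, (0, coordCovec i)⟩ : TangentBundle 𝓘(ℝ, Plane × (Plane →L[ℝ] ℝ))
        (Plane × (Plane →L[ℝ] ℝ)))) (extChartAt cotangentModel q q) :=
    (contMDiffAt_vectorSpace_iff_contDiffAt (V := fun _ => (0, coordCovec i))).2 contDiffAt_const
  exact ContMDiffAt.mpullback_vectorField_preimage hc
    (contMDiffAt_extChartAt (n := ∞)) (isInvertible_mfderiv_extChartAt (mem_extChartAt_source q))
    (by simp)

theorem eq_of_map_eq_covector {V : Type*} [AddCommGroup V] [Module ℝ V] [TopologicalSpace V]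
    (L : V →L[ℝ] Plane × (Plane →L[ℝ] ℝ)) (hL : Function.Injective L) {a b W : V}
    {ξ : Plane →L[ℝ] ℝ} (ha : L a = (0, coordCovec 0)) (hb : L b = (0, coordCovec 1))
    (hW : L W = (0, ξ)) : W = ξ (coordVec 0) • a + ξ (coordVec 1) • b := by
  apply hL
  rw [map_add, map_smul, map_smul, ha, hb, hW]
  refine Prod.ext ?_ (covector_eq ξ)
  simp

theorem vertical_eq_span {q y : Cotangent S} (hy : y ∈ (extChartAt cotangentModel q).source) :
    vertical y = Submodule.span ℝ (Set.range fun i => verticalField q i y) := by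
  have hi := isInvertible_mfderiv_extChartAt (I := cotangentModel) hy
  have hv (i : Fin 2) : mfderiv cotangentModel 𝓘(ℝ, Plane × (Plane →L[ℝ] ℝ))
      (extChartAt cotangentModel q) y (verticalField q i y) = (0, coordCovec i) :=
    hi.self_apply_inverse _
  apply le_antisymm
  · intro W hW
    rw [mem_vertical_iff_chart hy] at hW
    obtain ⟨ξ, hξ⟩ : ∃ ξ : Plane →L[ℝ] ℝ, mfderiv cotangentModel 𝓘(ℝ, Plane × (Plane →L[ℝ] ℝ))
      (extChartAt cotangentModel q) y W = ((0, ξ) : Plane × (Plane →L[ℝ] ℝ)) :=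
      ⟨_, Prod.ext hW rfl⟩
    have e : W = ξ (coordVec 0) • verticalField q 0 y + ξ (coordVec 1) • verticalField q 1 y :=
      eq_of_map_eq_covector _ hi.injective (hv 0) (hv 1) hξ
    rw [e]
    exact add_mem (Submodule.smul_mem _ _ (Submodule.subset_span ⟨0, rfl⟩))
      (Submodule.smul_mem _ _ (Submodule.subset_span ⟨1, rfl⟩))
  · rw [Submodule.span_le]
    rintro _ ⟨i, rfl⟩
    exact (mem_vertical_iff_chart hy).2 (congrArg Prod.fst (hv i))

end Vertical

/-! ### Walker, self-dual, isotropic and quasi-Einstein properties. -/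

section Geometry

variable {S : Type*} [TopologicalSpace S] [T2Space S] [ChartedSpace Plane S]
  [IsManifold (𝓡 2) ∞ S]
  {D : CovariantDerivative (𝓡 2) Plane (TangentSpace (𝓡 2) : S → Type _)}
  (hD : CovariantDerivative.ContMDiffCovariantDerivative D ∞) (htorsion : D.torsion = 0)
  {Φ : Π x : S, TangentSpace (𝓡 2) x →L[ℝ] TangentSpace (𝓡 2) x →L[ℝ] ℝ}
  (hΦ : IsSmoothTensor Φ) (hΦs : ∀ x v w, Φ x v w = Φ x w v) {c : S → ℝ}
  (hc : ContMDiff (𝓡 2) 𝓘(ℝ) ∞ c)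

include hD htorsion hΦ hΦs hc in
theorem leviCivita_scalarExtension_fst (q : Cotangent S) (X Y : Plane × (Plane →L[ℝ] ℝ)) :
    (leviCivita (inChart (scalarExtension D Φ c) q) (extChartAt cotangentModel q q) X Y).1
      = chartConn D q.proj (extChartAt (𝓡 2) q.proj q.proj) X.1 Y.1
        - (c q.proj / 2) • ((show Plane →L[ℝ] ℝ from q.2) Y.1 • X.1
          + (show Plane →L[ℝ] ℝ from q.2) X.1 • Y.1) := by
  have hs := mem_extChartAt_source (I := 𝓡 2) q.proj
  rw [leviCivita_congr (inChart_eventuallyEq htorsion hΦs q)]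
  refine ((isExtensionData_chart hD htorsion hΦ hΦs hc q.proj).leviCivita_fst
    (cotangentChart_fst_mem q) X Y).trans ?_
  rw [cotangentChart_snd_self, cotangentChart_fst hs, Function.comp_apply,
    (extChartAt (𝓡 2) q.proj).left_inv hs]

include hD htorsion hΦ hΦs hc in
theorem isWalker_scalarExtension : IsWalker (scalarExtension D Φ c) vertical where
  rank_two := finrank_vertical
  smooth q := ⟨verticalField q, contMDiffAt_verticalField q, by
    filter_upwards [(isOpen_extChartAt_source (I := cotangentModel) q).mem_nhds
      (mem_extChartAt_source q)] with y hy using vertical_eq_span hy⟩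
  null q X hX Y hY := by
    rw [mem_vertical] at hX hY
    refine (scalarExtension_self D Φ c htorsion hΦs q X Y).trans ?_
    have key (A B : Plane × (Plane →L[ℝ] ℝ)) (hA : A.1 = 0) (hB : B.1 = 0) :
        chartExtension D Φ c q.proj (extChartAt cotangentModel q q) A B = 0 := by
      rw [chartExtension_apply, hA, hB]
      simp
    exact key X Y hX hY
  parallel q Y _ hY v := by
    rw [mem_vertical]
    have hYq := hY.self_of_nhds
    rw [mem_vertical] at hYq
    let f : Plane × (Plane →L[ℝ] ℝ) → Plane × (Plane →L[ℝ] ℝ) := fun w =>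
      mfderiv cotangentModel 𝓘(ℝ, Plane × (Plane →L[ℝ] ℝ)) (extChartAt cotangentModel q)
        ((extChartAt cotangentModel q).symm w) (Y ((extChartAt cotangentModel q).symm w))
    have hf : (fun w => (f w).1) =ᶠ[𝓝 (extChartAt cotangentModel q q)] fun _ => 0 := by
      have ht : ∀ᶠ w in 𝓝 (extChartAt cotangentModel q q),
          Y ((extChartAt cotangentModel q).symm w)
            ∈ vertical ((extChartAt cotangentModel q).symm w) := by
        refine (continuousAt_extChartAt_symm (I := cotangentModel) q).eventually
          (p := fun y => Y y ∈ vertical y) ?_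
        rwa [extChartAt_to_inv]
      filter_upwards [ht, (isOpen_extChartAt_target q).mem_nhds (mem_extChartAt_target q)]
        with w hw hwt
      exact (mem_vertical_iff_chart ((extChartAt cotangentModel q).map_target hwt)).1 hw
    have hd (v : Plane × (Plane →L[ℝ] ℝ)) :
        (fderiv ℝ f (extChartAt cotangentModel q q) v).1 = 0 := by
      -- If `f` is not differentiable, `fderiv` takes its default value 0, whose base component
      -- vanishes as well.
      by_cases hdf : DifferentiableAt ℝ f (extChartAt cotangentModel q q)
      · have k := hdf.hasFDerivAt.fst.fderiv
        rw [hf.fderiv_eq] at k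
        simpa using (congrArg (fun L : Plane × (Plane →L[ℝ] ℝ) →L[ℝ] Plane => L v) k).symm
      · rw [fderiv_zero_of_not_differentiableAt hdf]
        rfl
    have hl := leviCivita_scalarExtension_fst hD htorsion hΦ hΦs hc q v (Y q)
    have key (A B : Plane × (Plane →L[ℝ] ℝ)) (hB : B.1 = 0) :
        (0 : Plane) + (chartConn D q.proj (extChartAt (𝓡 2) q.proj q.proj) A.1 B.1
          - (c q.proj / 2) • ((show Plane →L[ℝ] ℝ from q.2) B.1 • A.1
          + (show Plane →L[ℝ] ℝ from q.2) A.1 • B.1)) = 0 := by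
      simp [hB]
      exact Or.inr (Or.inl (map_zero q.2))
    exact (congrArg₂ (· + ·) (hd v) hl).trans (key v (Y q) hYq)

/-- The Weyl tensor in terms of the metric `g`, the Ricci tensor `ρ`, the scalar curvature `τ` and
a component `r` of the curvature tensor. -/
def weylCombination {V : Type*} (g ρ : V → V → ℝ) (τ r : ℝ) (X Y Z T : V) : ℝ :=
  r + τ / 6 * (g X Z * g Y T - g X T * g Y Z)
    + 1 / 2 * (ρ X T * g Y Z - ρ X Z * g Y T + ρ Y Z * g X T - ρ Y T * g X Z)

omit [T2Space S] in
theorem weyl_eq_weylCombination (g : Π q : Cotangent S,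
    TangentSpace cotangentModel q →L[ℝ] TangentSpace cotangentModel q →L[ℝ] ℝ) (q : Cotangent S)
    (X Y Z T : Plane × (Plane →L[ℝ] ℝ)) : weyl g q X Y Z T
      = weylCombination (V := Plane × (Plane →L[ℝ] ℝ)) (fun A B => g q A B)
        (fun A B => metricRicci g q A B) (scalarCurvature g q)
        (g q (metricCurvature g q X Y Z) T) X Y Z T := rfl

omit [T2Space S] [IsManifold (𝓡 2) ∞ S] [ChartedSpace Plane S] [TopologicalSpace S] in
theorem IsExtensionData.walkerWeyl_eq_weylCombination (Γ : Plane → Plane →L[ℝ] Plane →L[ℝ] Plane)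
    (Φ : Plane → Plane →L[ℝ] Plane →L[ℝ] ℝ) (c : Plane → ℝ) (w X Y Z T : Plane × (Plane →L[ℝ] ℝ)) :
    walkerWeyl Γ Φ c w X Y Z T
      = weylCombination (fun A B => walkerMetric Γ Φ c w A B)
        (fun A B => ricci (leviCivita (walkerMetric Γ Φ c)) w A B) (6 * c w.1)
        (loweredCurvature (walkerMetric Γ Φ c) w X Y Z T) X Y Z T := rfl

include hD htorsion hΦ hΦs hc in
-- Both Weyl tensors are the same `weylCombination`, so it suffices to match metric, Ricci tensor,
-- scalar curvature and lowered curvature with their coordinate versions.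
theorem isSelfDualWalker_scalarExtension : IsSelfDualWalker (scalarExtension D Φ c) vertical := by
  intro q
  have hE := isExtensionData_chart hD htorsion hΦ hΦs hc q.proj
  have hw := cotangentChart_fst_mem q
  have hm := hE.isMetricAt hw
  have hG := inChart_eventuallyEq (c := c) htorsion hΦs q
  have hL := eventually_leviCivita_congr hG
  have hg := scalarExtension_eq (c := c) htorsion hΦs q
  obtain ⟨o, ho1, ho2⟩ := hE.exists_orientation hw
  have hρ (X Y : Plane × (Plane →L[ℝ] ℝ)) : metricRicci (scalarExtension D Φ c) q X Y
      = ricci (leviCivita (chartExtension D Φ c q.proj)) (extChartAt cotangentModel q q) X Y :=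
    ricci_congr hL X Y
  have hτ : scalarCurvature (scalarExtension D Φ c) q
      = 6 * (c ∘ (extChartAt (𝓡 2) q.proj).symm) (extChartAt cotangentModel q q).1 := by
    refine Eq.trans ?_ (hE.contract_ricci_walkerMetric hw (Module.finBasis ℝ _))
    refine Finset.sum_congr rfl fun i _ => (hρ _ _).trans ?_
    exact congrArg (fun G : Plane × (Plane →L[ℝ] ℝ) →L[ℝ] Plane × (Plane →L[ℝ] ℝ) →L[ℝ] ℝ =>
      ricci (leviCivita (chartExtension D Φ c q.proj)) (extChartAt cotangentModel q q)
        (Module.finBasis ℝ _ i) (G.inverse (LinearMap.toContinuousLinearMap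
          ((Module.finBasis ℝ (Plane × (Plane →L[ℝ] ℝ))).coord i)))) hg
  have hW (X Y Z T : Plane × (Plane →L[ℝ] ℝ)) : weyl (scalarExtension D Φ c) q X Y Z T
      = IsExtensionData.walkerWeyl (chartConn D q.proj) (inChart Φ q.proj)
        (c ∘ (extChartAt (𝓡 2) q.proj).symm) (extChartAt cotangentModel q q) X Y Z T := by
    have hg' (A B : Plane × (Plane →L[ℝ] ℝ)) : scalarExtension D Φ c q A B
      = walkerMetric (chartConn D q.proj) (inChart Φ q.proj)
        (c ∘ (extChartAt (𝓡 2) q.proj).symm) (extChartAt cotangentModel q q) A B :=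
      scalarExtension_self D Φ c htorsion hΦs q A B
    have hR : scalarExtension D Φ c q (metricCurvature (scalarExtension D Φ c) q X Y Z) T
        = loweredCurvature (chartExtension D Φ c q.proj) (extChartAt cotangentModel q q)
          X Y Z T := by
      refine (hg' _ _).trans (Eq.trans ?_ (hm.curvature_lower X Y Z T))
      exact congrArg (fun A => walkerMetric (chartConn D q.proj) (inChart Φ q.proj)
        (c ∘ (extChartAt (𝓡 2) q.proj).symm) (extChartAt cotangentModel q q) A T)
        (curvature_congr hL X Y Z)
    have e1 := funext fun A => funext fun B => hg' A B
    have e2 := funext fun A => funext fun B => hρ A B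
    rw [weyl_eq_weylCombination, hτ, hR, IsExtensionData.walkerWeyl_eq_weylCombination]
    exact congrArg₂ (fun g ρ => weylCombination g ρ _ _ X Y Z T) e1 e2
  refine ⟨o, fun X hX Y hY => ?_, fun Z T => ?_⟩
  · rw [mem_vertical] at hX hY
    have key (G : Plane × (Plane →L[ℝ] ℝ) →L[ℝ] Plane × (Plane →L[ℝ] ℝ) →L[ℝ] ℝ)
        (hG : G = chartExtension D Φ c q.proj (extChartAt cotangentModel q q))
        (X Y : Plane × (Plane →L[ℝ] ℝ)) (hX : X.1 = 0) (hY : Y.1 = 0) :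
        IsSelfDualForm G o fun Z T => G X Z * G Y T - G X T * G Y Z := by
      subst hG
      exact ho1 X Y hX hY
    exact key _ hg X Y hX hY
  · have key (G : Plane × (Plane →L[ℝ] ℝ) →L[ℝ] Plane × (Plane →L[ℝ] ℝ) →L[ℝ] ℝ)
        (hG : G = chartExtension D Φ c q.proj (extChartAt cotangentModel q q))
        (Z T : Plane × (Plane →L[ℝ] ℝ)) :
        IsSelfDualForm G o fun X Y => weyl (scalarExtension D Φ c) q X Y Z T := by
      subst hG
      have e := funext fun X => funext fun Y => hW X Y Z T
      exact (congrArg (IsSelfDualForm _ o) e).mpr (ho2 Z T)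
    exact key _ hg Z T

omit [T2Space S] in
theorem comp_proj_eventuallyEq (f : S → ℝ) (q : Cotangent S) :
    (fun r : Cotangent S => f r.proj) ∘ (extChartAt cotangentModel q).symm
      =ᶠ[𝓝 (extChartAt cotangentModel q q)]
      fun w => (f ∘ (extChartAt (𝓡 2) q.proj).symm) w.1 := by
  filter_upwards [(isOpen_extChartAt_target q).mem_nhds (mem_extChartAt_target q)] with w hw
    using congrArg f (proj_cotangentChart_symm hw)

omit [T2Space S] in
theorem contMDiff_comp_proj {f : S → ℝ} (hf : ContMDiff (𝓡 2) 𝓘(ℝ) ∞ f) :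
    ContMDiff cotangentModel 𝓘(ℝ) ∞ (fun r : Cotangent S => f r.proj) :=
  hf.comp (contMDiff_proj (fun x : S => TangentSpace (𝓡 2) x →L[ℝ] ℝ))

omit [T2Space S] in
theorem mvfderiv_eq_fderiv_chart {f : S → ℝ} (hf : ContMDiff (𝓡 2) 𝓘(ℝ) ∞ f) (x : S)
    (v : TangentSpace (𝓡 2) x) : mvfderiv (𝓡 2) f x v
      = fderiv ℝ (f ∘ (extChartAt (𝓡 2) x).symm) (extChartAt (𝓡 2) x x) v := by
  rw [mvfderiv_chart (mem_extChartAt_source x) (hf.mdifferentiableAt (by simp)), chartDeriv_self]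

omit [T2Space S] in
theorem mvfderiv_comp_proj {f : S → ℝ} (hf : ContMDiff (𝓡 2) 𝓘(ℝ) ∞ f) (q : Cotangent S)
    (X : Plane × (Plane →L[ℝ] ℝ)) : mvfderiv cotangentModel (fun r : Cotangent S => f r.proj) q X
      = fderiv ℝ (f ∘ (extChartAt (𝓡 2) q.proj).symm) (extChartAt (𝓡 2) q.proj q.proj) X.1 := by
  have h1 : MDifferentiableAt (𝓡 2) 𝓘(ℝ) f q.proj := hf.mdifferentiableAt (by simp)
  have h2 : MDifferentiableAt cotangentModel (𝓡 2) (fun r : Cotangent S => r.proj) q :=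
    (contMDiff_proj (n := ∞) (fun x : S => TangentSpace (𝓡 2) x →L[ℝ] ℝ)).mdifferentiableAt
      (by simp)
  have k := mfderiv_comp q h1 h2
  have k2 : mvfderiv cotangentModel (fun r : Cotangent S => f r.proj) q X
      = mvfderiv (𝓡 2) f q.proj (dproj q X) :=
    congrArg (fun L : TangentSpace cotangentModel q →L[ℝ] ℝ => L X) k
  rw [k2, mvfderiv_eq_fderiv_chart hf]
  exact congrArg _ (dproj_apply q X)

include hD htorsion hΦ hΦs hc in
-- The function is constant on fibres, so only the base component of the connection enters; its part
-- in c contributes the symmetric product of ω and df.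
theorem metricHessian_comp_proj {f : S → ℝ} (hf : ContMDiff (𝓡 2) 𝓘(ℝ) ∞ f) (q : Cotangent S)
    (X Y : Plane × (Plane →L[ℝ] ℝ)) :
    metricHessian (scalarExtension D Φ c) (fun r : Cotangent S => f r.proj) q X Y
      = hessian (fun t v w => chartConn D q.proj t v w) (f ∘ (extChartAt (𝓡 2) q.proj).symm)
          (extChartAt (𝓡 2) q.proj q.proj) X.1 Y.1
        + c q.proj / 2 * ((show Plane →L[ℝ] ℝ from q.2) Y.1
            * fderiv ℝ (f ∘ (extChartAt (𝓡 2) q.proj).symm) (extChartAt (𝓡 2) q.proj q.proj) X.1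
          + (show Plane →L[ℝ] ℝ from q.2) X.1
            * fderiv ℝ (f ∘ (extChartAt (𝓡 2) q.proj).symm)
              (extChartAt (𝓡 2) q.proj q.proj) Y.1) := by
  have hs := mem_extChartAt_source (I := 𝓡 2) q.proj
  have ht := mem_extChartAt_target (I := 𝓡 2) q.proj
  have hfst := cotangentChart_fst hs
  have hfp := contDiffAt_comp_chart_symm hf ht
  have e := comp_proj_eventuallyEq f q
  set F := f ∘ (extChartAt (𝓡 2) q.proj).symm with hF
  have hdF (w : Plane × (Plane →L[ℝ] ℝ)) (hw : DifferentiableAt ℝ F w.1)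
      (Z : Plane × (Plane →L[ℝ] ℝ)) :
      fderiv ℝ (fun w : Plane × (Plane →L[ℝ] ℝ) => F w.1) w Z = fderiv ℝ F w.1 Z.1 :=
    congrArg (fun L : Plane × (Plane →L[ℝ] ℝ) →L[ℝ] ℝ => L Z)
      (hw.hasFDerivAt.comp w hasFDerivAt_fst).fderiv
  have h1 : (fun w => fderiv ℝ ((fun r : Cotangent S => f r.proj) ∘ (extChartAt cotangentModel q).symm) w Y)
      =ᶠ[𝓝 (extChartAt cotangentModel q q)] fun w => (fun t => fderiv ℝ F t Y.1) w.1 := by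
    have hev : ∀ᶠ w in 𝓝 (extChartAt cotangentModel q q), ContDiffAt ℝ 1 F w.1 := by
      refine continuous_fst.continuousAt.eventually (p := fun t => ContDiffAt ℝ 1 F t) ?_
      rw [hfst]
      exact (hfp.of_le (m := 1) ENat.LEInfty.out).eventually (by simp)
    filter_upwards [e.eventuallyEq_nhds, hev] with w hw hwF
    rw [hw.fderiv_eq, hdF w (hwF.differentiableAt (by simp))]
  have h2 : DifferentiableAt ℝ (fun t => fderiv ℝ F t Y.1) (extChartAt cotangentModel q q).1 := by
    rw [hfst]
    exact (hfp.of_le (m := 2) ENat.LEInfty.out).differentiableAt_fderiv_apply Y.1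
  have h3 := (h2.hasFDerivAt.comp (extChartAt cotangentModel q q) hasFDerivAt_fst).fderiv
  have h4 : fderiv ℝ (fun w => fderiv ℝ ((fun r : Cotangent S => f r.proj) ∘
      (extChartAt cotangentModel q).symm) w Y) (extChartAt cotangentModel q q) X
        = fderiv ℝ (fun t => fderiv ℝ F t Y.1) (extChartAt (𝓡 2) q.proj q.proj) X.1 := by
    rw [h1.fderiv_eq, ← hfst]
    exact congrArg (fun L : Plane × (Plane →L[ℝ] ℝ) →L[ℝ] ℝ => L X) h3
  have h5 (Z : Plane × (Plane →L[ℝ] ℝ)) : fderiv ℝ ((fun r : Cotangent S => f r.proj) ∘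
      (extChartAt cotangentModel q).symm) (extChartAt cotangentModel q q) Z
        = fderiv ℝ F (extChartAt (𝓡 2) q.proj q.proj) Z.1 := by
    rw [e.fderiv_eq, hdF _ (by rw [hfst]; exact hfp.differentiableAt (by simp)), hfst]
  refine (congrArg₂ (· - ·) h4 (h5 (leviCivita _ _ X Y))).trans ?_
  rw [leviCivita_scalarExtension_fst hD htorsion hΦ hΦs hc, map_sub, map_smul, map_add, map_smul,
    map_smul, hessian]
  simp only [smul_eq_mul]
  ring

omit [T2Space S] in
include htorsion hΦs in
-- The gradient is the vertical vector with covector df: it is null, and nonzero when df is.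
theorem isIsotropicOn_scalarExtension {f : S → ℝ} (hf : ContMDiff (𝓡 2) 𝓘(ℝ) ∞ f) :
    IsIsotropicOn (scalarExtension D Φ c) (fun q : Cotangent S => f q.proj)
      {q : Cotangent S | mvfderiv (𝓡 2) f q.proj ≠ 0} := by
  intro q hq
  have hgrad : gradient (scalarExtension D Φ c) (fun q : Cotangent S => f q.proj) q
      = (((0 : Plane), fderiv ℝ (f ∘ (extChartAt (𝓡 2) q.proj).symm)
        (extChartAt (𝓡 2) q.proj q.proj)) : Plane × (Plane →L[ℝ] ℝ)) := by
    have hg := scalarExtension_eq (c := c) htorsion hΦs q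
    refine (congrArg (fun G : Plane × (Plane →L[ℝ] ℝ) →L[ℝ] Plane × (Plane →L[ℝ] ℝ) →L[ℝ] ℝ =>
      G.inverse (mvfderiv cotangentModel (fun q : Cotangent S => f q.proj) q)) hg).trans ?_
    refine walkerForm_inverse _ _ _ fun Y => ?_
    refine Eq.trans ?_ (mvfderiv_comp_proj hf q Y).symm
    simp
  rw [hgrad]
  constructor
  · refine (scalarExtension_self D Φ c htorsion hΦs q _ _).trans ?_
    rw [chartExtension_apply]
    simp
  · intro h0
    apply hq
    ext v
    rw [mvfderiv_eq_fderiv_chart hf]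
    exact congrArg (fun X : Plane × (Plane →L[ℝ] ℝ) => X.2 v) h0

include hD htorsion hΦ hΦs hc in
-- In Hes_f + ρ the ω-terms are (c/2)(ω⊗df + df⊗ω) + ½(ω⊗dc + dc⊗ω), which `hcf` makes zero. What
-- remains beyond (3/2) c g is Q - (c/2)Φ, zero by `hQ`.
theorem isGeneralizedQuasiEinstein_scalarExtension {f : S → ℝ} {μ : ℝ}
    (hf : ContMDiff (𝓡 2) 𝓘(ℝ) ∞ f)
    (hQ : ∀ x v w, affineQETensor D f μ x v w = c x / 2 * Φ x v w)
    (hcf : ∀ x v, mvfderiv (𝓡 2) c x v = -c x * mvfderiv (𝓡 2) f x v) :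
    IsGeneralizedQuasiEinstein (scalarExtension D Φ c) (fun q : Cotangent S => f q.proj) μ
      (fun q => 3 / 2 * c q.proj) := by
  refine ⟨contMDiff_comp_proj hf, contMDiff_const.mul (contMDiff_comp_proj hc), ?_⟩
  intro q
  have hE := isExtensionData_chart hD htorsion hΦ hΦs hc q.proj
  have hw := cotangentChart_fst_mem q
  have hL := eventually_leviCivita_congr (inChart_eventuallyEq (c := c) htorsion hΦs q)
  have hs := mem_extChartAt_source (I := 𝓡 2) q.proj
  have key (X Y : Plane × (Plane →L[ℝ] ℝ)) :
      metricHessian (scalarExtension D Φ c) (fun r : Cotangent S => f r.proj) q X Y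
        + metricRicci (scalarExtension D Φ c) q X Y
        - μ * (mvfderiv cotangentModel (fun r : Cotangent S => f r.proj) q X
          * mvfderiv cotangentModel (fun r : Cotangent S => f r.proj) q Y)
      = 3 / 2 * c q.proj * scalarExtension D Φ c q X Y := by
    have hρ : metricRicci (scalarExtension D Φ c) q X Y
      = ricci (leviCivita (walkerMetric (chartConn D q.proj) (inChart Φ q.proj)
        (c ∘ (extChartAt (𝓡 2) q.proj).symm))) (extChartAt cotangentModel q q) X Y :=
      ricci_congr hL X Y
    have hg : scalarExtension D Φ c q X Y
      = walkerMetric (chartConn D q.proj) (inChart Φ q.proj)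
        (c ∘ (extChartAt (𝓡 2) q.proj).symm) (extChartAt cotangentModel q q) X Y :=
      scalarExtension_self D Φ c htorsion hΦs q X Y
    have hB (v w : Plane) : chartQETensor D f μ q.proj (extChartAt (𝓡 2) q.proj q.proj) v w
        = c q.proj / 2 * inChart Φ q.proj (extChartAt (𝓡 2) q.proj q.proj) v w :=
      (affineQETensor_self D μ hf v w).symm.trans
        ((hQ _ v w).trans (congrArg (c q.proj / 2 * ·) (inChart_self Φ v w).symm))
    have hdc (v : Plane) : fderiv ℝ (c ∘ (extChartAt (𝓡 2) q.proj).symm)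
        (extChartAt (𝓡 2) q.proj q.proj) v = -c q.proj * fderiv ℝ
          (f ∘ (extChartAt (𝓡 2) q.proj).symm) (extChartAt (𝓡 2) q.proj q.proj) v :=
      (mvfderiv_eq_fderiv_chart hc q.proj v).symm.trans ((hcf q.proj v).trans
        (congrArg (-c q.proj * ·) (mvfderiv_eq_fderiv_chart hf q.proj v)))
    have hq := hB X.1 Y.1
    unfold chartQETensor at hq
    have h2 := hρ.trans (hE.ricci_walkerMetric hw X Y)
    rw [← hg, cotangentChart_fst hs, cotangentChart_snd_self, hdc, hdc, Function.comp_apply,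
      (extChartAt (𝓡 2) q.proj).left_inv hs] at h2
    rw [h2, metricHessian_comp_proj hD htorsion hΦ hΦs hc hf, mvfderiv_comp_proj hf,
      mvfderiv_comp_proj hf]
    linear_combination hq
  exact key

include hD htorsion hΦ hΦs hc in
theorem isSelfDualIsotropicQE_scalarExtension {f : S → ℝ} {μ : ℝ}
    (hf : ContMDiff (𝓡 2) 𝓘(ℝ) ∞ f)
    (hQ : ∀ x v w, affineQETensor D f μ x v w = c x / 2 * Φ x v w)
    (hcf : ∀ x v, mvfderiv (𝓡 2) c x v = -c x * mvfderiv (𝓡 2) f x v) :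
    IsSelfDualIsotropicQE (scalarExtension D Φ c) f μ (fun q => 3 / 2 * c q.proj) where
  metric := isNeutralMetric_scalarExtension hD htorsion hΦ hΦs hc
  walker := isWalker_scalarExtension hD htorsion hΦ hΦs hc
  selfDual := isSelfDualWalker_scalarExtension hD htorsion hΦ hΦs hc
  isotropic := isIsotropicOn_scalarExtension htorsion hΦs hf
  quasiEinstein := isGeneralizedQuasiEinstein_scalarExtension hD htorsion hΦ hΦs hc hf hQ hcf

end Geometry

/-! ### The factors c = 0 and c = C e^{-f}. -/

section Specialization

variable {S : Type*} [TopologicalSpace S] [ChartedSpace Plane S] [IsManifold (𝓡 2) ∞ S]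
  {D : CovariantDerivative (𝓡 2) Plane (TangentSpace (𝓡 2) : S → Type _)}

theorem scalarExtension_zero (Φ : Π x : S, TangentSpace (𝓡 2) x →L[ℝ] TangentSpace (𝓡 2) x →L[ℝ] ℝ) :
    scalarExtension D Φ (fun _ => 0) = deformedExtension D (fun x v w => Φ x v w) := by
  funext q
  refine ContinuousLinearMap.ext fun X => ContinuousLinearMap.ext fun Y => ?_
  refine (modifiedExtension_apply D _ _ q X Y).trans ?_
  rw [zero_mul, add_zero]

theorem IsSmoothTensor.smul {Q : Π x : S, TangentSpace (𝓡 2) x →L[ℝ] TangentSpace (𝓡 2) x →L[ℝ] ℝ}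
    (hQ : IsSmoothTensor Q) {k : S → ℝ} (hk : ContMDiff (𝓡 2) 𝓘(ℝ) ∞ k) :
    IsSmoothTensor fun x => k x • Q x := by
  intro p
  have h1 : ContDiffOn ℝ ∞ (k ∘ (extChartAt (𝓡 2) p).symm) (extChartAt (𝓡 2) p).target :=
    fun u hu => (contDiffAt_comp_chart_symm hk hu).contDiffWithinAt
  refine (h1.smul (hQ p)).congr fun u hu => ?_
  refine ContinuousLinearMap.ext fun X => ContinuousLinearMap.ext fun Y => ?_
  rfl

theorem mvfderiv_const_mul_exp_neg {f : S → ℝ} (hf : ContMDiff (𝓡 2) 𝓘(ℝ) ∞ f) (C : ℝ) (x : S)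
    (v : TangentSpace (𝓡 2) x) : mvfderiv (𝓡 2) (fun x => C * Real.exp (-f x)) x v
      = -(C * Real.exp (-f x)) * mvfderiv (𝓡 2) f x v := by
  have hc : ContMDiff (𝓡 2) 𝓘(ℝ) ∞ (fun x => C * Real.exp (-f x)) :=
    (contDiff_const.mul (Real.contDiff_exp.comp contDiff_neg)).contMDiff.comp hf
  have hd : DifferentiableAt ℝ (f ∘ (extChartAt (𝓡 2) x).symm) (extChartAt (𝓡 2) x x) :=
    (contDiffAt_comp_chart_symm hf (mem_extChartAt_target x)).differentiableAt (by simp)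
  rw [mvfderiv_eq_fderiv_chart hc, mvfderiv_eq_fderiv_chart hf]
  have k := ((hd.hasFDerivAt.neg.exp).const_mul C).fderiv
  refine (congrArg (fun L : Plane →L[ℝ] ℝ => L v) k).trans ?_
  have key (v : Plane) : (C • Real.exp (-(f ∘ (extChartAt (𝓡 2) x).symm) (extChartAt (𝓡 2) x x)) •
      -fderiv ℝ (f ∘ (extChartAt (𝓡 2) x).symm) (extChartAt (𝓡 2) x x)) v
        = -(C * Real.exp (-f x))
          * fderiv ℝ (f ∘ (extChartAt (𝓡 2) x).symm) (extChartAt (𝓡 2) x x) v := by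
    rw [Function.comp_apply, extChartAt_to_inv]
    simp only [smul_apply, neg_apply, smul_eq_mul]
    ring
  exact key v

end Specialization

end QuasiEinstein

end

/-! ### The theorem. -/

theorem theorem1p3 {S : Type*} [TopologicalSpace S] [T2Space S]
    [ChartedSpace QuasiEinstein.Plane S] [IsManifold (𝓡 2) ∞ S]
    (D : CovariantDerivative (𝓡 2) QuasiEinstein.Plane (TangentSpace (𝓡 2) : S → Type _))
    (hD : CovariantDerivative.ContMDiffCovariantDerivative D ∞) (htorsion : D.torsion = 0)
    (fh : S → ℝ) (hfh : ContMDiff (𝓡 2) 𝓘(ℝ) ∞ fh) (μ : ℝ) :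
    (∀ Φ : Π x : S, TangentSpace (𝓡 2) x →L[ℝ] TangentSpace (𝓡 2) x →L[ℝ] ℝ,
      QuasiEinstein.IsSmoothTensor Φ → (∀ x v w, Φ x v w = Φ x w v) →
      (∀ x v w, QuasiEinstein.affineQETensor D fh μ x v w = 0) →
      QuasiEinstein.IsSelfDualIsotropicQE
        (QuasiEinstein.deformedExtension D (fun x v w => Φ x v w)) fh μ (fun _ => 0)) ∧
    (∀ C : ℝ, C ≠ 0 →
      QuasiEinstein.IsSelfDualIsotropicQE
        (QuasiEinstein.modifiedExtension D
          (fun x v w => 2 / C * Real.exp (fh x) * QuasiEinstein.affineQETensor D fh μ x v w)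
          (fun x => (C * Real.exp (-fh x)) • ContinuousLinearMap.id ℝ (TangentSpace (𝓡 2) x))
          (fun x => ContinuousLinearMap.id ℝ (TangentSpace (𝓡 2) x)))
        fh μ (fun q => 3 / 2 * C * Real.exp (-fh q.proj))) := by
  refine ⟨fun Φ hΦ hΦs hQ => ?_, fun C hC => ?_⟩
  -- With c = 0 the conditions read Q = 0 and 0 = 0, and Φ is unconstrained.
  · have h := QuasiEinstein.isSelfDualIsotropicQE_scalarExtension (c := fun _ => 0) (f := fh)
      (μ := μ) hD htorsion hΦ hΦs contMDiff_const hfh (fun x v w => by rw [hQ]; simp)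
      (fun x v => by simp [mvfderiv_const])
    rw [QuasiEinstein.scalarExtension_zero, mul_zero] at h
    exact h
  -- Here Φ is built from Q, which is defined only as a function of two vectors; the general result
  -- needs it as a smooth symmetric field of bilinear forms.
  · obtain ⟨Q, hQ, hQs, hQe⟩ := QuasiEinstein.exists_affineQETensor D hD μ htorsion hfh
    have hk : ContMDiff (𝓡 2) 𝓘(ℝ) ∞ (fun x => 2 / C * Real.exp (fh x)) :=
      (contDiff_const.mul Real.contDiff_exp).contMDiff.comp hfh
    have hc : ContMDiff (𝓡 2) 𝓘(ℝ) ∞ (fun x => C * Real.exp (-fh x)) :=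
      (contDiff_const.mul (Real.contDiff_exp.comp contDiff_neg)).contMDiff.comp hfh
    have h := QuasiEinstein.isSelfDualIsotropicQE_scalarExtension (μ := μ) hD htorsion
      (hQ.smul hk) (fun x v w => congrArg (2 / C * Real.exp (fh x) * ·) (hQs x v w)) hc hfh
      (fun x v w => by
        -- The factor 2/C · e^f is the inverse of c/2, so that Q = (c/2)Φ.
        have e : C * Real.exp (-fh x) / 2 * (2 / C * Real.exp (fh x) * Q x v w) = Q x v w := by
          rw [Real.exp_neg]
          field_simp
        exact (hQe x v w).symm.trans e.symm)
      (QuasiEinstein.mvfderiv_const_mul_exp_neg hfh C)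
    have e : (fun (x : S) (v w : TangentSpace (𝓡 2) x) =>
        2 / C * Real.exp (fh x) * QuasiEinstein.affineQETensor D fh μ x v w)
          = fun x v w => ((2 / C * Real.exp (fh x)) • Q x) v w := by
      funext x v w
      exact congrArg (2 / C * Real.exp (fh x) * ·) (hQe x v w).symm
    have e' : (fun q : QuasiEinstein.Cotangent S => 3 / 2 * C * Real.exp (-fh q.proj))
        = fun q => 3 / 2 * (C * Real.exp (-fh q.proj)) := by
      funext q
      ring
    rw [e, e']
    exact h
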